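/- Let $n\ge 1$ and $1<p<\infty$. For $\alpha\in\mathbb Z^n$ write $e_\alpha(z)=z_1^{\alpha_1}\cdots z_n^{\alpha_n}$. Let $\mathscr U\subset\mathbb C^n$ be a monomial polyhedron, that is, a bounded domain of the form $$\mathscr U=\{z\in\mathbb C^n: |e_{\alpha^1}(z)|<1,\dots,|e_{\alpha^n}(z)|<1\}$$ for some $\alpha^1,\dots,\alpha^n\in\mathbb Z^n$ (points at which one of these monomials is undefined, because a coordinate with a negative exponent vanishes, do not belong to $\mathscr U$). Let $L^p(\mathscr U)$ be taken with respect to Lebesgue measure, let $A^p(\mathscr U)=L^p(\mathscr U)\cap\mathcal O(\mathscr U)$, and let $\mathcal S_p(\mathscr U)=\{\alpha\in\mathbb Z^n: e_\alpha\in A^p(\mathscr U)\}$. For $\alpha\in\mathcal S_p(\mathscr U)$ let $a_\alpha:A^p(\mathscr U)\to\mathbb C$ be the functional sending $f$ to the coefficient of $e_\alpha$ in the Laurent expansion of $f$ on $\mathscr U$ (a bounded linear functional), and let $\widetilde a_\alpha:L^p(\mathscr U)\to\mathbb C$ be its (unique) norm-preserving linear extension. The Monomial Basis Projection of $A^p(\mathscr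 U)$ is a bounded linear projection $\boldsymbol P$ from $L^p(\mathscr U)$ onto $A^p(\mathscr U)$ such that for every $f\in L^p(\mathscr U)$ $$\boldsymbol P f=\lim_{N\to\infty}\ \sum_{\alpha\in\mathcal S_p(\mathscr U),\ \max_j|\alpha_j|\le N}\widetilde a_\alpha(f)\,e_\alpha\qquad\text{in the norm of } L^p(\mathscr U).$$ Then the Monomial Basis Projection $\boldsymbol P^{\mathscr U}_{p,1}$ of $A^p(\mathscr U)$ exists and is unique; it is a bounded surjective projection operator $L^p(\mathscr U)\to A^p(\mathscr U)$. -/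

import Mathlib

open MeasureTheory Filter Topology
open scoped ENNReal

/-- The Laurent monomial `e_α(z) = z₁^α₁ ⋯ z_n^α_n`. At a point where it is not defined
(a coordinate with a negative exponent vanishes) the Lean value is meaningless; the notions below
exclude these points explicitly. -/
noncomputable def laurentMonomial {n : ℕ} (α : Fin n → ℤ) (z : Fin n → ℂ) : ℂ :=
  ∏ k, z k ^ α k

/-- The Laurent monomial of exponent `α` is defined at `z`. -/
def LaurentDefinedAt {n : ℕ} (α : Fin n → ℤ) (z : Fin n → ℂ) : Prop :=
  ∀ k, α k < 0 → z k ≠ 0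

/-- A monomial polyhedron: a bounded domain in `ℂⁿ` cut out by `n` inequalities `|e_{B j}(z)| < 1`
(the monomials being defined at `z`), where the exponents are the rows of an integer matrix. -/
structure IsMonomialPolyhedron {n : ℕ} (U : Set (Fin n → ℂ)) : Prop where
  isOpen : IsOpen U
  isConnected : IsConnected U
  isBounded : Bornology.IsBounded U
  eq_setOf : ∃ B : Matrix (Fin n) (Fin n) ℤ,
    U = {z | ∀ j, LaurentDefinedAt (B j) z ∧ ‖laurentMonomial (B j) z‖ < 1}

/-- The Bergman space `A^p(U)`, as the subspace of `L^p(U)` (Lebesgue measure on `U`) of the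
classes that contain a function holomorphic on `U`. -/
def bergmanSpace {n : ℕ} (U : Set (Fin n → ℂ)) (p : ℝ≥0∞) [Fact (1 ≤ p)] :
    Submodule ℂ (Lp ℂ p (volume.restrict U)) where
  carrier := {f | ∃ g : (Fin n → ℂ) → ℂ, DifferentiableOn ℂ g U ∧ f =ᵐ[volume.restrict U] g}
  zero_mem' := ⟨0, differentiableOn_const 0, Lp.coeFn_zero ℂ p (volume.restrict U)⟩
  add_mem' := by
    rintro f₁ f₂ ⟨g₁, h₁, e₁⟩ ⟨g₂, h₂, e₂⟩
    exact ⟨g₁ + g₂, h₁.add h₂, (Lp.coeFn_add f₁ f₂).trans (e₁.add e₂)⟩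
  smul_mem' := by
    rintro c f ⟨g, h, e⟩
    exact ⟨c • g, h.const_smul c, (Lp.coeFn_smul c f).trans (e.const_smul c)⟩

/-- The set `S_p(U)` of `p`-allowable indices: those `α ∈ ℤⁿ` for which `e_α` is holomorphic on `U`
and belongs to `L^p(U)`. (If `e_α` has a pole on the open set `U`, its Lean version is
discontinuous there.) -/
def allowableIndices {n : ℕ} (U : Set (Fin n → ℂ)) (p : ℝ≥0∞) : Set (Fin n → ℤ) :=
  {α | DifferentiableOn ℂ (laurentMonomial α) U ∧
    MemLp (laurentMonomial α) p (volume.restrict U)}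

/-- For `α ∈ S_p(U)`, the monomial `e_α` as an element of `A^p(U)`. -/
noncomputable def bergmanMonomial {n : ℕ} (U : Set (Fin n → ℂ)) (p : ℝ≥0∞) [Fact (1 ≤ p)]
    (α : allowableIndices U p) : bergmanSpace U p :=
  ⟨α.2.2.toLp (laurentMonomial α.1), laurentMonomial α.1, α.2.1, α.2.2.coeFn_toLp⟩

/-- `g = ∑_α c_α e_α` on `U`: only monomials that are holomorphic on `U` occur, the series converges
normally on every compact subset of `U`, and its sum is `g` on `U`. -/
structure HasLaurentExpansion {n : ℕ} (U : Set (Fin n → ℂ)) (g : (Fin n → ℂ) → ℂ)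
    (c : (Fin n → ℤ) → ℂ) : Prop where
  holomorphic : ∀ α, c α ≠ 0 → DifferentiableOn ℂ (laurentMonomial α) U
  normal : ∀ K ⊆ U, IsCompact K → ∃ M : (Fin n → ℤ) → ℝ, Summable M ∧
    ∀ α, ∀ z ∈ K, ‖c α * laurentMonomial α z‖ ≤ M α
  hasSum : ∀ z ∈ U, HasSum (fun α => c α * laurentMonomial α z) (g z)

/-- `a` is the `α`-th Laurent coefficient functional on `A^p(U)`: it sends `f` to the coefficient of
index `α` in the Laurent expansion of the holomorphic representative of `f`. -/
def IsLaurentCoeffFunctional {n : ℕ} (U : Set (Fin n → ℂ)) (p : ℝ≥0∞) [Fact (1 ≤ p)]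
    (α : Fin n → ℤ) (a : bergmanSpace U p →L[ℂ] ℂ) : Prop :=
  ∀ f : bergmanSpace U p, ∃ (g : (Fin n → ℂ) → ℂ) (c : (Fin n → ℤ) → ℂ),
    DifferentiableOn ℂ g U ∧ (f : Lp ℂ p (volume.restrict U)) =ᵐ[volume.restrict U] g ∧
      HasLaurentExpansion U g c ∧ a f = c α

/-- `b` is a Hahn-Banach (that is, norm-preserving) extension to `L` of the bounded functional `a`
on the subspace `A`. -/
def IsHahnBanachExtension {L : Type*} [NormedAddCommGroup L] [NormedSpace ℂ L]
    {A : Submodule ℂ L} (a : A →L[ℂ] ℂ) (b : L →L[ℂ] ℂ) : Prop :=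
  (∀ x : A, b x = a x) ∧ ‖b‖ = ‖a‖

/-- The multi-indices `α ∈ ℤⁿ` with `|α|_∞ ≤ N`. -/
noncomputable def squareIndices (n N : ℕ) : Finset (Fin n → ℤ) :=
  Fintype.piFinset fun _ => Finset.Icc (-(N : ℤ)) N

open Classical in
/-- `P` is the Monomial Basis Projection of `A^p(U)`: a bounded linear projection of `L^p(U)` onto
`A^p(U)` which is the norm limit of the square partial sums of `∑_α ã_α(f) e_α`, `α ∈ S_p(U)`, where
`ã_α` is the Hahn-Banach extension to `L^p(U)` of the `α`-th Laurent coefficient functional. -/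
structure IsMonomialBasisProjection {n : ℕ} (U : Set (Fin n → ℂ)) (p : ℝ≥0∞) [Fact (1 ≤ p)]
    (P : Lp ℂ p (volume.restrict U) →L[ℂ] bergmanSpace U p) : Prop where
  projection : ∀ f : bergmanSpace U p, P f = f
  series : ∃ b : allowableIndices U p → (Lp ℂ p (volume.restrict U) →L[ℂ] ℂ),
    (∀ α : allowableIndices U p, ∃ a : bergmanSpace U p →L[ℂ] ℂ,
      IsLaurentCoeffFunctional U p α a ∧ IsHahnBanachExtension a (b α)) ∧
    ∀ f, Tendsto (fun N : ℕ => ∑ α ∈ (squareIndices n N).subtype (· ∈ allowableIndices U p),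
      b α f • bergmanMonomial U p α) atTop (𝓝 (P f))

/-!
The logarithms of the moduli turn a monomial polyhedron `U` into an open simplicial cone: there are
linear coordinates `t = M log |z|` on which `U` (off the coordinate hyperplanes) is the set of all
`t` with positive coordinates (`HasLogCoordinates`). In these coordinates `|e_α|` is a product of
exponentials `exp (-(α A)_j t_j)` with an integer matrix `A`, and Lebesgue measure is a product of
exponential densities and of Haar measure on the torus. Hence `e_α ∈ A^p(U)` is a system of strict
linear inequalities `(α A)_j > l_j` together with sign conditions (`mem_allowableIndices_iff`), and
`‖e_α‖^{-p}` is a constant times `∏_j ((α A)_j - l_j)` (`exists_norm_bergmanMonomial_rpow_mul`).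

Laurent coefficients are torus averages: the average of `g (θ · z)` against the character of
frequency `α` is `c_α e_α(z)` (`exists_hasAngularCoeff`, `hasLaurentExpansion`). Since the norm of
`L^p` is differentiable, a functional on `A^p(U)` that attains its norm at `e_α` has only one
norm-preserving extension (`eq_of_norming`), and that of the coefficient functional is the pairing
with `conj e_α |e_α|^{p-2} / ‖e_α‖^p` (`exists_coeffFunctional`).

The heart of the matter is a bound for the square partial sums that does not depend on their order
(`exists_norm_partialSum_le`). The `N`-th partial sum is an integral operator whose kernel is a sum
over `α` of `∏_j ((α A)_j - l_j) e_α(z) conj e_α(w) |e_α(w)|^{p-2}`. For fixed moduli of `z` and `w`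
this is a Fourier multiplier of the torus. By the theorem of M. Riesz
(`exists_isMultiplier_halfLine`) and transference (`IsMultiplier.transfer`), half-spaces are
multipliers of `L^p` of the torus, hence so are functions of bounded variation of the integers
`(α A)_j` (`IsMultiplier.of_variation`), and the variation of `k ↦ (k - l) e^{-ky}` over `k > l` is
at most a multiple of `e^{-ly} / y`. With `y_j = t_j(z) + (p - 1) t_j(w)` this gives a multiplier
bound which is a product of Hilbert-type kernels (`HasLogCoordinates.exists_isMultiplier`). No
absolute convergence of the series is used: the angular cancellation is left to the multiplier
theorem, and Schur's test in the radial variables alone finishes the estimate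
(`exists_lintegral_bergmanKernel_rpow_le`).

Functions that are trigonometric polynomials on every torus orbit are dense in `L^p(U)`, and on them
the partial sums are eventually constant. With the uniform bound, and since `A^p(U)` is closed
(`isClosed_bergmanSpace`), the partial sums converge everywhere. The limit is the identity on
`A^p(U)`, because it has the same Laurent coefficients as the given function
(`eq_zero_of_coeff_eq_zero`), and it is the only Monomial Basis Projection because the extensions of
the coefficient functionals are unique.
-/

/-! ### The Riesz projection on the circle -/

open Complex AddCircle in
/-- The mean value property at the centre of the unit disc, for the Haar measure of `ℝ/ℤ`. -/
theorem integral_toCircle_of_diffContOnCl {G : ℂ → ℂ} (hG : DiffContOnCl ℂ G (Metric.ball 0 1)) :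
    ∫ t : UnitAddCircle, G (toCircle t) ∂haarAddCircle = G 0 := by
  have h0 := fourierCoeff_eq_intervalIntegral (T := 1) (fun t : UnitAddCircle => G (toCircle t)) 0 0
  simp only [fourierCoeff, neg_zero, fourier_zero, one_smul, zero_add, div_one] at h0
  rw [h0]
  have h2 := DiffContOnCl.circleAverage (f := G) (c := 0) (R := 1) (by simpa using hG)
  rw [← h2, Real.circleAverage_def]
  have h3 := intervalIntegral.smul_integral_comp_mul_left (a := 0) (b := 1)
    (fun θ => G (circleMap 0 1 θ)) (2 * Real.pi)
  simp only [mul_zero, mul_one] at h3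
  rw [← h3, smul_smul, inv_mul_cancel₀ (by positivity), one_smul]
  refine intervalIntegral.integral_congr fun x _ => ?_
  simp only [toCircle_apply_mk, circleMap]
  congr 1
  simp [Circle.coe_exp]

/-- The trigonometric inequality behind the M. Riesz theorem for `1 < P ≤ 2`: where `cos φ` is small,
`cos (P φ)` is negative and bounded away from zero. -/
theorem exists_cos_rpow_bound {P : ℝ} (h1 : 1 < P) (h2 : P ≤ 2) :
    ∃ A B : ℝ, 0 ≤ A ∧ 0 ≤ B ∧ ∀ φ : ℝ, |φ| < Real.pi / 2 →
      1 ≤ A * Real.cos φ ^ P - B * Real.cos (P * φ) := by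
  have hpi := Real.pi_pos
  -- the midpoint of `π / (2P)`, where `cos (P φ)` changes sign, and `π / 2`, where `cos φ` vanishes
  set θ : ℝ := (Real.pi / (2 * P) + Real.pi / 2) / 2 with hθ
  have hPθ : P * θ = Real.pi / 4 * (1 + P) := by rw [hθ]; field_simp; ring
  have hθ2 : θ < Real.pi / 2 := by
    have : Real.pi / (2 * P) < Real.pi / 2 := by
      apply div_lt_div_of_pos_left hpi (by norm_num); linarith
    linarith
  have hθ0 : 0 < θ := by positivity
  have hc : Real.cos (P * θ) < 0 := by
    apply Real.cos_neg_of_pi_div_two_lt_of_lt <;> rw [hPθ] <;> nlinarith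
  have hcθ : 0 < Real.cos θ := Real.cos_pos_of_mem_Ioo ⟨by linarith, hθ2⟩
  set B := 1 / (-Real.cos (P * θ)) with hB
  have hB0 : 0 ≤ B := by rw [hB]; apply div_nonneg zero_le_one; linarith
  refine ⟨(1 + B) / Real.cos θ ^ P, B, by positivity, hB0, fun φ hφ => ?_⟩
  rw [← Real.cos_abs φ, ← Real.cos_abs (P * φ), abs_mul, abs_of_pos (by linarith : 0 < P)]
  have ha := abs_nonneg φ
  generalize |φ| = ψ at *
  have hcψ : 0 < Real.cos ψ := Real.cos_pos_of_mem_Ioo ⟨by linarith, hφ⟩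
  rcases le_total ψ θ with h | h
  · have : Real.cos θ ^ P ≤ Real.cos ψ ^ P :=
      Real.rpow_le_rpow hcθ.le (Real.cos_le_cos_of_nonneg_of_le_pi ha (by linarith) h) (by linarith)
    have h3 : 1 + B ≤ (1 + B) / Real.cos θ ^ P * Real.cos ψ ^ P := by
      rw [div_mul_eq_mul_div, le_div_iff₀ (by positivity)]
      gcongr
    have := Real.cos_le_one (P * ψ)
    nlinarith
  · have h3 : Real.cos (P * ψ) ≤ Real.cos (P * θ) := by
      apply Real.cos_le_cos_of_nonneg_of_le_pi (by positivity) (by nlinarith)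
      gcongr
    have h4 : 1 ≤ B * (-Real.cos (P * ψ)) := by
      rw [hB, div_mul_eq_mul_div, le_div_iff₀ (by linarith)]
      linarith
    have : 0 ≤ (1 + B) / Real.cos θ ^ P * Real.cos ψ ^ P := by positivity
    linarith

/-- On the right half-plane `|z|^P` is dominated by `(Re z)^P` up to the real part of the
holomorphic function `z^P`, whose mean over a circle is known. -/
theorem exists_norm_rpow_le_re {P : ℝ} (h1 : 1 < P) (h2 : P ≤ 2) :
    ∃ A B : ℝ, 0 ≤ A ∧ 0 ≤ B ∧ ∀ z : ℂ, 0 < z.re →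
      ‖z‖ ^ P ≤ A * z.re ^ P - B * (z ^ (P : ℂ)).re := by
  obtain ⟨A, B, hA, hB, h⟩ := exists_cos_rpow_bound h1 h2
  refine ⟨A, B, hA, hB, fun z hz => ?_⟩
  have hz0 : z ≠ 0 := by rintro rfl; simp at hz
  have harg := Complex.abs_arg_lt_pi_div_two_iff.2 (Or.inl hz)
  have h3 := h _ harg
  have e1 : (z ^ (P : ℂ)).re = ‖z‖ ^ P * Real.cos (P * z.arg) := by
    have := Complex.norm_mul_exp_arg_mul_I (z ^ (P : ℂ))
    rw [Complex.cpow_def_of_ne_zero hz0, Complex.log]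
    rw [show ((Real.log ‖z‖ : ℂ) + z.arg * Complex.I) * P
      = ((Real.log ‖z‖ * P : ℝ) : ℂ) + ((P * z.arg : ℝ) : ℂ) * Complex.I by push_cast; ring]
    rw [Complex.exp_add, ← Complex.ofReal_exp, Complex.re_ofReal_mul, Complex.exp_ofReal_mul_I_re,
      Real.rpow_def_of_pos (norm_pos_iff.2 hz0)]
  have e2 : z.re ^ P = ‖z‖ ^ P * Real.cos z.arg ^ P := by
    rw [← Real.mul_rpow (norm_nonneg _)
      (Real.cos_nonneg_of_mem_Icc ⟨by linarith [neg_abs_le z.arg], by linarith [le_abs_self z.arg]⟩),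
      Complex.norm_mul_cos_arg]
  rw [e1, e2]
  have : 0 ≤ ‖z‖ ^ P := by positivity
  nlinarith

/-- The trigonometric polynomial on the circle with coefficients `c`. -/
noncomputable def trigPoly : (ℤ →₀ ℂ) →ₗ[ℂ] C(UnitAddCircle, ℂ) :=
  Finsupp.linearCombination ℂ (fun k => fourier k)

theorem trigPoly_apply (c : ℤ →₀ ℂ) (t : UnitAddCircle) :
    trigPoly c t = c.sum fun k a => a * fourier k t := by
  simp only [trigPoly, Finsupp.linearCombination_apply, Finsupp.sum, ContinuousMap.coe_sum,
    Finset.sum_apply, ContinuousMap.coe_smul, Pi.smul_apply, smul_eq_mul]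

theorem fourierCoeff_trigPoly (c : ℤ →₀ ℂ) (k : ℤ) : fourierCoeff (trigPoly c) k = c k := by
  have h : (trigPoly c : UnitAddCircle → ℂ) = ∑ i ∈ c.support, (c i) • ⇑(fourier (T := 1) i) := by
    ext t; simp [trigPoly_apply, Finsupp.sum]
  rw [h, fourierCoeff.sum]
  · simp only [Finset.sum_apply, fourierCoeff.const_smul, fourierCoeff_fourier]
    simp [Pi.single_apply, eq_comm]
  · intro i _
    exact ((map_continuous (fourier (T := 1) i)).const_smul (c i)).integrable_of_hasCompactSupport
      (HasCompactSupport.of_compactSpace _)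

theorem dense_range_trigPoly : DenseRange trigPoly := by
  have := span_fourier_closure_eq_top (T := 1)
  rw [← Finsupp.range_linearCombination, ← Submodule.dense_iff_topologicalClosure_eq_top] at this
  exact this

section Lp
variable {X : Type*} [TopologicalSpace X] [CompactSpace X] [MeasurableSpace X] [BorelSpace X]
  (μ : Measure X)

theorem ContinuousMap.norm_toLp_rpow [IsFiniteMeasure μ] (p : ℝ≥0∞) [hp1 : Fact (1 ≤ p)]
    (hp : p ≠ ⊤) (f : C(X, ℂ)) :
    ‖ContinuousMap.toLp (E := ℂ) p μ ℂ f‖ ^ p.toReal = ∫ x, ‖f x‖ ^ p.toReal ∂μ := by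
  have h0 : p ≠ 0 := (zero_lt_one.trans_le hp1.out).ne'
  have hP : 0 < p.toReal := ENNReal.toReal_pos h0 hp
  rw [Lp.norm_def, eLpNorm_congr_ae (ContinuousMap.coeFn_toLp μ f),
    MemLp.eLpNorm_eq_integral_rpow_norm h0 hp, ENNReal.toReal_ofReal (by positivity),
    ← Real.rpow_mul (by positivity), inv_mul_cancel₀ hP.ne', Real.rpow_one]
  exact (Lp.memLp (ContinuousMap.toLp (E := ℂ) p μ ℂ f)).ae_eq (ContinuousMap.coeFn_toLp μ f)

theorem ContinuousMap.norm_toLp_le_norm [IsProbabilityMeasure μ] (p : ℝ≥0∞) [Fact (1 ≤ p)]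
    (f : C(X, ℂ)) : ‖ContinuousMap.toLp (E := ℂ) p μ ℂ f‖ ≤ ‖f‖ := by
  have := Lp.norm_le_of_ae_bound (f := ContinuousMap.toLp (E := ℂ) p μ ℂ f) (norm_nonneg f)
    ((ContinuousMap.coeFn_toLp μ f).mono fun x hx => by rw [hx]; exact f.norm_coe_le_norm x)
  simpa [measureUnivNNReal] using this

theorem ContinuousMap.norm_toLp_mono_exponent [IsProbabilityMeasure μ] {p q : ℝ≥0∞}
    [Fact (1 ≤ p)] [Fact (1 ≤ q)] (hpq : p ≤ q) (f : C(X, ℂ)) :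
    ‖ContinuousMap.toLp (E := ℂ) p μ ℂ f‖ ≤ ‖ContinuousMap.toLp (E := ℂ) q μ ℂ f‖ := by
  rw [Lp.norm_def, Lp.norm_def]
  refine ENNReal.toReal_mono (Lp.eLpNorm_ne_top _) ?_
  rw [eLpNorm_congr_ae (ContinuousMap.coeFn_toLp μ f),
    eLpNorm_congr_ae (ContinuousMap.coeFn_toLp μ f)]
  exact eLpNorm_le_eLpNorm_of_exponent_le hpq f.continuous.aestronglyMeasurable

theorem ContinuousMap.norm_integral_le_norm_toLp [IsProbabilityMeasure μ] (p : ℝ≥0∞)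
    [hp : Fact (1 ≤ p)] (f : C(X, ℂ)) : ‖∫ x, f x ∂μ‖ ≤ ‖ContinuousMap.toLp (E := ℂ) p μ ℂ f‖ := by
  refine le_trans ?_ (ContinuousMap.norm_toLp_mono_exponent μ hp.out f)
  have := ContinuousMap.norm_toLp_rpow μ 1 ENNReal.one_ne_top f
  simp only [ENNReal.toReal_one, Real.rpow_one] at this
  rw [this]
  exact norm_integral_le_integral_norm _

theorem ContinuousMap.norm_toLp_le_of_forall_norm_le [IsFiniteMeasure μ] (p : ℝ≥0∞) [Fact (1 ≤ p)]
    {f g : C(X, ℂ)} (h : ∀ x, ‖f x‖ ≤ ‖g x‖) :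
    ‖ContinuousMap.toLp (E := ℂ) p μ ℂ f‖ ≤ ‖ContinuousMap.toLp (E := ℂ) p μ ℂ g‖ := by
  refine Lp.norm_le_norm_of_ae_le ?_
  filter_upwards [ContinuousMap.coeFn_toLp (p := p) (𝕜 := ℂ) μ f,
    ContinuousMap.coeFn_toLp (p := p) (𝕜 := ℂ) μ g] with x hx hy
  rw [hx, hy]; exact h x

end Lp

/-- The part of a trigonometric polynomial with frequencies `k ≥ 0`. -/
noncomputable def nonnegPart : (ℤ →₀ ℂ) →ₗ[ℂ] (ℤ →₀ ℂ) where
  toFun c := c.filter (0 ≤ ·)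
  map_add' _ _ := Finsupp.filter_add
  map_smul' _ _ := Finsupp.filter_smul

theorem nonnegPart_apply (c : ℤ →₀ ℂ) (k : ℤ) :
    nonnegPart c k = if 0 ≤ k then c k else 0 := by
  simp [nonnegPart, Finsupp.filter_apply]

theorem sum_nonnegPart (c : ℤ →₀ ℂ) (φ : ℤ → ℂ) :
    ((nonnegPart c).sum fun k a => a * φ k) = ∑ k ∈ c.support with 0 ≤ k, c k * φ k := by
  rw [Finsupp.sum_of_support_subset (s := c.support)]
  · simp only [nonnegPart_apply, Finset.sum_filter, ite_mul, zero_mul]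
  · intro k; simp only [Finsupp.mem_support_iff, nonnegPart_apply]; intro h; split_ifs at h <;> simp_all
  · simp

theorem coeff_neg_of_real {c : ℤ →₀ ℂ} (hc : ∀ t, (trigPoly c t).im = 0) (k : ℤ) :
    c (-k) = (starRingEnd ℂ) (c k) := by
  rw [← fourierCoeff_trigPoly, ← fourierCoeff_trigPoly, fourierCoeff, fourierCoeff, ← integral_conj]
  congr 1; ext t
  have : (starRingEnd ℂ) (trigPoly c t) = trigPoly c t := Complex.conj_eq_iff_im.2 (hc t)
  simp [this]

/-- For a real trigonometric polynomial `f`, twice the nonnegative part minus the mean is the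
analytic completion of `f`: its real part is `f`. -/
theorem re_two_mul_nonnegPart {c : ℤ →₀ ℂ} (hc : ∀ t, (trigPoly c t).im = 0) (t : UnitAddCircle) :
    (2 * trigPoly (nonnegPart c) t - c 0).re = (trigPoly c t).re := by
  have h1 : trigPoly c t + c 0 = trigPoly (nonnegPart c) t
      + (starRingEnd ℂ) (trigPoly (nonnegPart c) t) := by
    set N : ℕ := c.support.sup Int.natAbs
    set s := Finset.Icc (-(N : ℤ)) N
    have hs : ∀ k, c k ≠ 0 → k ∈ s := fun k hk => by
      have : k.natAbs ≤ N := Finset.le_sup (f := Int.natAbs) (by simpa using hk)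
      simp only [s, Finset.mem_Icc]; omega
    have e1 : trigPoly c t = ∑ k ∈ s, c k * fourier k t := by
      rw [trigPoly_apply, Finsupp.sum_of_support_subset (s := s)]
      · intro k hk; exact hs k (by simpa using hk)
      · simp
    have e2 : trigPoly (nonnegPart c) t = ∑ k ∈ s, (if 0 ≤ k then c k * fourier k t else 0) := by
      rw [trigPoly_apply, Finsupp.sum_of_support_subset (s := s)]
      · simp only [nonnegPart_apply, ite_mul, zero_mul]
      · intro k hk
        apply hs k
        intro h; simp [nonnegPart_apply, h] at hk
      · simp
    have e3 : (starRingEnd ℂ) (trigPoly (nonnegPart c) t)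
        = ∑ k ∈ s, (if k ≤ 0 then c k * fourier k t else 0) := by
      rw [e2, map_sum]
      refine Finset.sum_nbij' (fun k => -k) (fun k => -k) ?_ ?_ ?_ ?_ ?_
      · intro k; simp only [s, Finset.mem_Icc]; omega
      · intro k; simp only [s, Finset.mem_Icc]; omega
      · simp
      · simp
      · intro k _
        rw [coeff_neg_of_real hc, fourier_neg]
        split_ifs <;> first | (simp; done) | omega
    have h0 : (0 : ℤ) ∈ s := by simp [s]
    have e4 : c 0 = ∑ k ∈ s, (if k = 0 then c k * fourier k t else 0) := by
      simp [Finset.sum_ite_eq', h0]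
    rw [e3, e2, e1, e4, ← Finset.sum_add_distrib, ← Finset.sum_add_distrib]
    refine Finset.sum_congr rfl fun k _ => ?_
    rcases lt_trichotomy k 0 with h | h | h
    · simp [h.ne, h.le, not_le.2 h]
    · simp [h]
    · simp [h.ne', h.le, not_le.2 h]
  have h2 := congrArg Complex.re h1
  simp only [Complex.add_re, Complex.conj_re] at h2
  simp only [Complex.sub_re, Complex.mul_re, Complex.re_ofNat, Complex.im_ofNat]
  linarith

open AddCircle Complex in
/-- For a positive trigonometric polynomial the analytic completion `F` maps the disc to the right
half-plane. The pointwise bound `|F|^P ≤ A (Re F)^P - B Re F^P` is integrated over the circle, and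
the mean of `F^P` is `F(0)^P ≥ 0`. -/
theorem integral_norm_rpow_le_of_pos {P : ℝ} (h1 : 1 < P) {A B : ℝ} (hB : 0 ≤ B)
    (hAB : ∀ z : ℂ, 0 < z.re → ‖z‖ ^ P ≤ A * z.re ^ P - B * (z ^ (P : ℂ)).re)
    {c : ℤ →₀ ℂ} (him : ∀ t, (trigPoly c t).im = 0) (hre : ∀ t, 0 < (trigPoly c t).re) :
    ∫ t, ‖2 * trigPoly (nonnegPart c) t - c 0‖ ^ P ∂haarAddCircle ≤
      A * ∫ t, ‖trigPoly c t‖ ^ P ∂haarAddCircle := by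
  set F : ℂ → ℂ := fun z => 2 * (∑ k ∈ c.support with 0 ≤ k, c k * z ^ k.toNat) - c 0 with hF
  have hFd : Differentiable ℂ F := by
    refine ((Differentiable.const_mul ?_ _).sub_const _)
    fun_prop
  have hFt : ∀ t : UnitAddCircle, F (toCircle t) = 2 * trigPoly (nonnegPart c) t - c 0 := by
    intro t
    rw [trigPoly_apply, sum_nonnegPart, hF]
    simp only
    congr 2
    refine Finset.sum_congr rfl fun k hk => ?_
    have hk0 := (Finset.mem_filter.1 hk).2
    rw [fourier_apply, toCircle_zsmul]
    obtain ⟨m, rfl⟩ := Int.eq_ofNat_of_zero_le hk0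
    simp
  have hFre : ∀ t : UnitAddCircle, (F (toCircle t)).re = (trigPoly c t).re := fun t => by
    rw [hFt, re_two_mul_nonnegPart him]
  obtain ⟨t0, -, ht0⟩ := isCompact_univ.exists_isMinOn (Set.univ_nonempty (α := UnitAddCircle))
    (f := fun t => (trigPoly c t).re) (by fun_prop)
  set m := (trigPoly c t0).re with hm
  have hm0 : 0 < m := hre t0
  have hFm : ∀ z ∈ Metric.closedBall (0 : ℂ) 1, m ≤ (F z).re := by
    intro z hz
    -- the maximum principle for `exp (-F)` carries the lower bound of `Re F` into the disc
    have h := Complex.norm_le_of_forall_mem_frontier_norm_le (U := Metric.ball (0 : ℂ) 1)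
      (f := fun z => Complex.exp (-F z)) (C := Real.exp (-m)) Metric.isBounded_ball
      (hFd.neg.cexp.diffContOnCl) ?_ (z := z) (by rwa [closure_ball _ one_ne_zero])
    · rw [Complex.norm_exp, Real.exp_le_exp, Complex.neg_re] at h
      linarith
    · intro w hw
      rw [frontier_ball _ one_ne_zero, mem_sphere_zero_iff_norm] at hw
      obtain ⟨t, ht⟩ := (AddCircle.homeomorphCircle (T := 1) one_ne_zero).surjective
        (⟨w, mem_sphere_zero_iff_norm.2 hw⟩ : Circle)
      rw [AddCircle.homeomorphCircle_apply] at ht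
      have hw' : w = (toCircle t : ℂ) := by rw [ht]
      rw [hw', Complex.norm_exp, Real.exp_le_exp, Complex.neg_re, hFre]
      exact neg_le_neg (ht0 (Set.mem_univ t))
  have hGd : DiffContOnCl ℂ (fun z => F z ^ (P : ℂ)) (Metric.ball 0 1) := by
    apply DifferentiableOn.diffContOnCl
    rw [closure_ball _ one_ne_zero]
    intro z hz
    refine ((hFd z).cpow_const (Or.inl ?_)).differentiableWithinAt
    exact hm0.trans_le (hFm z hz)
  have hF0 : F 0 = c 0 := by
    have h0 := integral_toCircle_of_diffContOnCl hFd.diffContOnCl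
    simp_rw [hFt] at h0
    rw [← h0, integral_sub, integral_const_mul]
    · have := fourierCoeff_trigPoly (nonnegPart c) 0
      simp only [fourierCoeff, neg_zero, fourier_zero, one_smul, nonnegPart_apply, le_refl,
        if_true] at this
      rw [this]; simp; ring
    · exact (((trigPoly (nonnegPart c)).continuous).const_mul _ ).integrable_of_hasCompactSupport
        (HasCompactSupport.of_compactSpace _)
    · exact integrable_const _
  have hc0 : ((c 0) : ℂ) = ((c 0).re : ℂ) ∧ 0 < (c 0).re := by
    have := coeff_neg_of_real him 0
    rw [neg_zero] at this
    refine ⟨(Complex.conj_eq_iff_re.1 this.symm).symm, ?_⟩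
    rw [← hF0]; exact hm0.trans_le (hFm 0 (by simp))
  have hmean := integral_toCircle_of_diffContOnCl hGd
  have hcont : Continuous fun t : UnitAddCircle => F (toCircle t) :=
    hFd.continuous.comp (by fun_prop)
  have hcontG : Continuous fun t : UnitAddCircle => F (toCircle t) ^ (P : ℂ) := by
    refine hcont.cpow continuous_const fun t => Or.inl ?_
    rw [hFre]; exact hre t
  have hint : ∀ {f : UnitAddCircle → ℝ}, Continuous f → Integrable f haarAddCircle := fun h =>
    h.integrable_of_hasCompactSupport (HasCompactSupport.of_compactSpace _)
  have hmean' : 0 ≤ ∫ t : UnitAddCircle, (F (toCircle t) ^ (P : ℂ)).re ∂haarAddCircle := by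
    have h3 := integral_re (𝕜 := ℂ) (hcontG.integrable_of_hasCompactSupport (μ := haarAddCircle)
      (HasCompactSupport.of_compactSpace _))
    simp only [RCLike.re_eq_complex_re] at h3
    rw [h3, hmean, hF0, hc0.1, ← Complex.ofReal_cpow hc0.2.le, Complex.ofReal_re]
    exact Real.rpow_nonneg hc0.2.le _
  have hP0 : 0 ≤ P := by linarith
  calc ∫ t, ‖2 * trigPoly (nonnegPart c) t - c 0‖ ^ P ∂haarAddCircle
      = ∫ t : UnitAddCircle, ‖F (toCircle t)‖ ^ P ∂haarAddCircle := by simp_rw [hFt]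
    _ ≤ ∫ t : UnitAddCircle, (A * ‖trigPoly c t‖ ^ P - B * (F (toCircle t) ^ (P : ℂ)).re) ∂haarAddCircle := by
        refine integral_mono (hint (hcont.norm.rpow_const fun _ => Or.inr hP0)) (hint ?_) fun t => ?_
        · refine (continuous_const.mul ((trigPoly c).continuous.norm.rpow_const fun _ => Or.inr hP0)).sub
            (continuous_const.mul (Complex.continuous_re.comp hcontG))
        · have := hAB (F (toCircle t)) (by rw [hFre]; exact hre t)
          rw [hFre] at this
          have e : ‖trigPoly c t‖ = (trigPoly c t).re := by
            conv_lhs => rw [← Complex.re_add_im (trigPoly c t), him t]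
            simp [abs_of_pos (hre t)]
          simp only [e]; exact this
    _ = A * (∫ t, ‖trigPoly c t‖ ^ P ∂haarAddCircle)
        - B * ∫ t : UnitAddCircle, (F (toCircle t) ^ (P : ℂ)).re ∂haarAddCircle := by
        rw [integral_sub, integral_const_mul, integral_const_mul]
        · exact hint (continuous_const.mul ((trigPoly c).continuous.norm.rpow_const fun _ => Or.inr hP0))
        · exact hint (continuous_const.mul (Complex.continuous_re.comp hcontG))
    _ ≤ _ := by nlinarith

/-- The class in `L^p` of the circle of a trigonometric polynomial. -/
noncomputable def trigLp (p : ℝ≥0∞) [Fact (1 ≤ p)] :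
    (ℤ →₀ ℂ) →ₗ[ℂ] Lp ℂ p (AddCircle.haarAddCircle (T := 1)) :=
  (ContinuousMap.toLp (E := ℂ) p AddCircle.haarAddCircle ℂ).toLinearMap ∘ₗ trigPoly

theorem trigLp_apply (p : ℝ≥0∞) [Fact (1 ≤ p)] (c : ℤ →₀ ℂ) :
    trigLp p c = ContinuousMap.toLp (E := ℂ) p AddCircle.haarAddCircle ℂ (trigPoly c) := rfl

/-- The Riesz projection is bounded on positive trigonometric polynomials, `1 < p ≤ 2`. -/
theorem exists_norm_nonnegPart_le_of_pos {p : ℝ≥0∞} [Fact (1 ≤ p)] (h1 : 1 < p) (h2 : p ≤ 2) :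
    ∃ C : ℝ, 0 ≤ C ∧ ∀ c : ℤ →₀ ℂ, (∀ t, (trigPoly c t).im = 0) → (∀ t, 0 < (trigPoly c t).re) →
      ‖trigLp p (nonnegPart c)‖ ≤ C * ‖trigLp p c‖ := by
  have hpt : p ≠ ⊤ := (h2.trans_lt (by norm_num)).ne
  have hP1 : 1 < p.toReal := by
    rw [← ENNReal.toReal_one]; exact (ENNReal.toReal_lt_toReal (by norm_num) hpt).2 h1
  have hP2 : p.toReal ≤ 2 := by
    simpa using ENNReal.toReal_mono (by norm_num) h2
  obtain ⟨A, B, hA, hB, hAB⟩ := exists_norm_rpow_le_re hP1 hP2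
  set P := p.toReal
  have hP0 : 0 < P := by linarith
  refine ⟨(A ^ P⁻¹ + 1) / 2, by positivity, fun c him hre => ?_⟩
  set f : C(UnitAddCircle, ℂ) := (2 : ℂ) • trigPoly (nonnegPart c) - ContinuousMap.const _ (c 0)
  have hf : ‖ContinuousMap.toLp (E := ℂ) p AddCircle.haarAddCircle ℂ f‖
      ≤ A ^ P⁻¹ * ‖trigLp p c‖ := by
    have h := integral_norm_rpow_le_of_pos hP1 hB hAB him hre
    rw [trigLp_apply, ← Real.rpow_le_rpow_iff (z := P) (by positivity) (by positivity) hP0,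
      Real.mul_rpow (by positivity) (by positivity), ← Real.rpow_mul hA, inv_mul_cancel₀ hP0.ne',
      Real.rpow_one, ContinuousMap.norm_toLp_rpow _ _ hpt, ContinuousMap.norm_toLp_rpow _ _ hpt]
    exact h
  have hc0 : ‖c 0‖ ≤ ‖trigLp p c‖ := by
    rw [← fourierCoeff_trigPoly c 0, trigLp_apply]
    refine le_trans (le_of_eq ?_) (ContinuousMap.norm_integral_le_norm_toLp _ p _)
    simp [fourierCoeff]
  have hk : ‖ContinuousMap.toLp (E := ℂ) p (AddCircle.haarAddCircle (T := 1)) ℂ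
      (ContinuousMap.const _ (c 0))‖ ≤ ‖c 0‖ := by
    refine (ContinuousMap.norm_toLp_le_norm _ p _).trans ?_
    exact (ContinuousMap.norm_le _ (norm_nonneg _)).2 fun _ => le_rfl
  have e : (2 : ℂ) • trigLp p (nonnegPart c) =
      ContinuousMap.toLp (E := ℂ) p AddCircle.haarAddCircle ℂ f +
      ContinuousMap.toLp (E := ℂ) p AddCircle.haarAddCircle ℂ (ContinuousMap.const _ (c 0)) := by
    rw [← map_add, trigLp_apply, ← map_smul]
    congr 1
    simp [f]
  have h4 : 2 * ‖trigLp p (nonnegPart c)‖ ≤ (A ^ P⁻¹ + 1) * ‖trigLp p c‖ := by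
    have := congrArg norm e
    rw [norm_smul] at this
    simp only [RCLike.norm_ofNat] at this
    rw [this]
    refine (norm_add_le _ _).trans ?_
    linarith
  linarith

/-- In `L²` the Riesz projection is a contraction, by Parseval. -/
theorem norm_trigLp_two_nonnegPart_le (c : ℤ →₀ ℂ) :
    ‖trigLp 2 (nonnegPart c)‖ ≤ ‖trigLp 2 c‖ := by
  have key : ∀ d : ℤ →₀ ℂ, HasSum (fun k => ‖d k‖ ^ 2) (‖trigLp 2 d‖ ^ 2) := by
    intro d
    have h := hasSum_sq_fourierCoeff (trigLp 2 d)
    rw [trigLp_apply]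
    have h2 := ContinuousMap.norm_toLp_rpow (AddCircle.haarAddCircle (T := 1)) 2 (by norm_num)
      (trigPoly d)
    simp only [ENNReal.toReal_ofNat, Real.rpow_ofNat] at h2
    rw [h2]
    convert! h using 1
    · ext k
      rw [trigLp_apply, fourierCoeff_toLp, fourierCoeff_trigPoly]
    · refine integral_congr_ae ?_
      filter_upwards [ContinuousMap.coeFn_toLp (p := 2) (𝕜 := ℂ) AddCircle.haarAddCircle
        (trigPoly d)] with t ht
      rw [trigLp_apply, ht]
  refine (sq_le_sq₀ (norm_nonneg _) (norm_nonneg _)).1 (hasSum_le ?_ (key _) (key _))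
  intro k
  rw [nonnegPart_apply]
  split_ifs <;> simp

/-- Real trigonometric polynomials with positive values approximate nonnegative functions. -/
theorem exists_trigPoly_pos_near (g : C(UnitAddCircle, ℝ)) (hg : ∀ t, 0 ≤ g t) {ε : ℝ}
    (hε : 0 < ε) : ∃ d : ℤ →₀ ℂ, (∀ t, (trigPoly d t).im = 0) ∧ (∀ t, 0 < (trigPoly d t).re) ∧
      ∀ t, ‖trigPoly d t - g t‖ ≤ ε := by
  -- the shift by `ε / 2` leaves room for a positive real part after approximation up to `ε / 4`
  set G : C(UnitAddCircle, ℂ) := ⟨fun t => ((g t + ε / 2 : ℝ) : ℂ), by fun_prop⟩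
  obtain ⟨e, he⟩ := dense_range_trigPoly.exists_dist_lt G (ε := ε / 4) (by positivity)
  -- the coefficients of the real part of `trigPoly e`
  set d : ℤ →₀ ℂ := (1 / 2 : ℂ) • (e + e.sum fun k a => Finsupp.single (-k) ((starRingEnd ℂ) a))
  have hd : ∀ t, trigPoly d t = ((trigPoly e t).re : ℂ) := by
    intro t
    have h1 : trigPoly (e.sum fun k a => Finsupp.single (-k) ((starRingEnd ℂ) a)) t
        = (starRingEnd ℂ) (trigPoly e t) := by
      rw [trigPoly_apply e, Finsupp.sum, map_sum, Finsupp.sum, map_sum]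
      simp [trigPoly]
    simp only [d, map_smul, map_add, ContinuousMap.smul_apply, ContinuousMap.add_apply, h1,
      Complex.add_conj, smul_eq_mul]
    push_cast; ring
  have hdist : ∀ t, |(trigPoly e t).re - (g t + ε / 2)| < ε / 4 := by
    intro t
    have h1 := (ContinuousMap.dist_apply_le_dist t).trans_lt he
    rw [dist_comm, Complex.dist_eq] at h1
    refine lt_of_le_of_lt ?_ h1
    have := Complex.abs_re_le_norm (trigPoly e t - G t)
    simpa [G] using this
  refine ⟨d, fun t => by rw [hd]; simp, fun t => ?_, fun t => ?_⟩
  · rw [hd, Complex.ofReal_re]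
    have := abs_lt.1 (hdist t); have := hg t; linarith
  · rw [hd, ← Complex.ofReal_sub, Complex.norm_real, Real.norm_eq_abs, abs_le]
    have := abs_lt.1 (hdist t)
    constructor <;> linarith

/-- A trigonometric polynomial is a combination of four positive ones up to a uniformly small
remainder, which the `L²` bound controls since `p ≤ 2`. -/
theorem exists_norm_nonnegPart_le_of_le_two {p : ℝ≥0∞} [Fact (1 ≤ p)] (h1 : 1 < p) (h2 : p ≤ 2) :
    ∃ C : ℝ, 0 ≤ C ∧ ∀ c : ℤ →₀ ℂ, ‖trigLp p (nonnegPart c)‖ ≤ C * ‖trigLp p c‖ := by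
  obtain ⟨C, hC, hpos⟩ := exists_norm_nonnegPart_le_of_pos h1 h2
  refine ⟨4 * C, by positivity, fun c => ?_⟩
  have key : ∀ ε > 0, ‖trigLp p (nonnegPart c)‖ ≤ 4 * C * ‖trigLp p c‖ + (4 * C + 4) * ε := by
    intro ε hε
    -- each of the four nonnegative parts is replaced by a positive trigonometric polynomial
    have part : ∀ φ : ℂ → ℝ, Continuous φ → (∀ z, 0 ≤ φ z) → (∀ z, φ z ≤ ‖z‖) →
        ∃ d : ℤ →₀ ℂ, ‖trigLp p (nonnegPart d)‖ ≤ C * (‖trigLp p c‖ + ε) ∧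
          ∀ t, ‖trigPoly d t - φ (trigPoly c t)‖ ≤ ε := by
      intro φ hφ h0 hle
      obtain ⟨d, him, hre, hd⟩ := exists_trigPoly_pos_near
        ⟨fun t => φ (trigPoly c t), by fun_prop⟩ (fun t => h0 _) hε
      refine ⟨d, (hpos d him hre).trans ?_, hd⟩
      gcongr
      set g : C(UnitAddCircle, ℂ) := ⟨fun t => (φ (trigPoly c t) : ℂ), by fun_prop⟩
      have e : trigLp p d = ContinuousMap.toLp (E := ℂ) p AddCircle.haarAddCircle ℂ g +
          ContinuousMap.toLp (E := ℂ) p AddCircle.haarAddCircle ℂ (trigPoly d - g) := by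
        rw [← map_add, add_sub_cancel, trigLp_apply]
      rw [e]
      refine (norm_add_le _ _).trans (add_le_add ?_ ?_)
      · refine ContinuousMap.norm_toLp_le_of_forall_norm_le _ p fun t => ?_
        simpa [g, abs_of_nonneg (h0 _)] using hle _
      · exact (ContinuousMap.norm_toLp_le_norm _ p _).trans
          ((ContinuousMap.norm_le _ hε.le).2 fun t => hd t)
    obtain ⟨d₁, b₁, a₁⟩ := part (fun z => max z.re 0) (by fun_prop) (fun z => le_max_right _ _)
      (fun z => max_le ((le_abs_self _).trans (Complex.abs_re_le_norm z)) (norm_nonneg z))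
    obtain ⟨d₂, b₂, a₂⟩ := part (fun z => max (-z.re) 0) (by fun_prop) (fun z => le_max_right _ _)
      (fun z => max_le ((neg_le_abs _).trans (Complex.abs_re_le_norm z)) (norm_nonneg z))
    obtain ⟨d₃, b₃, a₃⟩ := part (fun z => max z.im 0) (by fun_prop) (fun z => le_max_right _ _)
      (fun z => max_le ((le_abs_self _).trans (Complex.abs_im_le_norm z)) (norm_nonneg z))
    obtain ⟨d₄, b₄, a₄⟩ := part (fun z => max (-z.im) 0) (by fun_prop) (fun z => le_max_right _ _)
      (fun z => max_le ((neg_le_abs _).trans (Complex.abs_im_le_norm z)) (norm_nonneg z))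
    set r : ℤ →₀ ℂ := c - (d₁ - d₂ + Complex.I • (d₃ - d₄)) with hr
    have hrt : ∀ t, ‖trigPoly r t‖ ≤ 4 * ε := by
      intro t
      have e : trigPoly r t = -(trigPoly d₁ t - (max (trigPoly c t).re 0 : ℝ)) +
          (trigPoly d₂ t - (max (-(trigPoly c t).re) 0 : ℝ)) +
          -(Complex.I * (trigPoly d₃ t - (max (trigPoly c t).im 0 : ℝ))) +
          Complex.I * (trigPoly d₄ t - (max (-(trigPoly c t).im) 0 : ℝ)) := by
        have hs : ∀ x : ℝ, x = max x 0 - max (-x) 0 := fun x => by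
          rcases le_total 0 x with h | h
          · rw [max_eq_left h, max_eq_right (by linarith)]; ring
          · rw [max_eq_right h, max_eq_left (by linarith)]; ring
        have h3 : trigPoly c t = ((max (trigPoly c t).re 0 : ℝ) - (max (-(trigPoly c t).re) 0 : ℝ))
            + Complex.I * ((max (trigPoly c t).im 0 : ℝ) - (max (-(trigPoly c t).im) 0 : ℝ)) := by
          rw [← Complex.ofReal_sub, ← Complex.ofReal_sub, ← hs, ← hs, mul_comm,
            Complex.re_add_im]
        simp only [hr, map_sub, map_add, map_smul, ContinuousMap.sub_apply,
          ContinuousMap.add_apply, ContinuousMap.smul_apply, smul_eq_mul]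
        linear_combination h3
      rw [e]
      refine (norm_add_le_of_le (norm_add_le_of_le (norm_add_le_of_le (r₁ := ε) (r₂ := ε) ?_ ?_)
        (r₂ := ε) ?_) (r₂ := ε) ?_).trans (by linarith)
      · rw [norm_neg]; exact a₁ t
      · exact a₂ t
      · rw [norm_neg, norm_mul, Complex.norm_I, one_mul]; exact a₃ t
      · rw [norm_mul, Complex.norm_I, one_mul]; exact a₄ t
    have hrn : ‖trigLp p (nonnegPart r)‖ ≤ 4 * ε :=
      calc ‖trigLp p (nonnegPart r)‖ ≤ ‖trigLp 2 (nonnegPart r)‖ :=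
            ContinuousMap.norm_toLp_mono_exponent _ h2 _
        _ ≤ ‖trigLp 2 r‖ := norm_trigLp_two_nonnegPart_le r
        _ ≤ ‖trigPoly r‖ := ContinuousMap.norm_toLp_le_norm _ 2 _
        _ ≤ 4 * ε := (ContinuousMap.norm_le _ (by positivity)).2 hrt
    have e : trigLp p (nonnegPart c) = trigLp p (nonnegPart r) + (trigLp p (nonnegPart d₁)
        - trigLp p (nonnegPart d₂) + Complex.I • (trigLp p (nonnegPart d₃)
        - trigLp p (nonnegPart d₄))) := by
      rw [hr]; simp only [map_sub, map_add, map_smul]; abel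
    rw [e]
    refine (norm_add_le_of_le hrn (norm_add_le_of_le (norm_sub_le_of_le b₁ b₂)
      (r₂ := C * (‖trigLp p c‖ + ε) + C * (‖trigLp p c‖ + ε)) ?_)).trans (by linarith)
    rw [norm_smul, Complex.norm_I, one_mul]
    exact norm_sub_le_of_le b₃ b₄
  refine le_of_forall_pos_le_add fun δ hδ => ?_
  have := key (δ / (4 * C + 4)) (by positivity)
  rwa [mul_div_cancel₀ _ (by positivity)] at this

theorem integral_trigPoly_mul_conj (c d : ℤ →₀ ℂ) :
    ∫ t, trigPoly c t * (starRingEnd ℂ) (trigPoly d t) ∂AddCircle.haarAddCircle =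
      ∑ k ∈ d.support, c k * (starRingEnd ℂ) (d k) := by
  have h : ∀ t, trigPoly c t * (starRingEnd ℂ) (trigPoly d t) =
      ∑ k ∈ d.support, (starRingEnd ℂ) (d k) * (fourier (-k) t • trigPoly c t) := by
    intro t
    rw [trigPoly_apply d, Finsupp.sum, map_sum, Finset.mul_sum]
    refine Finset.sum_congr rfl fun k _ => ?_
    rw [map_mul, fourier_neg, smul_eq_mul]; ring
  simp_rw [h]
  rw [integral_finsetSum]
  · refine Finset.sum_congr rfl fun k _ => ?_
    rw [integral_const_mul, ← fourierCoeff_trigPoly c k, fourierCoeff, mul_comm]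
  · intro k _
    refine Continuous.integrable_of_hasCompactSupport ?_ (HasCompactSupport.of_compactSpace _)
    fun_prop

/-- The Riesz projection is symmetric for the `L²` pairing. -/
theorem integral_nonnegPart_mul_conj (c d : ℤ →₀ ℂ) :
    ∫ t, trigPoly (nonnegPart c) t * (starRingEnd ℂ) (trigPoly d t) ∂AddCircle.haarAddCircle =
      ∫ t, trigPoly c t * (starRingEnd ℂ) (trigPoly (nonnegPart d) t) ∂AddCircle.haarAddCircle := by
  rw [integral_trigPoly_mul_conj, integral_trigPoly_mul_conj]
  symm
  rw [Finset.sum_subset (s₂ := d.support)]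
  · refine Finset.sum_congr rfl fun k _ => ?_
    simp only [nonnegPart_apply]; split_ifs <;> simp
  · intro k; simp only [Finsupp.mem_support_iff, nonnegPart_apply]; intro h; split_ifs at h <;> simp_all
  · intro k _ hk
    rw [Finsupp.notMem_support_iff.1 hk]; simp

/-- Hölder's inequality for continuous functions. -/
theorem ContinuousMap.norm_integral_mul_conj_le {X : Type*} [TopologicalSpace X] [CompactSpace X]
    [MeasurableSpace X] [BorelSpace X] (μ : Measure X) [IsFiniteMeasure μ] {p q : ℝ≥0∞}
    [Fact (1 ≤ p)] [Fact (1 ≤ q)] (hp : p ≠ ⊤) (hq : q ≠ ⊤)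
    (hpq : p.toReal.HolderConjugate q.toReal) (f g : C(X, ℂ)) :
    ‖∫ x, f x * (starRingEnd ℂ) (g x) ∂μ‖ ≤ ‖ContinuousMap.toLp (E := ℂ) p μ ℂ f‖ *
      ‖ContinuousMap.toLp (E := ℂ) q μ ℂ g‖ := by
  have mem : ∀ (h : C(X, ℂ)) (r : ℝ≥0∞), MemLp h r μ := fun h r =>
    MemLp.of_bound h.continuous.aestronglyMeasurable ‖h‖
      (Eventually.of_forall fun x => h.norm_coe_le_norm x)
  have h := integral_mul_norm_le_Lp_mul_Lq hpq (μ := μ) (f := f) (g := g) (mem _ _) (mem _ _)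
  rw [← ContinuousMap.norm_toLp_rpow μ p hp, ← ContinuousMap.norm_toLp_rpow μ q hq,
    ← Real.rpow_mul (norm_nonneg _), ← Real.rpow_mul (norm_nonneg _), mul_one_div_cancel hpq.ne_zero,
    mul_one_div_cancel hpq.symm.ne_zero, Real.rpow_one, Real.rpow_one] at h
  refine (norm_integral_le_integral_norm _).trans (le_trans (le_of_eq ?_) h)
  simp

/-- Boundedness of the Riesz projection passes to the conjugate exponent. -/
theorem norm_nonnegPart_le_of_dual {p q : ℝ≥0∞} [Fact (1 ≤ p)] [Fact (1 ≤ q)] (hp : p ≠ ⊤)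
    (hq : q ≠ ⊤) (h2 : 2 ≤ p.toReal) (hpq : p.toReal.HolderConjugate q.toReal) {C : ℝ} (hC : 0 ≤ C)
    (h : ∀ d : ℤ →₀ ℂ, ‖trigLp q (nonnegPart d)‖ ≤ C * ‖trigLp q d‖) (c : ℤ →₀ ℂ) :
    ‖trigLp p (nonnegPart c)‖ ≤ C * ‖trigLp p c‖ := by
  set μ := AddCircle.haarAddCircle (T := 1)
  set P := p.toReal
  set f := trigPoly (nonnegPart c)
  have hP1 : 1 < P := hpq.lt
  -- the function dual to `f`
  set g : C(UnitAddCircle, ℂ) := ⟨fun t => f t * ((‖f t‖ ^ (P - 2) : ℝ) : ℂ), by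
    refine f.continuous.mul (Complex.continuous_ofReal.comp (f.continuous.norm.rpow_const ?_))
    exact fun _ => Or.inr (by linarith)⟩ with hg
  have hgn : ∀ t, ‖g t‖ = ‖f t‖ ^ (P - 1) := by
    intro t
    rw [hg, ContinuousMap.coe_mk, norm_mul, Complex.norm_real, Real.norm_of_nonneg (by positivity),
      ← Real.rpow_one_add' (norm_nonneg _) (by linarith)]
    ring_nf
  have hfg : ∀ t, f t * (starRingEnd ℂ) (g t) = ((‖f t‖ ^ P : ℝ) : ℂ) := by
    intro t
    change f t * (starRingEnd ℂ) (f t * ((‖f t‖ ^ (P - 2) : ℝ) : ℂ)) = _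
    rw [map_mul, Complex.conj_ofReal, ← mul_assoc, Complex.mul_conj,
      ← Complex.ofReal_mul, Complex.normSq_eq_norm_sq, ← Real.rpow_two,
      ← Real.rpow_add' (norm_nonneg _) (by linarith)]
    ring_nf
  set N := ‖trigLp p (nonnegPart c)‖ with hN
  have hNP : N ^ P = ∫ t, ‖f t‖ ^ P ∂μ := ContinuousMap.norm_toLp_rpow _ _ hp _
  have hgq : ‖ContinuousMap.toLp (E := ℂ) q μ ℂ g‖ = N ^ (P - 1) := by
    have h1 := ContinuousMap.norm_toLp_rpow μ q hq g
    simp_rw [hgn, ← Real.rpow_mul (norm_nonneg _), hpq.sub_one_mul_conj] at h1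
    rw [← hNP] at h1
    rw [← Real.rpow_left_inj (norm_nonneg _) (by positivity) hpq.symm.ne_zero, h1,
      ← Real.rpow_mul (by positivity), hpq.sub_one_mul_conj]
  -- `g` need not be a trigonometric polynomial, so it is approximated by one
  have key : ∀ ε > 0, N ^ P ≤ ‖trigLp p c‖ * (C * (N ^ (P - 1) + ε)) + N * ε := by
    intro ε hε
    obtain ⟨d, hd⟩ := dense_range_trigPoly.exists_dist_lt g hε
    have hsub : ‖ContinuousMap.toLp (E := ℂ) q μ ℂ (g - trigPoly d)‖ ≤ ε :=
      (ContinuousMap.norm_toLp_le_norm _ q _).trans (by rw [← dist_eq_norm]; exact hd.le)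
    have e1 : ((N ^ P : ℝ) : ℂ) = (∫ t, trigPoly c t * (starRingEnd ℂ) (trigPoly (nonnegPart d) t) ∂μ)
        + ∫ t, f t * (starRingEnd ℂ) ((g - trigPoly d) t) ∂μ := by
      rw [← integral_nonnegPart_mul_conj, ← integral_add, hNP, ← integral_complex_ofReal]
      · refine integral_congr_ae (Eventually.of_forall fun t => ?_)
        simp only
        rw [← hfg t, ContinuousMap.sub_apply, map_sub]; ring
      · refine Continuous.integrable_of_hasCompactSupport ?_ (HasCompactSupport.of_compactSpace _)
        fun_prop
      · refine Continuous.integrable_of_hasCompactSupport ?_ (HasCompactSupport.of_compactSpace _)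
        fun_prop
    have e2 : N ^ P = ‖((N ^ P : ℝ) : ℂ)‖ := by
      rw [Complex.norm_real, Real.norm_of_nonneg (by positivity)]
    rw [e2, e1]
    refine norm_add_le_of_le ((ContinuousMap.norm_integral_mul_conj_le μ hp hq hpq _ _).trans ?_)
      ((ContinuousMap.norm_integral_mul_conj_le μ hp hq hpq _ _).trans ?_)
    · refine mul_le_mul_of_nonneg_left ((h d).trans ?_) (norm_nonneg _)
      gcongr
      rw [← hgq]
      have : trigLp q d = ContinuousMap.toLp (E := ℂ) q μ ℂ g
          - ContinuousMap.toLp (E := ℂ) q μ ℂ (g - trigPoly d) := by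
        rw [← map_sub, sub_sub_cancel]; rfl
      rw [this]
      exact norm_sub_le_of_le le_rfl hsub
    · exact mul_le_mul_of_nonneg_left hsub (norm_nonneg _)
  have key2 : N ^ P ≤ ‖trigLp p c‖ * (C * N ^ (P - 1)) := by
    refine le_of_forall_pos_le_add fun δ hδ => ?_
    have := key (δ / (‖trigLp p c‖ * C + N + 1)) (by positivity)
    refine this.trans ?_
    have h3 : (‖trigLp p c‖ * C + N) * (δ / (‖trigLp p c‖ * C + N + 1)) ≤ δ := by
      rw [mul_div_assoc', div_le_iff₀ (by positivity)]
      nlinarith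
    linarith
  rcases eq_or_lt_of_le (norm_nonneg (trigLp p (nonnegPart c))) with h0 | h0
  · rw [hN, ← h0]; positivity
  · have h4 : N ^ P = N * N ^ (P - 1) := by
      rw [← Real.rpow_one_add' h0.le (by linarith)]; congr 1; ring
    rw [h4] at key2
    refine le_of_mul_le_mul_right ?_ (Real.rpow_pos_of_pos h0 (P - 1))
    linarith

/-- The M. Riesz theorem: the projection onto nonnegative frequencies is bounded in `L^p` of the
circle, `1 < p < ∞`. -/
theorem exists_norm_nonnegPart_le {p : ℝ≥0∞} [Fact (1 ≤ p)] (h1 : 1 < p) (hp : p ≠ ⊤) :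
    ∃ C : ℝ, 0 ≤ C ∧ ∀ c : ℤ →₀ ℂ, ‖trigLp p (nonnegPart c)‖ ≤ C * ‖trigLp p c‖ := by
  rcases le_total p 2 with h2 | h2
  · exact exists_norm_nonnegPart_le_of_le_two h1 h2
  · have hP : 2 ≤ p.toReal := by simpa using ENNReal.toReal_mono hp h2
    have hpq := Real.HolderConjugate.conjExponent (p := p.toReal) (by linarith)
    set Q := p.toReal.conjExponent
    have hQ : (ENNReal.ofReal Q).toReal = Q := ENNReal.toReal_ofReal hpq.symm.nonneg
    have hQ1 : 1 < ENNReal.ofReal Q := by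
      rw [← ENNReal.ofReal_one]
      exact (ENNReal.ofReal_lt_ofReal_iff (by linarith [hpq.symm.lt])).2 hpq.symm.lt
    have hQ2 : ENNReal.ofReal Q ≤ 2 := by
      rw [← ENNReal.ofReal_ofNat]
      refine ENNReal.ofReal_le_ofReal ?_
      simp only [Q, Real.conjExponent]
      rw [div_le_iff₀ (by linarith)]; linarith
    have : Fact (1 ≤ ENNReal.ofReal Q) := ⟨hQ1.le⟩
    obtain ⟨C, hC, h⟩ := exists_norm_nonnegPart_le_of_le_two hQ1 hQ2
    exact ⟨C, hC, norm_nonnegPart_le_of_dual hp ENNReal.ofReal_ne_top hP (by rwa [hQ]) hC h⟩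

/-! ### Multipliers -/

section Multiplier
variable {ι E : Type*} [NormedAddCommGroup E] [NormedSpace ℂ E]

/-- The sequence `m` is a multiplier of the family `v` with bound `C`: multiplying coefficients by
`m` is bounded by `C` on finite linear combinations of `v`. No independence of `v` is required; the
sums are formal, so that multipliers form an algebra without any well-definedness issue. -/
def IsMultiplier (v : ι → E) (m : ι → ℂ) (C : ℝ) : Prop :=
  0 ≤ C ∧ ∀ (F : Finset ι) (c : ι → ℂ), ‖∑ i ∈ F, (m i * c i) • v i‖ ≤ C * ‖∑ i ∈ F, c i • v i‖

variable {v : ι → E} {m m₁ m₂ : ι → ℂ} {C C₁ C₂ : ℝ}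

theorem IsMultiplier.mul (h₁ : IsMultiplier v m₁ C₁) (h₂ : IsMultiplier v m₂ C₂) :
    IsMultiplier v (fun i => m₁ i * m₂ i) (C₁ * C₂) := by
  refine ⟨mul_nonneg h₁.1 h₂.1, fun F c => ?_⟩
  simp_rw [mul_assoc]
  refine (h₁.2 F fun i => m₂ i * c i).trans ?_
  exact mul_le_mul_of_nonneg_left (h₂.2 F c) h₁.1

theorem IsMultiplier.const (v : ι → E) (a : ℂ) : IsMultiplier v (fun _ => a) ‖a‖ := by
  refine ⟨norm_nonneg _, fun F c => ?_⟩
  simp_rw [mul_smul, ← Finset.smul_sum, norm_smul]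
  exact le_rfl

theorem IsMultiplier.add (h₁ : IsMultiplier v m₁ C₁) (h₂ : IsMultiplier v m₂ C₂) :
    IsMultiplier v (fun i => m₁ i + m₂ i) (C₁ + C₂) := by
  refine ⟨add_nonneg h₁.1 h₂.1, fun F c => ?_⟩
  simp_rw [add_mul, add_smul, Finset.sum_add_distrib]
  exact norm_add_le_of_le (h₁.2 F c) (h₂.2 F c)

theorem IsMultiplier.mono (h : IsMultiplier v m C₁) (hC : C₁ ≤ C₂) : IsMultiplier v m C₂ :=
  ⟨h.1.trans hC, fun F c => (h.2 F c).trans (mul_le_mul_of_nonneg_right hC (norm_nonneg _))⟩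

theorem IsMultiplier.sum {κ : Type*} (s : Finset κ) {m : κ → ι → ℂ} {C : κ → ℝ}
    (h : ∀ k ∈ s, IsMultiplier v (m k) (C k)) :
    IsMultiplier v (fun i => ∑ k ∈ s, m k i) (∑ k ∈ s, C k) := by
  classical
  induction s using Finset.induction_on with
  | empty => simpa using IsMultiplier.const v 0
  | insert a s ha ih =>
    simp_rw [Finset.sum_insert ha]
    exact (h a (by simp)).add (ih fun k hk => h k (by simp [hk]))

theorem IsMultiplier.prod {κ : Type*} (s : Finset κ) {m : κ → ι → ℂ} {C : κ → ℝ}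
    (h : ∀ k ∈ s, IsMultiplier v (m k) (C k)) :
    IsMultiplier v (fun i => ∏ k ∈ s, m k i) (∏ k ∈ s, C k) := by
  classical
  induction s using Finset.induction_on with
  | empty => simpa using IsMultiplier.const v 1
  | insert a s ha ih =>
    simp_rw [Finset.prod_insert ha]
    exact (h a (by simp)).mul (ih fun k hk => h k (by simp [hk]))

/-- A function of the level `κ i` which vanishes below level `a` and has total variation at most
`V` is a multiplier when the half-lines `{κ ≥ k}` are. -/
theorem IsMultiplier.of_variation {κ : ι → ℤ} {R V : ℝ} {a : ℤ} {g : ℤ → ℝ} (hR : 0 ≤ R)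
    (hhalf : ∀ k : ℤ, IsMultiplier v (fun i => if k ≤ κ i then 1 else 0) R)
    (hg : ∀ k < a, g k = 0)
    (hV : ∀ N : ℕ, ∑ j ∈ Finset.range N, |g (a + j) - g (a + j - 1)| ≤ V) :
    IsMultiplier v (fun i => (g (κ i) : ℂ)) (V * R) := by
  have hV0 : 0 ≤ V := by simpa using hV 0
  refine ⟨mul_nonneg hV0 hR, fun F c => ?_⟩
  obtain ⟨N, hN⟩ : ∃ N : ℕ, ∀ i ∈ F, κ i < a + N := by
    refine ⟨F.sup (fun i => (κ i - a).toNat) + 1, fun i hi => ?_⟩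
    have := Finset.le_sup (f := fun i => (κ i - a).toNat) hi
    omega
  have htel : ∀ M : ℕ, ∑ j ∈ Finset.range M, (g (a + j) - g (a + j - 1)) = g (a + M - 1) := by
    intro M
    induction M with
    | zero => simp [hg (a - 1) (by omega)]
    | succ M ih => rw [Finset.sum_range_succ, ih]; push_cast; ring_nf
  -- summation by parts: `g (κ i)` is a combination of half-line indicators, the increments of `g`
  -- being the coefficients
  have hgs : ∀ i ∈ F, (g (κ i) : ℂ) = ∑ j ∈ Finset.range N,
      ((g (a + j) - g (a + j - 1) : ℝ) : ℂ) * (if a + j ≤ κ i then 1 else 0) := by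
    intro i hi
    by_cases h : κ i < a
    · rw [hg _ h, Finset.sum_eq_zero]; · simp
      intro j _
      rw [if_neg (by omega), mul_zero]
    · push Not at h
      obtain ⟨M, hM⟩ := Int.eq_ofNat_of_zero_le (sub_nonneg.2 h)
      have h1 := htel (M + 1)
      have hκ : a + ((M + 1 : ℕ) : ℤ) - 1 = κ i := by push_cast; omega
      rw [hκ] at h1
      rw [← h1, Complex.ofReal_sum]
      have hMN : M + 1 ≤ N := by have := hN i hi; omega
      rw [← Finset.sum_subset (Finset.range_mono hMN)]
      · refine Finset.sum_congr rfl fun j hj => ?_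
        rw [Finset.mem_range] at hj
        rw [if_pos (by omega), mul_one]
      · intro j _ hj
        rw [Finset.mem_range] at hj
        rw [if_neg (by omega), mul_zero]
  have hmult := IsMultiplier.sum (v := v) (Finset.range N) fun j _ =>
    (IsMultiplier.const v ((g (a + j) - g (a + j - 1) : ℝ) : ℂ)).mul (hhalf (a + j))
  have := hmult.2 F c
  rw [← Finset.sum_mul] at this
  calc ‖∑ i ∈ F, ((g (κ i) : ℂ) * c i) • v i‖ = _ := by
        rw [Finset.sum_congr rfl fun i hi => by rw [hgs i hi]]
    _ ≤ _ := this
    _ ≤ V * R * ‖∑ i ∈ F, c i • v i‖ := by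
        gcongr
        simp only [Complex.norm_real, Real.norm_eq_abs]
        exact hV N

end Multiplier

theorem trigLp_single (p : ℝ≥0∞) [Fact (1 ≤ p)] (F : Finset ℤ) (c : ℤ → ℂ) :
    ∑ k ∈ F, c k • fourierLp (T := 1) p k = trigLp p (∑ k ∈ F, Finsupp.single k (c k)) := by
  rw [map_sum]
  refine Finset.sum_congr rfl fun k _ => ?_
  rw [trigLp_apply, trigPoly, Finsupp.linearCombination_single, map_smul]

/-- The M. Riesz theorem: half-lines are multipliers of `L^p` of the circle, uniformly. -/
theorem exists_isMultiplier_halfLine {p : ℝ≥0∞} [Fact (1 ≤ p)] (h1 : 1 < p) (hp : p ≠ ⊤) :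
    ∃ C : ℝ, 0 ≤ C ∧ ∀ m : ℤ,
      IsMultiplier (fourierLp (T := 1) p) (fun k => if m ≤ k then 1 else 0) C := by
  obtain ⟨C, hC, h⟩ := exists_norm_nonnegPart_le h1 hp
  -- multiplication by `fourier m` is an isometry that shifts frequencies by `m`
  have hnorm : ∀ (m : ℤ) (F : Finset ℤ) (c : ℤ → ℂ),
      ‖∑ k ∈ F, c k • fourierLp (T := 1) p k‖ =
      ‖trigLp p (∑ k ∈ F, Finsupp.single (k - m) (c k))‖ := by
    intro m F c
    rw [trigLp_single]
    refine le_antisymm (ContinuousMap.norm_toLp_le_of_forall_norm_le _ p fun t => ?_)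
      (ContinuousMap.norm_toLp_le_of_forall_norm_le _ p fun t => ?_) <;>
    · have e : trigPoly (∑ k ∈ F, Finsupp.single k (c k)) t
          = fourier m t * trigPoly (∑ k ∈ F, Finsupp.single (k - m) (c k)) t := by
        simp only [trigPoly, map_sum, Finsupp.linearCombination_single, ContinuousMap.sum_apply,
          ContinuousMap.smul_apply, smul_eq_mul, Finset.mul_sum]
        refine Finset.sum_congr rfl fun k _ => ?_
        rw [mul_left_comm, ← fourier_add, add_sub_cancel]
      have e2 : ‖(fourier m t : ℂ)‖ = 1 := by rw [fourier_apply, Circle.norm_coe]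
      rw [e, norm_mul, e2, one_mul]
  refine ⟨C, hC, fun m => ⟨hC, fun F c => ?_⟩⟩
  rw [hnorm m, hnorm m]
  convert! h (∑ k ∈ F, Finsupp.single (k - m) (c k)) using 3
  rw [map_sum]
  refine Finset.sum_congr rfl fun k _ => ?_
  ext j
  rw [nonnegPart_apply]
  simp only [Finsupp.single_apply]
  split_ifs <;> first | (simp; done) | omega

/-! ### Transference to the torus -/

/-- The normalised Haar measure of the torus `(ℝ/ℤ)ⁿ`. -/
noncomputable abbrev torusMeasure (n : ℕ) : Measure (UnitAddTorus (Fin n)) :=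
  Measure.pi fun _ => AddCircle.haarAddCircle

/-- The character `θ ↦ e^{2πi α·θ}` as an element of `L^p` of the torus. -/
noncomputable def torusChar {n : ℕ} (p : ℝ≥0∞) [Fact (1 ≤ p)] (α : Fin n → ℤ) :
    Lp ℂ p (torusMeasure n) :=
  ContinuousMap.toLp (E := ℂ) p (torusMeasure n) ℂ (UnitAddTorus.mFourier α)

section Torus
variable {n : ℕ}

theorem Continuous.integrable_torus {E : Type*} [NormedAddCommGroup E]
    {f : UnitAddTorus (Fin n) → E} (hf : Continuous f) : Integrable f (torusMeasure n) :=
  hf.integrable_of_hasCompactSupport (HasCompactSupport.of_compactSpace _)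

theorem norm_sum_torusChar_rpow {p : ℝ≥0∞} [Fact (1 ≤ p)] (hp : p ≠ ⊤)
    (F : Finset (Fin n → ℤ)) (c : (Fin n → ℤ) → ℂ) :
    ‖∑ α ∈ F, c α • torusChar p α‖ ^ p.toReal =
      ∫ θ, ‖∑ α ∈ F, c α * UnitAddTorus.mFourier α θ‖ ^ p.toReal ∂torusMeasure n := by
  have : ∑ α ∈ F, c α • torusChar p α = ContinuousMap.toLp (E := ℂ) p (torusMeasure n) ℂ
      (∑ α ∈ F, c α • UnitAddTorus.mFourier α) := by
    simp [torusChar, map_sum]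
  rw [this, ContinuousMap.norm_toLp_rpow _ _ hp]
  simp [ContinuousMap.sum_apply]

theorem mFourier_add_apply (α : Fin n → ℤ) (θ φ : UnitAddTorus (Fin n)) :
    UnitAddTorus.mFourier α (θ + φ) = UnitAddTorus.mFourier α θ * UnitAddTorus.mFourier α φ := by
  simp only [UnitAddTorus.mFourier, ContinuousMap.coe_mk, Pi.add_apply, ← Finset.prod_mul_distrib]
  refine Finset.prod_congr rfl fun k _ => ?_
  rw [fourier_apply, fourier_apply, fourier_apply, smul_add, AddCircle.toCircle_add, Circle.coe_mul]

theorem norm_mFourier_apply (α : Fin n → ℤ) (θ : UnitAddTorus (Fin n)) :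
    ‖UnitAddTorus.mFourier α θ‖ = 1 := by
  simp only [UnitAddTorus.mFourier, ContinuousMap.coe_mk, fourier_apply, norm_prod]
  exact Finset.prod_eq_one fun b _ => Circle.norm_coe _

theorem prod_toCircle {ι : Type*} (s : Finset ι) (x : ι → UnitAddCircle) :
    ∏ k ∈ s, (AddCircle.toCircle (x k) : ℂ) = AddCircle.toCircle (∑ k ∈ s, x k) := by
  classical
  induction s using Finset.induction_on with
  | empty => simp
  | insert a s ha ih =>
    rw [Finset.prod_insert ha, Finset.sum_insert ha, ih, AddCircle.toCircle_add, Circle.coe_mul]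

theorem mFourier_zsmul_apply (α a : Fin n → ℤ) (φ : UnitAddCircle) :
    UnitAddTorus.mFourier α (fun k => a k • φ) = fourier (∑ k, a k * α k) φ := by
  simp only [UnitAddTorus.mFourier, ContinuousMap.coe_mk, fourier_apply, smul_smul]
  rw [Finset.sum_smul, prod_toCircle]
  simp only [mul_comm]

/-- Transference: a multiplier of the circle applied to the integer frequency `a · α` is a
multiplier of the torus. -/
theorem IsMultiplier.transfer {p : ℝ≥0∞} [hp1 : Fact (1 ≤ p)] (hp : p ≠ ⊤) {m : ℤ → ℂ} {C : ℝ}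
    (h : IsMultiplier (fourierLp (T := 1) p) m C) (a : Fin n → ℤ) :
    IsMultiplier (torusChar (n := n) p) (fun α => m (∑ k, a k * α k)) C := by
  have hP : 0 < p.toReal := ENNReal.toReal_pos (zero_lt_one.trans_le hp1.out).ne' hp
  set P := p.toReal with hPdef
  refine ⟨h.1, fun F c => ?_⟩
  rw [← Real.rpow_le_rpow_iff (by positivity) (mul_nonneg h.1 (norm_nonneg _)) hP,
    Real.mul_rpow h.1 (norm_nonneg _), hPdef, norm_sum_torusChar_rpow hp,
    norm_sum_torusChar_rpow hp, ← hPdef]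
  -- averaging over the circle subgroup of direction `a` does not change the integrals
  have avg : ∀ d : (Fin n → ℤ) → ℂ,
      ∫ θ, ‖∑ α ∈ F, d α * UnitAddTorus.mFourier α θ‖ ^ P ∂torusMeasure n =
      ∫ θ, ‖∑ l ∈ F.image (fun α => ∑ k, a k * α k),
        (∑ α ∈ F with ∑ k, a k * α k = l, d α * UnitAddTorus.mFourier α θ) •
          fourierLp (T := 1) p l‖ ^ P ∂torusMeasure n := by
    intro d
    set H : UnitAddTorus (Fin n) → ℝ := fun θ => ‖∑ α ∈ F, d α * UnitAddTorus.mFourier α θ‖ ^ P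
    have hH : Continuous H := Continuous.rpow_const (by fun_prop) fun _ => Or.inr hP.le
    have h1 : ∀ φ : UnitAddCircle, ∫ θ, H (θ + fun k => a k • φ) ∂torusMeasure n
        = ∫ θ, H θ ∂torusMeasure n := fun φ => integral_add_right_eq_self H _
    have hcont : Continuous fun x : UnitAddTorus (Fin n) × UnitAddCircle =>
        H (x.1 + fun k => a k • x.2) := hH.comp (by fun_prop)
    have h2 : ∫ θ, H θ ∂torusMeasure n = ∫ θ, ∫ φ : UnitAddCircle, H (θ + fun k => a k • φ)
        ∂AddCircle.haarAddCircle ∂torusMeasure n := by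
      rw [integral_integral_swap]
      · simp_rw [h1]; simp
      · exact hcont.integrable_of_hasCompactSupport (HasCompactSupport.of_compactSpace _)
    rw [h2]
    congr 1; ext θ
    have h3 : ∑ l ∈ F.image (fun α => ∑ k, a k * α k),
        (∑ α ∈ F with ∑ k, a k * α k = l, d α * UnitAddTorus.mFourier α θ) •
          fourierLp (T := 1) p l = ContinuousMap.toLp (E := ℂ) p AddCircle.haarAddCircle ℂ
        (∑ l ∈ F.image (fun α => ∑ k, a k * α k),
        (∑ α ∈ F with ∑ k, a k * α k = l, d α * UnitAddTorus.mFourier α θ) • fourier (T := 1) l) := by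
      simp [map_sum]
    rw [h3, hPdef, ContinuousMap.norm_toLp_rpow _ _ hp, ← hPdef]
    congr 1; ext φ
    simp only [H, ContinuousMap.sum_apply, ContinuousMap.smul_apply, smul_eq_mul]
    congr 2
    -- group the frequencies `α` by the value of `a · α`
    rw [← Finset.sum_fiberwise_of_maps_to (g := fun α : Fin n → ℤ => ∑ k, a k * α k)
      (fun α hα => Finset.mem_image_of_mem (fun α : Fin n → ℤ => ∑ k, a k * α k) hα)]
    refine Finset.sum_congr rfl fun l _ => ?_
    rw [Finset.sum_mul]
    refine Finset.sum_congr rfl fun α hα => ?_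
    rw [mFourier_add_apply, mFourier_zsmul_apply, (Finset.mem_filter.1 hα).2, mul_assoc]
  rw [avg, avg, ← integral_const_mul]
  have hc : ∀ d : (Fin n → ℤ) → ℂ, Continuous fun θ : UnitAddTorus (Fin n) =>
      ‖∑ l ∈ F.image (fun α => ∑ k, a k * α k),
        (∑ α ∈ F with ∑ k, a k * α k = l, d α * UnitAddTorus.mFourier α θ) •
          fourierLp (T := 1) p l‖ ^ P := fun d => by
    refine Continuous.rpow_const ?_ fun _ => Or.inr hP.le
    refine (continuous_finsetSum _ fun l _ => ?_).norm
    have h4 : Continuous fun θ : UnitAddTorus (Fin n) =>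
        ∑ α ∈ F with ∑ k, a k * α k = l, d α * UnitAddTorus.mFourier α θ := by fun_prop
    exact h4.smul continuous_const
  refine integral_mono (hc _).integrable_torus ((hc _).integrable_torus.const_mul _) fun θ => ?_
  simp only
  rw [← Real.mul_rpow h.1 (norm_nonneg _)]
  refine Real.rpow_le_rpow (norm_nonneg _) (le_trans (le_of_eq ?_) (h.2 _ _)) hP.le
  congr 1
  refine Finset.sum_congr rfl fun l _ => ?_
  congr 1
  rw [Finset.mul_sum]
  refine Finset.sum_congr rfl fun α hα => ?_
  rw [(Finset.mem_filter.1 hα).2, mul_assoc]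

/-- Translations of the torus are isometries of `L^p`, so that characters are multipliers. -/
theorem isMultiplier_mFourier {p : ℝ≥0∞} [hp1 : Fact (1 ≤ p)] (hp : p ≠ ⊤)
    (u : UnitAddTorus (Fin n)) :
    IsMultiplier (torusChar (n := n) p) (fun α => UnitAddTorus.mFourier α u) 1 := by
  have hP : 0 < p.toReal := ENNReal.toReal_pos (zero_lt_one.trans_le hp1.out).ne' hp
  refine ⟨zero_le_one, fun F c => ?_⟩
  rw [one_mul, ← Real.rpow_le_rpow_iff (by positivity) (norm_nonneg _) hP,
    norm_sum_torusChar_rpow hp, norm_sum_torusChar_rpow hp,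
    ← integral_add_right_eq_self (μ := torusMeasure n)
      (fun θ => ‖∑ α ∈ F, c α * UnitAddTorus.mFourier α θ‖ ^ p.toReal) u]
  refine le_of_eq (integral_congr_ae (Eventually.of_forall fun θ => ?_))
  simp only
  congr 2
  refine Finset.sum_congr rfl fun α _ => ?_
  rw [mFourier_add_apply]; ring

end Torus

/-! ### One-variable estimates and the Schur test -/

/-- The total variation of `k ↦ (k - l) e^{-ky}` on the integers `k ≥ a`, cut off below `a`. The
bound is, up to a constant, the factor of the kernel that dominates the partial sums. -/
theorem variation_linear_mul_exp_le {l y : ℝ} {a : ℤ} (ha : l < a) (hy : 0 < y) (N : ℕ) :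
    let g : ℤ → ℝ := fun k => if a ≤ k then ((k : ℝ) - l) * Real.exp (-(k * y)) else 0
    ∑ j ∈ Finset.range N, |g (a + j) - g (a + j - 1)| ≤ 4 * (Real.exp (-(l * y)) / y) := by
  intro g
  set x : ℕ → ℝ := fun j => (a : ℝ) - l + j with hx
  set r : ℕ → ℝ := fun j => Real.exp (-(x j * y)) with hr
  have hx0 : ∀ j, 0 < x j := fun j => by
    have : (0 : ℝ) ≤ j := Nat.cast_nonneg j
    simp only [hx]; linarith
  have hr0 : ∀ j, 0 < r j := fun j => Real.exp_pos _
  have hxs : ∀ j, x (j + 1) = x j + 1 := fun j => by simp only [hx]; push_cast; ring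
  have hstep : ∀ j, r (j + 1) ≤ (r j - r (j + 1)) / y := by
    intro j
    rw [le_div_iff₀ hy]
    have h1 : r j = r (j + 1) * Real.exp y := by
      simp only [hr, ← Real.exp_add, hxs]; congr 1; ring
    have h2 := Real.add_one_le_exp y
    rw [h1]; nlinarith [hr0 (j + 1)]
  have hanti : ∀ j, r (j + 1) ≤ r j := fun j => by
    simp only [hr, Real.exp_le_exp, hxs]; nlinarith
  have hg : ∀ j : ℕ, g (a + j) = Real.exp (-(l * y)) * (x j * r j) := by
    intro j
    simp only [g, hr, hx]
    rw [if_pos (by omega), mul_left_comm, ← Real.exp_add]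
    push_cast
    congr 1
    · ring
    · congr 1; ring
  have hg1 : g (a - 1) = 0 := by simp [g]
  -- the factor `x j` increases and `r j` decreases: an increment of `x r` is at most
  -- `r (j + 1)`, summed by `hstep`, plus `x j (r j - r (j + 1))`, summed by parts
  have claim : ∀ N, ∑ j ∈ Finset.range (N + 1), |g (a + j) - g (a + j - 1)| ≤
      Real.exp (-(l * y)) * (2 * (x 0 * r 0) - x N * r N + 2 * ((r 0 - r N) / y)) := by
    intro N
    induction N with
    | zero =>
      have := hg 0
      simp only [Nat.cast_zero, add_zero] at this
      simp only [zero_add, Finset.sum_range_one, Nat.cast_zero, add_zero, hg1, sub_zero, sub_self,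
        zero_div, mul_zero]
      rw [this, abs_of_nonneg (by have := hx0 0; have := hr0 0; positivity)]
      apply le_of_eq; ring
    | succ N ih =>
      rw [Finset.sum_range_succ]
      have e : a + ((N + 1 : ℕ) : ℤ) - 1 = a + (N : ℤ) := by push_cast; ring
      rw [e, hg, hg, ← mul_sub, abs_mul, abs_of_pos (Real.exp_pos _)]
      have h1 : |x (N + 1) * r (N + 1) - x N * r N| ≤ r (N + 1) + x N * (r N - r (N + 1)) := by
        rw [hxs, abs_le]
        have := hx0 N; have := hr0 (N + 1); have := hanti N
        constructor <;> nlinarith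
      have h2 := hstep N
      have h3 : Real.exp (-(l * y)) * |x (N + 1) * r (N + 1) - x N * r N| ≤
          Real.exp (-(l * y)) * (x N * r N - x (N + 1) * r (N + 1)
            + 2 * ((r N - r (N + 1)) / y)) := by
        refine mul_le_mul_of_nonneg_left ?_ (Real.exp_pos _).le
        rw [hxs] at h1 ⊢
        linarith
      refine (add_le_add ih h3).trans (le_of_eq ?_)
      ring
  have hE := Real.exp_pos (-(l * y))
  rcases N with _ | N
  · simp only [Finset.range_zero, Finset.sum_empty]; positivity
  · refine (claim N).trans ?_
    have h1 : x 0 * r 0 ≤ 1 / y := by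
      rw [le_div_iff₀ hy]
      have h2 := Real.add_one_le_exp (x 0 * y)
      have h3 : r 0 * Real.exp (x 0 * y) = 1 := by
        simp only [hr]; rw [← Real.exp_add]; simp
      nlinarith [hr0 0]
    have h2 : (r 0 - r N) / y ≤ 1 / y := by
      gcongr
      have : r 0 ≤ 1 := by
        simp only [hr]; rw [Real.exp_le_one_iff]; have := hx0 0; nlinarith
      have := hr0 N; linarith
    have h3 := mul_pos (hx0 N) (hr0 N)
    calc _ ≤ Real.exp (-(l * y)) * (4 * (1 / y)) := by
          refine mul_le_mul_of_nonneg_left ?_ hE.le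
          linarith
      _ = _ := by ring

/-- The Hilbert-type kernel `1 / (t + c s)` maps `s ^ (-a)` to a multiple of `t ^ (-a)`. -/
theorem lintegral_hilbert_kernel_le {a c : ℝ} (ha0 : 0 < a) (ha1 : a < 1) (hc : 0 < c) :
    ∃ C : ℝ, 0 ≤ C ∧ ∀ t : ℝ, 0 < t →
      ∫⁻ s in Set.Ioi (0 : ℝ), ENNReal.ofReal (s ^ (-a) / (t + c * s)) ≤
        ENNReal.ofReal (C * t ^ (-a)) := by
  have h1a : 0 < 1 - a := by linarith
  refine ⟨1 / (1 - a) + c⁻¹ / a, by positivity, fun t ht => ?_⟩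
  -- below `t` the kernel is at most `1 / t`, above it at most `1 / (c s)`
  have hsplit : Set.Ioi (0 : ℝ) = Set.Ioc 0 t ∪ Set.Ioi t := (Set.Ioc_union_Ioi_eq_Ioi ht.le).symm
  have h1 : ∫⁻ s in Set.Ioc (0 : ℝ) t, ENNReal.ofReal (s ^ (-a) / (t + c * s)) ≤
      ENNReal.ofReal (1 / (1 - a) * t ^ (-a)) := by
    have hint : IntegrableOn (fun s : ℝ => s ^ (-a) * t⁻¹) (Set.Ioc 0 t) := by
      rw [← intervalIntegrable_iff_integrableOn_Ioc_of_le ht.le]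
      exact (intervalIntegral.intervalIntegrable_rpow' (by linarith)).mul_const _
    calc _ ≤ ∫⁻ s in Set.Ioc (0 : ℝ) t, ENNReal.ofReal (s ^ (-a) * t⁻¹) := by
          refine setLIntegral_mono' measurableSet_Ioc fun s hs => ENNReal.ofReal_le_ofReal ?_
          rw [div_eq_mul_inv]
          have : 0 ≤ c * s := by have := hs.1; positivity
          have : 0 ≤ s ^ (-a) := Real.rpow_nonneg hs.1.le _
          gcongr
          linarith
      _ = ENNReal.ofReal (∫ s in Set.Ioc (0 : ℝ) t, s ^ (-a) * t⁻¹) := by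
          rw [ofReal_integral_eq_lintegral_ofReal hint]
          filter_upwards [ae_restrict_mem measurableSet_Ioc] with s hs
          have := Real.rpow_nonneg hs.1.le (-a)
          simp only [Pi.zero_apply]; positivity
      _ ≤ _ := by
          rw [← intervalIntegral.integral_of_le ht.le, intervalIntegral.integral_mul_const,
            integral_rpow (Or.inl (by linarith)), Real.zero_rpow (by linarith)]
          refine ENNReal.ofReal_le_ofReal (le_of_eq ?_)
          rw [Real.rpow_add ht, Real.rpow_one, sub_zero]
          have : -a + 1 = 1 - a := by ring
          rw [this]; field_simp
  have h2 : ∫⁻ s in Set.Ioi t, ENNReal.ofReal (s ^ (-a) / (t + c * s)) ≤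
      ENNReal.ofReal (c⁻¹ / a * t ^ (-a)) := by
    have hint : IntegrableOn (fun s : ℝ => c⁻¹ * s ^ (-a - 1)) (Set.Ioi t) :=
      (integrableOn_Ioi_rpow_of_lt (by linarith) ht).const_mul _
    calc _ ≤ ∫⁻ s in Set.Ioi t, ENNReal.ofReal (c⁻¹ * s ^ (-a - 1)) := by
          refine setLIntegral_mono' measurableSet_Ioi fun s hs => ENNReal.ofReal_le_ofReal ?_
          have hs0 : 0 < s := ht.trans hs
          have : 0 ≤ s ^ (-a) := Real.rpow_nonneg hs0.le _
          rw [Real.rpow_sub hs0, Real.rpow_one]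
          calc s ^ (-a) / (t + c * s) ≤ s ^ (-a) / (c * s) := by gcongr; linarith
            _ = _ := by field_simp
      _ = ENNReal.ofReal (∫ s in Set.Ioi t, c⁻¹ * s ^ (-a - 1)) := by
          rw [ofReal_integral_eq_lintegral_ofReal hint]
          filter_upwards [ae_restrict_mem measurableSet_Ioi] with s hs
          have := Real.rpow_nonneg (ht.trans hs).le (-a - 1)
          simp only [Pi.zero_apply]; positivity
      _ ≤ _ := by
          rw [integral_const_mul, integral_Ioi_rpow_of_lt (by linarith) ht]
          refine ENNReal.ofReal_le_ofReal (le_of_eq ?_)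
          rw [sub_add_cancel]; field_simp
  rw [hsplit, lintegral_union measurableSet_Ioi (Set.disjoint_left.2 fun x hx hx' =>
    (not_lt.2 hx.2) hx'), add_mul, ENNReal.ofReal_add (by positivity) (by positivity)]
  exact add_le_add h1 h2

/-- The Schur test with weights `h₁`, `h₂`: Hölder's inequality for
`k F = (k^(1/P) h₂⁻¹ F) (k^(1/Q) h₂)`, then Tonelli's theorem. -/
theorem lintegral_schur_le {X Y : Type*} [MeasurableSpace X] [MeasurableSpace Y] {μ : Measure X}
    {ν : Measure Y} [SFinite μ] [SFinite ν] {P Q : ℝ} (hPQ : P.HolderConjugate Q)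
    {k : X → Y → ℝ≥0∞} (hk : Measurable (Function.uncurry k)) {h₁ : X → ℝ≥0∞} {h₂ : Y → ℝ≥0∞}
    (hh₁ : Measurable h₁) (hh₂ : Measurable h₂) (h₂0 : ∀ᵐ y ∂ν, h₂ y ≠ 0) (h₂t : ∀ᵐ y ∂ν, h₂ y ≠ ⊤)
    {C₁ C₂ : ℝ≥0∞} (H₁ : ∀ᵐ x ∂μ, ∫⁻ y, k x y * h₂ y ^ Q ∂ν ≤ C₁ * h₁ x ^ Q)
    (H₂ : ∀ᵐ y ∂ν, ∫⁻ x, k x y * h₁ x ^ P ∂μ ≤ C₂ * h₂ y ^ P)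
    {F : Y → ℝ≥0∞} (hF : Measurable F) :
    ∫⁻ x, (∫⁻ y, k x y * F y ∂ν) ^ P ∂μ ≤ C₁ ^ (P / Q) * C₂ * ∫⁻ y, F y ^ P ∂ν := by
  have hP := hPQ.pos
  have hQ := hPQ.symm.pos
  have hkx : ∀ x, Measurable (k x) := fun x => hk.comp measurable_prodMk_left
  have hky : ∀ y, Measurable fun x => k x y := fun y => hk.comp measurable_prodMk_right
  have step : ∀ᵐ x ∂μ, (∫⁻ y, k x y * F y ∂ν) ^ P ≤
      C₁ ^ (P / Q) * ∫⁻ y, h₁ x ^ P * (k x y * (h₂ y)⁻¹ ^ P * F y ^ P) ∂ν := by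
    filter_upwards [H₁] with x hx
    have e : ∫⁻ y, k x y * F y ∂ν =
        ∫⁻ y, ((fun y => k x y ^ (1 / P) * (h₂ y)⁻¹ * F y) * fun y => k x y ^ (1 / Q) * h₂ y) y ∂ν := by
      refine lintegral_congr_ae ?_
      filter_upwards [h₂0, h₂t] with y hy0 hyt
      simp only [Pi.mul_apply]
      have h3 : k x y = k x y ^ (1 / P) * k x y ^ (1 / Q) := by
        rw [← ENNReal.rpow_add_of_nonneg _ _ (by positivity) (by positivity)]
        have := hPQ.inv_add_inv_eq_one
        rw [one_div, one_div, this, ENNReal.rpow_one]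
      conv_lhs => rw [h3]
      rw [show k x y ^ (1 / P) * (h₂ y)⁻¹ * F y * (k x y ^ (1 / Q) * h₂ y) =
        k x y ^ (1 / P) * k x y ^ (1 / Q) * F y * ((h₂ y)⁻¹ * h₂ y) by ring,
        ENNReal.inv_mul_cancel hy0 hyt, mul_one]
    rw [e]
    have hol := ENNReal.lintegral_mul_le_Lp_mul_Lq ν hPQ
      (f := fun y => k x y ^ (1 / P) * (h₂ y)⁻¹ * F y) (g := fun y => k x y ^ (1 / Q) * h₂ y)
      (by have := hkx x; fun_prop) (by have := hkx x; fun_prop)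
    have r1 : ∀ (R : ℝ) (hR : 0 < R) (a b : ℝ≥0∞), (a ^ (1 / R) * b) ^ R = a * b ^ R := by
      intro R hR a b
      rw [ENNReal.mul_rpow_of_nonneg _ _ hR.le, ← ENNReal.rpow_mul, one_div_mul_cancel hR.ne',
        ENNReal.rpow_one]
    calc _ ≤ _ := ENNReal.rpow_le_rpow hol hP.le
      _ = (∫⁻ y, k x y * (h₂ y)⁻¹ ^ P * F y ^ P ∂ν) * (∫⁻ y, k x y * h₂ y ^ Q ∂ν) ^ (P / Q) := by
          rw [ENNReal.mul_rpow_of_nonneg _ _ hP.le, ← ENNReal.rpow_mul, ← ENNReal.rpow_mul,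
            one_div_mul_cancel hP.ne', ENNReal.rpow_one, one_div_mul_eq_div]
          simp_rw [r1 Q hQ, mul_assoc (k x _ ^ (1 / P)), r1 P hP, ENNReal.mul_rpow_of_nonneg _ _ hP.le,
            mul_assoc]
      _ ≤ (∫⁻ y, k x y * (h₂ y)⁻¹ ^ P * F y ^ P ∂ν) * (C₁ * h₁ x ^ Q) ^ (P / Q) := by gcongr
      _ = _ := by
          rw [ENNReal.mul_rpow_of_nonneg _ _ (by positivity), ← ENNReal.rpow_mul,
            mul_div_cancel₀ _ hQ.ne', lintegral_const_mul _ (by have := hkx x; fun_prop)]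
          ring
  calc _ ≤ _ := lintegral_mono_ae step
    _ = C₁ ^ (P / Q) * ∫⁻ y, ∫⁻ x, h₁ x ^ P * (k x y * (h₂ y)⁻¹ ^ P * F y ^ P) ∂μ ∂ν := by
        rw [lintegral_const_mul _ (by fun_prop), lintegral_lintegral_swap (by fun_prop)]
    _ ≤ C₁ ^ (P / Q) * ∫⁻ y, C₂ * F y ^ P ∂ν := by
        refine mul_le_mul' le_rfl (lintegral_mono_ae ?_)
        filter_upwards [H₂, h₂0, h₂t] with y hy hy0 hyt
        have := hky y
        calc ∫⁻ x, h₁ x ^ P * (k x y * (h₂ y)⁻¹ ^ P * F y ^ P) ∂μ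
            = (∫⁻ x, k x y * h₁ x ^ P ∂μ) * ((h₂ y)⁻¹ ^ P * F y ^ P) := by
              rw [← lintegral_mul_const _ (by fun_prop)]
              congr 1; ext x; ring
          _ ≤ C₂ * h₂ y ^ P * ((h₂ y)⁻¹ ^ P * F y ^ P) := by gcongr
          _ = C₂ * F y ^ P * (h₂ y * (h₂ y)⁻¹) ^ P := by
              rw [ENNReal.mul_rpow_of_nonneg _ _ hP.le]; ring
          _ = _ := by rw [ENNReal.mul_inv_cancel hy0 hyt, ENNReal.one_rpow, mul_one]
    _ = _ := by rw [lintegral_const_mul _ (by fun_prop), mul_assoc]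

/-! ### Integration in logarithmic coordinates -/

/-- Tonelli's theorem for a product of functions of one coordinate each. -/
theorem lintegral_pi_prod_eq_prod {n : ℕ} {E : Type*} [MeasurableSpace E] (μ : Fin n → Measure E)
    [∀ i, SigmaFinite (μ i)] {f : Fin n → E → ℝ≥0∞} (hf : ∀ i, Measurable (f i)) :
    ∫⁻ x, ∏ i, f i (x i) ∂Measure.pi μ = ∏ i, ∫⁻ x, f i x ∂μ i := by
  induction n with
  | zero => simp
  | succ n ih =>
    rw [← ((measurePreserving_piFinSuccAbove μ 0).symm).lintegral_comp_emb
      (MeasurableEquiv.measurableEmbedding _)]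
    simp_rw [MeasurableEquiv.piFinSuccAbove_symm_apply, Fin.insertNthEquiv,
      Fin.prod_univ_succ, Fin.insertNth_zero, Equiv.coe_fn_mk, Fin.cons_succ,
      Fin.zero_succAbove, Fin.cons_zero]
    have hg : Measurable fun y : Fin n → E => ∏ i : Fin n, f i.succ (y i) :=
      Finset.measurable_prod _ fun i _ => (hf _).comp (measurable_pi_apply i)
    rw [← ih (fun j => μ j.succ) fun i => hf i.succ]
    exact lintegral_prod_mul (hf 0).aemeasurable hg.aemeasurable

theorem pi_withDensity {n : ℕ} {E : Type*} [MeasurableSpace E] (μ : Measure E) [SigmaFinite μ]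
    {f : E → ℝ≥0∞} (hf : Measurable f) [SigmaFinite (μ.withDensity f)] :
    Measure.pi (fun _ : Fin n => μ.withDensity f) =
      (Measure.pi fun _ : Fin n => μ).withDensity fun x => ∏ i, f (x i) := by
  refine Measure.pi_eq fun s hs => ?_
  rw [withDensity_apply _ (MeasurableSet.univ_pi hs), ← lintegral_indicator (MeasurableSet.univ_pi hs)]
  have : ∀ x : Fin n → E, (Set.univ.pi s).indicator (fun x => ∏ i, f (x i)) x =
      ∏ i, (s i).indicator f (x i) := by
    intro x
    by_cases h : x ∈ Set.univ.pi s
    · rw [Set.indicator_of_mem h]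
      exact Finset.prod_congr rfl fun i _ => (Set.indicator_of_mem (h i (Set.mem_univ i)) f).symm
    · rw [Set.indicator_of_notMem h]
      obtain ⟨i, hi⟩ : ∃ i, x i ∉ s i := by simpa [Set.mem_pi] using h
      exact (Finset.prod_eq_zero (Finset.mem_univ i) (Set.indicator_of_notMem hi f)).symm
  simp_rw [this]
  rw [lintegral_pi_prod_eq_prod _ fun i => hf.indicator (hs i)]
  refine Finset.prod_congr rfl fun i _ => ?_
  rw [lintegral_indicator (hs i), withDensity_apply _ (hs i)]

/-- The image of Lebesgue measure of `ℂ` under `z ↦ log |z|`. -/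
theorem measurePreserving_log_norm :
    MeasurePreserving (fun z : ℂ => Real.log ‖z‖) volume
      (volume.withDensity fun x : ℝ => ENNReal.ofReal (2 * Real.pi * Real.exp (2 * x))) := by
  have hm : Measurable fun z : ℂ => Real.log ‖z‖ := Real.measurable_log.comp measurable_norm
  refine ⟨hm, Measure.ext_of_lintegral _ fun f hf => ?_⟩
  rw [lintegral_map hf hm, lintegral_withDensity_eq_lintegral_mul _ (by fun_prop) hf,
    ← Complex.lintegral_comp_polarCoord_symm]
  simp_rw [Complex.norm_polarCoord_symm, Real.log_abs, polarCoord_target, smul_eq_mul]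
  rw [Measure.volume_eq_prod, ← Measure.prod_restrict, lintegral_prod]
  · simp only [lintegral_const, MeasurableSet.univ, Measure.restrict_apply, Set.univ_inter,
      Real.volume_Ioo]
    rw [lintegral_mul_const]
    · rw [← Real.range_exp, ← Set.image_univ, lintegral_image_eq_lintegral_abs_deriv_mul
        MeasurableSet.univ (fun x _ => (Real.hasDerivAt_exp x).hasDerivWithinAt)
        Real.exp_injective.injOn, Measure.restrict_univ, ← lintegral_mul_const]
      · refine lintegral_congr fun x => ?_
        simp only [Pi.mul_apply, Real.log_exp, Real.abs_exp]
        rw [← mul_assoc, mul_right_comm, ← ENNReal.ofReal_mul (by positivity),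
          ← ENNReal.ofReal_mul (by positivity)]
        congr 2
        rw [← Real.exp_add]; ring_nf
      · fun_prop
    · fun_prop
  · refine Measurable.aemeasurable ?_
    fun_prop

/-- Integration in logarithmic coordinates. -/
theorem lintegral_comp_log_norm {n : ℕ} {Φ : (Fin n → ℝ) → ℝ≥0∞} (hΦ : Measurable Φ) :
    ∫⁻ z : Fin n → ℂ, Φ (fun k => Real.log ‖z k‖) =
      ∫⁻ x : Fin n → ℝ, ENNReal.ofReal ((2 * Real.pi) ^ n * Real.exp (2 * ∑ k, x k)) * Φ x := by
  have : SigmaFinite (volume.withDensity fun x : ℝ =>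
    ENNReal.ofReal (2 * Real.pi * Real.exp (2 * x))) := SigmaFinite.withDensity_ofReal _
  have h := measurePreserving_pi (fun _ : Fin n => (volume : Measure ℂ)) _
    (fun _ => measurePreserving_log_norm)
  rw [volume_pi, h.lintegral_comp hΦ, pi_withDensity _ (by fun_prop),
    lintegral_withDensity_eq_lintegral_mul _ _ hΦ]
  · refine lintegral_congr fun x => ?_
    rw [Pi.mul_apply, ← ENNReal.ofReal_prod_of_nonneg fun i _ => by positivity,
      Finset.prod_mul_distrib, ← Real.exp_sum, Finset.mul_sum]
    simp
  · fun_prop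

/-- Integration in the linear coordinates `t = M log |z|`. -/
theorem exists_lintegral_comp_mulVec_log_norm {n : ℕ} {M N : Matrix (Fin n) (Fin n) ℝ}
    (hNM : N * M = 1) : ∃ K : ℝ, 0 < K ∧ ∀ Φ : (Fin n → ℝ) → ℝ≥0∞, Measurable Φ →
      ∫⁻ z : Fin n → ℂ, Φ (M.mulVec fun k => Real.log ‖z k‖) =
        ENNReal.ofReal K * ∫⁻ t : Fin n → ℝ,
          (∏ j, ENNReal.ofReal (Real.exp (2 * (∑ k, N k j) * t j))) * Φ t := by
  have hdet : M.det ≠ 0 := fun h => by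
    have := congrArg Matrix.det hNM
    rw [Matrix.det_mul, h, mul_zero, Matrix.det_one] at this
    exact zero_ne_one this
  have hdet' : 0 < |M.det⁻¹| := abs_pos.2 (inv_ne_zero hdet)
  refine ⟨(2 * Real.pi) ^ n * |M.det⁻¹|, by positivity, fun Φ hΦ => ?_⟩
  have hMm : Measurable fun x : Fin n → ℝ => M.mulVec x := by
    have : Continuous fun x : Fin n → ℝ => M.mulVec x := by fun_prop
    exact this.measurable
  rw [lintegral_comp_log_norm (Φ := fun x => Φ (M.mulVec x)) (hΦ.comp hMm)]
  have hΨ : Measurable fun t : Fin n → ℝ => ENNReal.ofReal ((2 * Real.pi) ^ n) *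
      ((∏ j, ENNReal.ofReal (Real.exp (2 * (∑ k, N k j) * t j))) * Φ t) := by fun_prop
  have hMm' : Measurable (Matrix.toLin' M) := by
    rwa [show ⇑(Matrix.toLin' M) = fun x => M.mulVec x from funext fun x => Matrix.toLin'_apply M x]
  have h := lintegral_map (μ := (volume : Measure (Fin n → ℝ))) hΨ
    (g := Matrix.toLin' M) hMm'
  rw [Real.map_matrix_volume_pi_eq_smul_volume_pi hdet, lintegral_smul_measure] at h
  rw [mul_comm _ |M.det⁻¹|, ENNReal.ofReal_mul (abs_nonneg _), mul_assoc,
    ← lintegral_const_mul _ (by fun_prop)]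
  rw [smul_eq_mul] at h
  rw [h]
  refine lintegral_congr fun x => ?_
  simp only [Matrix.toLin'_apply]
  rw [← mul_assoc, ENNReal.ofReal_mul (by positivity),
    ← ENNReal.ofReal_prod_of_nonneg (fun i _ => by positivity), ← Real.exp_sum]
  congr 4
  have e : x = N.mulVec (M.mulVec x) := by rw [Matrix.mulVec_mulVec, hNM, Matrix.one_mulVec]
  conv_lhs => rw [e]
  simp only [Matrix.mulVec, dotProduct] at *
  simp_rw [mul_assoc, ← Finset.mul_sum]
  congr 1
  rw [Finset.sum_comm]
  simp_rw [Finset.sum_mul]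

/-! ### Logarithmic coordinates of a monomial polyhedron -/

section Monomial
variable {n : ℕ}

theorem norm_laurentMonomial (α : Fin n → ℤ) (z : Fin n → ℂ) :
    ‖laurentMonomial α z‖ = ∏ k, ‖z k‖ ^ α k := by
  simp [laurentMonomial, norm_prod, norm_zpow]

theorem norm_laurentMonomial_eq_exp (α : Fin n → ℤ) {z : Fin n → ℂ} (hz : ∀ k, z k ≠ 0) :
    ‖laurentMonomial α z‖ = Real.exp (∑ k, α k * Real.log ‖z k‖) := by
  rw [norm_laurentMonomial, Real.exp_sum]
  refine Finset.prod_congr rfl fun k _ => ?_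
  rw [← Real.rpow_intCast, Real.rpow_def_of_pos (norm_pos_iff.2 (hz k)), mul_comm]

theorem laurentMonomial_ne_zero (α : Fin n → ℤ) {z : Fin n → ℂ} (hz : ∀ k, z k ≠ 0) :
    laurentMonomial α z ≠ 0 :=
  Finset.prod_ne_zero_iff.2 fun k _ => zpow_ne_zero _ (hz k)

theorem dense_forall_ne_zero (n : ℕ) : Dense {z : Fin n → ℂ | ∀ k, z k ≠ 0} := by
  have := dense_pi (Set.univ : Set (Fin n)) (s := fun _ => ({0}ᶜ : Set ℂ))
    fun _ _ => dense_compl_singleton 0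
  convert! this using 1
  ext z; simp [Set.mem_pi]

theorem ae_forall_ne_zero (n : ℕ) : ∀ᵐ z : Fin n → ℂ, ∀ k, z k ≠ 0 := by
  rw [ae_all_iff]
  intro k
  have h := (Measure.quasiMeasurePreserving_eval (fun _ : Fin n => (volume : Measure ℂ)) k).ae
    (p := fun w => w ≠ 0) (Measure.ae_ne volume 0)
  exact h

/-- The set `U` is open, nonempty, bounded and Reinhardt, and its logarithm (off the coordinate
hyperplanes) is the open cone on which all coordinates of `t = M log |z|` are positive. The inverse
of `M` is the negative of the integer matrix `A`, so that the exponents of `|e_α|` in the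
coordinates `t` are integers. The matrices are not unique: `M` may be rescaled. -/
structure HasLogCoordinates (U : Set (Fin n → ℂ)) (A : Matrix (Fin n) (Fin n) ℤ)
    (M : Matrix (Fin n) (Fin n) ℝ) : Prop where
  isOpen : IsOpen U
  nonempty : U.Nonempty
  isBounded : Bornology.IsBounded U
  mem_of_norm_eq : ∀ z w : Fin n → ℂ, (∀ k, ‖z k‖ = ‖w k‖) → z ∈ U → w ∈ U
  inv : (-(A.map fun a : ℤ => (a : ℝ))) * M = 1
  mem_iff : ∀ z : Fin n → ℂ, (∀ k, z k ≠ 0) →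
    (z ∈ U ↔ ∀ j, 0 < M.mulVec (fun k => Real.log ‖z k‖) j)

/-- Boundedness of a monomial polyhedron forces its exponent matrix `B` to be invertible; then
`M = -B / (det B)²` and `A = det B · adj B`, an integer matrix, give logarithmic coordinates. -/
theorem IsMonomialPolyhedron.exists_hasLogCoordinates {U : Set (Fin n → ℂ)}
    (hU : IsMonomialPolyhedron U) : ∃ A M, HasLogCoordinates U A M := by
  obtain ⟨B, hB⟩ := hU.eq_setOf
  have hdef : ∀ (α : Fin n → ℤ) (z : Fin n → ℂ), (∀ k, z k ≠ 0) → LaurentDefinedAt α z :=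
    fun α z hz k _ => hz k
  obtain ⟨z, hzU, hz0⟩ := (dense_forall_ne_zero n).inter_open_nonempty U hU.isOpen
    hU.isConnected.nonempty
  have hmem : ∀ z : Fin n → ℂ, (∀ k, z k ≠ 0) →
      (z ∈ U ↔ ∀ j, ∑ k, B j k * Real.log ‖z k‖ < 0) := by
    intro z hz
    rw [hB]
    refine forall_congr' fun j => ?_
    rw [norm_laurentMonomial_eq_exp _ hz, Real.exp_lt_one_iff]
    exact and_iff_right (hdef _ _ hz)
  -- a kernel vector of `B` would give an unbounded ray in the logarithm of `U`
  have hdet : B.det ≠ 0 := by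
    intro h0
    have h0' : (B.map fun a : ℤ => (a : ℝ)).det = 0 := by
      have := (Int.castRingHom ℝ).map_det B
      rw [h0, map_zero] at this
      exact this.symm
    obtain ⟨v, hv0, hv⟩ := Matrix.exists_mulVec_eq_zero_iff.2 h0'
    obtain ⟨k, hk⟩ := Function.ne_iff.1 hv0
    obtain ⟨R, hR⟩ := hU.isBounded.exists_norm_le
    have hw : ∀ s : ℝ, (fun k => z k * (Real.exp (s * v k) : ℂ)) ∈ U := by
      intro s
      have hw0 : ∀ k, z k * (Real.exp (s * v k) : ℂ) ≠ 0 := fun k =>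
        mul_ne_zero (hz0 k) (by simp)
      rw [hmem _ hw0]
      intro j
      have h1 := (hmem z hz0).1 hzU j
      have h2 : ∑ k, (B j k : ℝ) * v k = 0 := congrFun hv j
      have h3 : ∀ k, Real.log ‖z k * (Real.exp (s * v k) : ℂ)‖ = Real.log ‖z k‖ + s * v k := by
        intro k
        rw [norm_mul, Real.log_mul (norm_ne_zero_iff.2 (hz0 k)) (by simp), Complex.norm_real,
          Real.norm_of_nonneg (Real.exp_pos _).le, Real.log_exp]
      simp_rw [h3, mul_add, Finset.sum_add_distrib, mul_left_comm _ s, ← Finset.mul_sum, h2]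
      simpa using h1
    have hzk : 0 < ‖z k‖ := norm_pos_iff.2 (hz0 k)
    have h1 := hR _ (hw (R / ‖z k‖ / v k))
    have h2 := (norm_le_pi_norm (fun k' => z k' * (Real.exp (R / ‖z k‖ / v k * v k') : ℂ)) k).trans h1
    rw [norm_mul, Complex.norm_real, Real.norm_of_nonneg (Real.exp_pos _).le,
      div_mul_cancel₀ _ hk, mul_comm, ← le_div_iff₀ hzk] at h2
    linarith [Real.add_one_le_exp (R / ‖z k‖)]
  have hd : (0 : ℝ) < (B.det : ℝ) ^ 2 := by positivity
  refine ⟨B.det • B.adjugate, -(((B.det : ℝ) ^ 2)⁻¹ • B.map fun a : ℤ => (a : ℝ)),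
    hU.isOpen, hU.isConnected.nonempty, hU.isBounded, ?_, ?_, ?_⟩
  · intro z w hzw hz
    rw [hB] at hz ⊢
    intro j
    obtain ⟨h1, h2⟩ := hz j
    refine ⟨fun k hk => ?_, ?_⟩
    · rw [← norm_ne_zero_iff, ← hzw k, norm_ne_zero_iff]; exact h1 k hk
    · rw [norm_laurentMonomial] at h2 ⊢
      simp_rw [← hzw]; exact h2
  · have h1 : (B.adjugate.map fun a : ℤ => (a : ℝ)) * (B.map fun a : ℤ => (a : ℝ))
        = (B.det : ℝ) • 1 := by
      have := congrArg (fun X : Matrix (Fin n) (Fin n) ℤ => X.map (Int.castRingHom ℝ))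
        (Matrix.adjugate_mul B)
      simp only [Matrix.map_mul] at this
      refine Eq.trans this ?_
      ext i j
      simp only [Matrix.map_apply, Matrix.smul_apply, Matrix.one_apply, smul_eq_mul]
      split_ifs <;> simp
    have h2 : ((B.det • B.adjugate).map fun a : ℤ => (a : ℝ)) =
        (B.det : ℝ) • (B.adjugate.map fun a : ℤ => (a : ℝ)) := by
      ext i j
      simp only [Matrix.map_apply, Matrix.smul_apply, smul_eq_mul]
      push_cast; rfl
    rw [neg_mul_neg, h2, smul_mul_smul_comm, h1, smul_smul]
    have : (B.det : ℝ) * ((B.det : ℝ) ^ 2)⁻¹ * B.det = 1 := by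
      field_simp
    rw [this, one_smul]
  · intro z hz
    rw [hmem z hz]
    refine forall_congr' fun j => ?_
    rw [Matrix.neg_mulVec, Matrix.smul_mulVec, Pi.neg_apply, Pi.smul_apply, smul_eq_mul]
    simp only [Matrix.mulVec, dotProduct, Matrix.map_apply]
    rw [neg_pos, mul_neg_iff]
    constructor
    · intro h; exact Or.inl ⟨by positivity, h⟩
    · rintro (h | h)
      · exact h.2
      · exact absurd h.1 (not_lt.2 (by positivity))

namespace HasLogCoordinates
variable {U : Set (Fin n → ℂ)} {A : Matrix (Fin n) (Fin n) ℤ} {M : Matrix (Fin n) (Fin n) ℝ}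

theorem log_norm_eq (h : HasLogCoordinates U A M) (z : Fin n → ℂ) (k : Fin n) :
    Real.log ‖z k‖ = -∑ j, A k j * M.mulVec (fun k => Real.log ‖z k‖) j := by
  have e := congrFun (congrArg (fun X => Matrix.mulVec X fun k => Real.log ‖z k‖) h.inv) k
  rw [← Matrix.mulVec_mulVec, Matrix.one_mulVec, Matrix.neg_mulVec] at e
  rw [← e]
  simp only [Pi.neg_apply, Matrix.mulVec, dotProduct, Matrix.map_apply]

/-- In logarithmic coordinates `t`, `|e_α| = ∏_j exp (-(α A)_j t_j)`. -/
theorem norm_laurentMonomial_eq (h : HasLogCoordinates U A M) (α : Fin n → ℤ) {z : Fin n → ℂ}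
    (hz : ∀ k, z k ≠ 0) : ‖laurentMonomial α z‖ =
      ∏ j, Real.exp (-((∑ k, A k j * α k : ℤ) * M.mulVec (fun k => Real.log ‖z k‖) j)) := by
  rw [norm_laurentMonomial_eq_exp α hz, ← Real.exp_sum]
  congr 1
  conv_lhs => enter [2, k]; rw [h.log_norm_eq z k]
  push_cast
  simp_rw [mul_neg, Finset.mul_sum, Finset.sum_neg_distrib, Finset.sum_mul]
  rw [Finset.sum_comm]
  congr 1
  refine Finset.sum_congr rfl fun j _ => Finset.sum_congr rfl fun k _ => by ring

/-- Integration over `U` of a product of functions of the logarithmic coordinates. -/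
theorem exists_lintegral_prod (h : HasLogCoordinates U A M) :
    ∃ K : ℝ, 0 < K ∧ ∀ g : Fin n → ℝ → ℝ≥0∞, (∀ j, Measurable (g j)) →
      ∫⁻ z in U, ∏ j, g j (M.mulVec (fun k => Real.log ‖z k‖) j) =
        ENNReal.ofReal K * ∏ j, ∫⁻ s in Set.Ioi (0 : ℝ),
          ENNReal.ofReal (Real.exp (-(2 * (∑ k, A k j : ℤ) * s))) * g j s := by
  obtain ⟨K, hK, hint⟩ := exists_lintegral_comp_mulVec_log_norm h.inv
  refine ⟨K, hK, fun g hg => ?_⟩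
  have hg' : ∀ j, Measurable ((Set.Ioi (0 : ℝ)).indicator (g j)) := fun j =>
    (hg j).indicator measurableSet_Ioi
  have h1 := hint (fun t => ∏ j, (Set.Ioi (0 : ℝ)).indicator (g j) (t j)) (by fun_prop)
  rw [← lintegral_indicator h.isOpen.measurableSet]
  calc _ = ∫⁻ z : Fin n → ℂ, ∏ j, (Set.Ioi (0 : ℝ)).indicator (g j)
        (M.mulVec (fun k => Real.log ‖z k‖) j) := by
        refine lintegral_congr_ae ?_
        filter_upwards [ae_forall_ne_zero n] with z hz
        by_cases hzU : z ∈ U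
        · rw [Set.indicator_of_mem hzU]
          refine Finset.prod_congr rfl fun j _ => ?_
          rw [Set.indicator_of_mem]
          exact (h.mem_iff z hz).1 hzU j
        · rw [Set.indicator_of_notMem hzU]
          rw [h.mem_iff z hz] at hzU
          push Not at hzU
          obtain ⟨j, hj⟩ := hzU
          refine (Finset.prod_eq_zero (Finset.mem_univ j) ?_).symm
          exact Set.indicator_of_notMem (show _ ∉ Set.Ioi (0 : ℝ) from not_lt.2 hj) _
    _ = _ := h1
    _ = _ := by
        congr 1
        simp_rw [← Finset.prod_mul_distrib]
        rw [volume_pi, lintegral_pi_prod_eq_prod (fun _ => (volume : Measure ℝ))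
          (f := fun j s => ENNReal.ofReal (Real.exp ((2 * ∑ k, (-A.map fun a : ℤ => (a : ℝ)) k j) * s))
            * (Set.Ioi (0 : ℝ)).indicator (g j) s) (fun j => by have := hg' j; fun_prop)]
        refine Finset.prod_congr rfl fun j _ => ?_
        rw [← lintegral_indicator measurableSet_Ioi]
        refine lintegral_congr fun s => ?_
        by_cases hs : s ∈ Set.Ioi (0 : ℝ)
        · rw [Set.indicator_of_mem hs, Set.indicator_of_mem hs]
          congr 3
          simp
        · rw [Set.indicator_of_notMem hs, Set.indicator_of_notMem hs, mul_zero]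

end HasLogCoordinates
end Monomial

/-! ### The action of the torus -/

/-- An integral over a compact space of functions holomorphic in a parameter is holomorphic. -/
theorem differentiableOn_integral_of_compact {X : Type*} [TopologicalSpace X] [CompactSpace X]
    [MeasurableSpace X] [BorelSpace X] (μ : Measure X) [IsFiniteMeasure μ] {V : Set ℂ}
    (hV : IsOpen V) {G : ℂ → X → ℂ} (hG : ContinuousOn (Function.uncurry G) (V ×ˢ Set.univ))
    (hd : ∀ x, DifferentiableOn ℂ (fun ζ => G ζ x) V) :
    DifferentiableOn ℂ (fun ζ => ∫ x, G ζ x ∂μ) V := by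
  intro ζ₀ hζ₀
  obtain ⟨r, hr, hball⟩ : ∃ r > 0, Metric.closedBall ζ₀ (2 * r) ⊆ V := by
    obtain ⟨r, hr, h⟩ := Metric.nhds_basis_closedBall.mem_iff.1 (hV.mem_nhds hζ₀)
    exact ⟨r / 2, by positivity, by rwa [mul_div_cancel₀ _ two_ne_zero]⟩
  obtain ⟨C, hC⟩ := ((isCompact_closedBall ζ₀ (2 * r)).prod (isCompact_univ (X := X))
    ).exists_bound_of_continuousOn (hG.mono (Set.prod_mono hball subset_rfl))
  have hsec : ∀ ζ ∈ V, Continuous (G ζ) := fun ζ hζ => by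
    rw [← continuousOn_univ]
    exact hG.comp (by fun_prop : ContinuousOn (fun x => (ζ, x)) Set.univ) fun x _ => ⟨hζ, trivial⟩
  have hsub : Metric.ball ζ₀ r ⊆ V := fun ζ hζ => hball (by
    rw [Metric.mem_closedBall]; rw [Metric.mem_ball] at hζ; linarith)
  have hderiv : ∀ x, ∀ ζ ∈ V, HasDerivAt (fun ζ => G ζ x) (deriv (fun ζ => G ζ x) ζ) ζ :=
    fun x ζ hζ => ((hd x).differentiableAt (hV.mem_nhds hζ)).hasDerivAt
  refine (hasDerivAt_integral_of_dominated_loc_of_deriv_le (μ := μ) (F := G)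
    (F' := fun ζ x => deriv (fun ζ => G ζ x) ζ) (bound := fun _ => C / r)
    (Metric.ball_mem_nhds ζ₀ hr) ?_ ?_ ?_ ?_ ?_ ?_).2.differentiableAt.differentiableWithinAt
  · filter_upwards [hV.mem_nhds hζ₀] with ζ hζ using (hsec ζ hζ).aestronglyMeasurable
  · exact (hsec ζ₀ hζ₀).integrable_of_hasCompactSupport (HasCompactSupport.of_compactSpace _)
  · -- the derivative is a limit of difference quotients
    have hu : Tendsto (fun m : ℕ => ((r / 2 / (m + 1) : ℝ) : ℂ)) atTop (𝓝[≠] 0) := by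
      refine tendsto_nhdsWithin_iff.2 ⟨?_, Eventually.of_forall fun m => ?_⟩
      · rw [← Complex.ofReal_zero]
        refine (Complex.continuous_ofReal.tendsto 0).comp ?_
        exact tendsto_const_div_atTop_nhds_zero_nat (r / 2) |>.comp (tendsto_add_atTop_nat 1)
          |>.congr fun m => by simp
      · simp only [Set.mem_compl_iff, Set.mem_singleton_iff, Complex.ofReal_eq_zero]
        positivity
    refine aestronglyMeasurable_of_tendsto_ae (u := atTop)
      (f := fun (m : ℕ) x => ((r / 2 / (m + 1) : ℝ) : ℂ)⁻¹ •
        (G (ζ₀ + ((r / 2 / (m + 1) : ℝ) : ℂ)) x - G ζ₀ x)) (fun m => ?_)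
      (Eventually.of_forall fun x =>
        (hasDerivAt_iff_tendsto_slope_zero.1 (hderiv x ζ₀ hζ₀)).comp hu)
    have hm : ζ₀ + ((r / 2 / (m + 1) : ℝ) : ℂ) ∈ V := by
      apply hsub
      rw [Metric.mem_ball, dist_eq_norm, add_sub_cancel_left, Complex.norm_real,
        Real.norm_of_nonneg (by positivity), div_lt_iff₀ (by positivity)]
      nlinarith [Nat.cast_nonneg (α := ℝ) m]
    exact (((hsec _ hm).sub (hsec _ hζ₀)).const_smul
      (((r / 2 / (m + 1) : ℝ) : ℂ)⁻¹)).aestronglyMeasurable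
  · refine Eventually.of_forall fun x ζ hζ => ?_
    have hsub' : Metric.closedBall ζ r ⊆ Metric.closedBall ζ₀ (2 * r) := fun w hw => by
      rw [Metric.mem_closedBall] at *
      rw [Metric.mem_ball] at hζ
      linarith [dist_triangle w ζ ζ₀]
    refine Complex.norm_deriv_le_of_forall_mem_sphere_norm_le hr ?_ fun w hw =>
      hC (w, x) ⟨hsub' (Metric.sphere_subset_closedBall hw), trivial⟩
    refine DifferentiableOn.diffContOnCl ((hd x).mono ?_)
    exact Metric.closure_ball_subset_closedBall.trans (hsub'.trans hball)
  · exact integrable_const _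
  · exact Eventually.of_forall fun x ζ hζ => hderiv x ζ (hsub hζ)

section Rotation
variable {n : ℕ}

/-- The action of the torus on `ℂⁿ` by rotation of the coordinates. -/
noncomputable def rot (θ : UnitAddTorus (Fin n)) (z : Fin n → ℂ) : Fin n → ℂ :=
  fun k => AddCircle.toCircle (θ k) * z k

theorem continuous_rot : Continuous fun x : UnitAddTorus (Fin n) × (Fin n → ℂ) => rot x.1 x.2 := by
  unfold rot
  have := AddCircle.continuous_toCircle (T := 1)
  fun_prop

theorem norm_rot_apply (θ : UnitAddTorus (Fin n)) (z : Fin n → ℂ) (k : Fin n) :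
    ‖rot θ z k‖ = ‖z k‖ := by
  rw [rot, norm_mul, Circle.norm_coe, one_mul]

theorem rot_add (θ φ : UnitAddTorus (Fin n)) (z : Fin n → ℂ) :
    rot (θ + φ) z = rot θ (rot φ z) := by
  ext k; simp [rot, AddCircle.toCircle_add, mul_assoc]

theorem rot_zero (z : Fin n → ℂ) : rot 0 z = z := by
  ext k; simp [rot]

theorem laurentMonomial_rot (α : Fin n → ℤ) (θ : UnitAddTorus (Fin n)) (z : Fin n → ℂ) :
    laurentMonomial α (rot θ z) = UnitAddTorus.mFourier α θ * laurentMonomial α z := by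
  simp only [laurentMonomial, rot, UnitAddTorus.mFourier, ContinuousMap.coe_mk, mul_zpow,
    Finset.prod_mul_distrib, fourier_apply, AddCircle.toCircle_zsmul, Circle.coe_zpow]

theorem measurePreserving_rot (θ : UnitAddTorus (Fin n)) :
    MeasurePreserving (rot θ) (volume : Measure (Fin n → ℂ)) volume := by
  refine measurePreserving_pi (fun _ : Fin n => (volume : Measure ℂ)) (fun _ => volume) fun k => ?_
  exact (rotation (AddCircle.toCircle (θ k))).measurePreserving

/-- The average of `g` over the torus orbit of `z` against the character of frequency `α`. -/
noncomputable def angularCoeff (g : (Fin n → ℂ) → ℂ) (α : Fin n → ℤ) (z : Fin n → ℂ) : ℂ :=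
  ∫ θ, UnitAddTorus.mFourier (-α) θ * g (rot θ z) ∂torusMeasure n

theorem angularCoeff_rot (g : (Fin n → ℂ) → ℂ) (α : Fin n → ℤ) (φ : UnitAddTorus (Fin n))
    (z : Fin n → ℂ) :
    angularCoeff g α (rot φ z) = UnitAddTorus.mFourier α φ * angularCoeff g α z := by
  unfold angularCoeff
  rw [← integral_add_right_eq_self (μ := torusMeasure n)
    (fun θ => UnitAddTorus.mFourier (-α) θ * g (rot θ z)) φ, ← integral_const_mul]
  refine integral_congr_ae (Eventually.of_forall fun θ => ?_)
  simp only
  rw [mFourier_add_apply, rot_add]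
  have h1 : UnitAddTorus.mFourier α φ * UnitAddTorus.mFourier (-α) φ = 1 := by
    rw [← UnitAddTorus.mFourier_add, add_neg_cancel, UnitAddTorus.mFourier_zero]; rfl
  linear_combination -(UnitAddTorus.mFourier (-α) θ * g (rot θ (rot φ z))) * h1

theorem exists_rot_eq {z w : Fin n → ℂ} (h : ∀ k, ‖z k‖ = ‖w k‖) : ∃ θ, rot θ z = w := by
  have : ∀ k, ∃ t : UnitAddCircle, (AddCircle.toCircle t : ℂ) * z k = w k := by
    intro k
    by_cases hz : z k = 0
    · refine ⟨0, ?_⟩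
      have := h k
      rw [hz, norm_zero, eq_comm, norm_eq_zero] at this
      rw [hz, this, mul_zero]
    · have hn : ‖w k / z k‖ = 1 := by
        rw [norm_div, h, div_self]; rw [← h]; exact norm_ne_zero_iff.2 hz
      obtain ⟨t, ht⟩ := (AddCircle.homeomorphCircle (T := 1) one_ne_zero).surjective
        (⟨w k / z k, mem_sphere_zero_iff_norm.2 hn⟩ : Circle)
      rw [AddCircle.homeomorphCircle_apply] at ht
      exact ⟨t, by rw [ht]; exact div_mul_cancel₀ _ hz⟩
  choose θ hθ using this
  exact ⟨θ, funext hθ⟩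

namespace HasLogCoordinates
variable {U : Set (Fin n → ℂ)} {A : Matrix (Fin n) (Fin n) ℤ} {M : Matrix (Fin n) (Fin n) ℝ}

theorem rot_mem (h : HasLogCoordinates U A M) (θ : UnitAddTorus (Fin n)) {z : Fin n → ℂ}
    (hz : z ∈ U) : rot θ z ∈ U :=
  h.mem_of_norm_eq z _ (fun k => (norm_rot_apply θ z k).symm) hz

theorem rot_mem_iff (h : HasLogCoordinates U A M) (θ : UnitAddTorus (Fin n)) (z : Fin n → ℂ) :
    rot θ z ∈ U ↔ z ∈ U :=
  ⟨h.mem_of_norm_eq _ _ (norm_rot_apply θ z), h.rot_mem θ⟩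

theorem measurePreserving_rot (h : HasLogCoordinates U A M) (θ : UnitAddTorus (Fin n)) :
    MeasurePreserving (rot θ) (volume.restrict U) (volume.restrict U) := by
  have := (_root_.measurePreserving_rot θ).restrict_preimage h.isOpen.measurableSet
  rwa [show rot θ ⁻¹' U = U from Set.ext fun z => h.rot_mem_iff θ z] at this

theorem continuousOn_comp_rot (h : HasLogCoordinates U A M) {g : (Fin n → ℂ) → ℂ}
    (hg : ContinuousOn g U) : ContinuousOn
      (fun x : (Fin n → ℂ) × UnitAddTorus (Fin n) => g (rot x.2 x.1)) (U ×ˢ Set.univ) :=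
  hg.comp (continuous_rot.comp continuous_swap).continuousOn fun x hx => h.rot_mem x.2 hx.1

theorem continuous_comp_rot (h : HasLogCoordinates U A M) {g : (Fin n → ℂ) → ℂ}
    (hg : ContinuousOn g U) {z : Fin n → ℂ} (hz : z ∈ U) : Continuous fun θ => g (rot θ z) := by
  rw [← continuousOn_univ]
  exact (h.continuousOn_comp_rot hg).comp
    (by fun_prop : ContinuousOn (fun θ : UnitAddTorus (Fin n) => (z, θ)) Set.univ)
    fun θ _ => ⟨hz, trivial⟩

theorem exists_bound_rot (h : HasLogCoordinates U A M) {g : (Fin n → ℂ) → ℂ}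
    (hg : ContinuousOn g U) {s : Set (Fin n → ℂ)} (hs : IsCompact s) (hsU : s ⊆ U) :
    ∃ C, ∀ z ∈ s, ∀ θ, ‖g (rot θ z)‖ ≤ C := by
  obtain ⟨C, hC⟩ := (hs.prod (isCompact_univ (X := UnitAddTorus (Fin n)))
    ).exists_bound_of_continuousOn
    ((h.continuousOn_comp_rot hg).mono (Set.prod_mono hsU subset_rfl))
  exact ⟨C, fun z hz θ => hC (z, θ) ⟨hz, trivial⟩⟩

theorem norm_angularCoeff_le {g : (Fin n → ℂ) → ℂ} {z : Fin n → ℂ} {C : ℝ}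
    (hC : ∀ θ, ‖g (rot θ z)‖ ≤ C) (α : Fin n → ℤ) : ‖angularCoeff g α z‖ ≤ C := by
  have := norm_integral_le_of_norm_le_const (μ := torusMeasure n) (C := C)
    (f := fun θ => UnitAddTorus.mFourier (-α) θ * g (rot θ z))
    (Eventually.of_forall fun θ => by rw [norm_mul, norm_mFourier_apply, one_mul]; exact hC θ)
  simpa [angularCoeff] using this

theorem continuousOn_angularCoeff (h : HasLogCoordinates U A M) {g : (Fin n → ℂ) → ℂ}
    (hg : ContinuousOn g U) (α : Fin n → ℤ) : ContinuousOn (angularCoeff g α) U := by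
  intro z hz
  obtain ⟨r, hr, hball⟩ := Metric.nhds_basis_closedBall.mem_iff.1 (h.isOpen.mem_nhds hz)
  obtain ⟨C, hC⟩ := h.exists_bound_rot hg (isCompact_closedBall z r) hball
  refine ContinuousAt.continuousWithinAt ?_
  have hmeas : ∀ w ∈ U, Continuous fun θ => UnitAddTorus.mFourier (-α) θ * g (rot θ w) :=
    fun w hw => (map_continuous _).mul (h.continuous_comp_rot hg hw)
  refine continuousAt_of_dominated (bound := fun _ => C) ?_ ?_ (integrable_const _) ?_
  · filter_upwards [h.isOpen.mem_nhds hz] with w hw using (hmeas w hw).aestronglyMeasurable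
  · filter_upwards [Metric.closedBall_mem_nhds z hr] with w hw
    exact Eventually.of_forall fun θ => by
      rw [norm_mul, norm_mFourier_apply, one_mul]; exact hC w hw θ
  · refine Eventually.of_forall fun θ => continuousAt_const.mul ?_
    have h1 : ContinuousAt g (rot θ z) := hg.continuousAt (h.isOpen.mem_nhds (h.rot_mem θ hz))
    exact ContinuousAt.comp (f := rot θ) h1
      (continuous_rot.comp (by fun_prop : Continuous fun w => (θ, w))).continuousAt

end HasLogCoordinates
end Rotation

/-! ### Laurent coefficients -/

section Laurent
variable {n : ℕ}

theorem laurentMonomial_exp (α : Fin n → ℤ) (x : Fin n → ℂ) :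
    laurentMonomial α (fun k => Complex.exp (x k)) = Complex.exp (∑ k, α k * x k) := by
  simp only [laurentMonomial, Complex.exp_sum, Complex.exp_int_mul]

namespace HasLogCoordinates
variable {U : Set (Fin n → ℂ)} {A : Matrix (Fin n) (Fin n) ℤ} {M : Matrix (Fin n) (Fin n) ℝ}

theorem angularCoeff_div_rot (g : (Fin n → ℂ) → ℂ) (α : Fin n → ℤ) (φ : UnitAddTorus (Fin n))
    (z : Fin n → ℂ) : angularCoeff g α (rot φ z) / laurentMonomial α (rot φ z) =
      angularCoeff g α z / laurentMonomial α z := by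
  rw [angularCoeff_rot, laurentMonomial_rot, mul_div_mul_left]
  rw [← norm_ne_zero_iff, norm_mFourier_apply]; exact one_ne_zero

/-- The quotient of the angular coefficient by the monomial does not depend on the point: along a
complex line in logarithmic coordinates it is holomorphic and invariant under imaginary
translations. -/
theorem angularCoeff_div_eq (h : HasLogCoordinates U A M) {g : (Fin n → ℂ) → ℂ}
    (hg : DifferentiableOn ℂ g U) (α : Fin n → ℤ) {z w : Fin n → ℂ} (hz : z ∈ U) (hw : w ∈ U)
    (hz0 : ∀ k, z k ≠ 0) (hw0 : ∀ k, w k ≠ 0) :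
    angularCoeff g α z / laurentMonomial α z = angularCoeff g α w / laurentMonomial α w := by
  set x : Fin n → ℝ := fun k => Real.log ‖z k‖
  set v : Fin n → ℝ := fun k => Real.log ‖w k‖ - Real.log ‖z k‖ with hv
  -- `E` is the complex line through the logarithms; `E 0` and `E 1` have the moduli of `z` and `w`
  set E : ℂ → Fin n → ℂ := fun ζ k => Complex.exp (x k + ζ * v k) with hE
  have hE0 : ∀ ζ k, E ζ k ≠ 0 := fun ζ k => Complex.exp_ne_zero _
  have hEn : ∀ ζ k, ‖E ζ k‖ = Real.exp (x k + ζ.re * v k) := fun ζ k => by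
    simp [hE, Complex.norm_exp]
  have hEd : Differentiable ℂ E := by
    rw [differentiable_pi]; intro k; simp only [hE]; fun_prop
  set V : Set ℂ := E ⁻¹' U
  have hV : IsOpen V := h.isOpen.preimage hEd.continuous
  have hmemV : ∀ t : ℝ, t ∈ Set.Icc (0 : ℝ) 1 → (t : ℂ) ∈ V := by
    intro t ht
    change E t ∈ U
    rw [h.mem_iff _ (hE0 _)]
    intro j
    have h1 := (h.mem_iff z hz0).1 hz j
    have h2 := (h.mem_iff w hw0).1 hw j
    have h3 : M.mulVec (fun k => Real.log ‖E t k‖) j = (1 - t) * M.mulVec (fun k => Real.log ‖z k‖) j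
        + t * M.mulVec (fun k => Real.log ‖w k‖) j := by
      simp only [Matrix.mulVec, dotProduct, hEn, Real.log_exp, Complex.ofReal_re, Finset.mul_sum,
        ← Finset.sum_add_distrib, x, hv]
      exact Finset.sum_congr rfl fun k _ => by ring
    rw [h3]
    rcases eq_or_lt_of_le ht.1 with h0 | h0
    · rw [← h0]; simpa using h1
    · have := mul_pos h0 h2
      have := mul_nonneg (sub_nonneg.2 ht.2) h1.le
      linarith
  set Ψ : ℂ → ℂ := fun ζ => angularCoeff g α (E ζ) / laurentMonomial α (E ζ) with hΨ
  have hΨd : DifferentiableOn ℂ Ψ V := by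
    refine DifferentiableOn.div ?_ ?_ fun ζ _ => laurentMonomial_ne_zero α (hE0 ζ)
    · refine differentiableOn_integral_of_compact (torusMeasure n) hV
        (G := fun ζ θ => UnitAddTorus.mFourier (-α) θ * g (rot θ (E ζ))) ?_ fun θ => ?_
      · refine ContinuousOn.mul (by fun_prop) ?_
        exact (h.continuousOn_comp_rot hg.continuousOn).comp
          (f := fun p : ℂ × UnitAddTorus (Fin n) => (E p.1, p.2))
          ((hEd.continuous.comp continuous_fst).prodMk continuous_snd).continuousOn
          fun p hp => ⟨hp.1, trivial⟩
      · refine DifferentiableOn.const_mul ?_ _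
        refine hg.comp (f := fun ζ => rot θ (E ζ)) ?_ fun ζ hζ => h.rot_mem θ hζ
        refine Differentiable.differentiableOn ?_
        rw [differentiable_pi]; intro k
        exact ((differentiable_pi.1 hEd) k).const_mul _
    · simp only [hE, laurentMonomial_exp]
      refine Differentiable.differentiableOn ?_
      fun_prop
  have hΨi : ∀ ζ (t : ℝ), Ψ (ζ + t * Complex.I) = Ψ ζ := by
    intro ζ t
    obtain ⟨φ, hφ⟩ := exists_rot_eq (z := E ζ) (w := E (ζ + t * Complex.I)) fun k => by
      rw [hEn, hEn]; simp
    simp only [hΨ]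
    rw [← hφ, angularCoeff_div_rot]
  have hΨ' : ∀ ζ ∈ V, HasDerivAt Ψ 0 ζ := by
    intro ζ hζ
    have h1 := (hΨd.differentiableAt (hV.mem_nhds hζ)).hasDerivAt
    have h2 : HasDerivAt (fun t : ℝ => ζ + t * Complex.I) Complex.I 0 := by
      simpa using ((Complex.ofRealCLM.hasDerivAt (x := (0 : ℝ))).mul_const Complex.I).const_add ζ
    have h3 : HasDerivAt (fun t : ℝ => Ψ (ζ + t * Complex.I)) (deriv Ψ ζ * Complex.I) 0 :=
      HasDerivAt.comp (h₂ := Ψ) (h := fun t : ℝ => ζ + t * Complex.I) (0 : ℝ) (by simpa using h1) h2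
    simp_rw [hΨi] at h3
    have h4 := h3.unique (hasDerivAt_const (0 : ℝ) (Ψ ζ))
    have h5 : deriv Ψ ζ = 0 := (mul_eq_zero.1 h4).resolve_right Complex.I_ne_zero
    rwa [h5] at h1
  have hconst := constant_of_has_deriv_right_zero (f := fun t : ℝ => Ψ t) (a := 0) (b := 1)
    (fun t ht => ((hΨ' t (hmemV t ht)).comp_ofReal).continuousAt.continuousWithinAt)
    (fun t ht => ((hΨ' t (hmemV t ⟨ht.1, ht.2.le⟩)).comp_ofReal).hasDerivWithinAt)
    1 (Set.right_mem_Icc.2 zero_le_one)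
  obtain ⟨φ₀, hφ₀⟩ := exists_rot_eq (z := E 0) (w := z) fun k => by
    rw [hEn]; simp [x, Real.exp_log (norm_pos_iff.2 (hz0 k))]
  obtain ⟨φ₁, hφ₁⟩ := exists_rot_eq (z := E 1) (w := w) fun k => by
    rw [hEn]; simp [x, hv, Real.exp_log (norm_pos_iff.2 (hw0 k))]
  rw [← hφ₀, ← hφ₁, angularCoeff_div_rot, angularCoeff_div_rot]
  simpa [hΨ] using hconst.symm

theorem exists_mem_forall_ne_zero (h : HasLogCoordinates U A M) : ∃ z ∈ U, ∀ k, z k ≠ 0 := by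
  obtain ⟨z, hz, hz0⟩ := (dense_forall_ne_zero n).inter_open_nonempty U h.isOpen h.nonempty
  exact ⟨z, hz, hz0⟩

/-- The Laurent coefficients of a holomorphic function. -/
theorem exists_angularCoeff_eq (h : HasLogCoordinates U A M) {g : (Fin n → ℂ) → ℂ}
    (hg : DifferentiableOn ℂ g U) : ∃ c : (Fin n → ℤ) → ℂ, ∀ α, ∀ z ∈ U, (∀ k, z k ≠ 0) →
      angularCoeff g α z = c α * laurentMonomial α z := by
  obtain ⟨w, hw, hw0⟩ := h.exists_mem_forall_ne_zero
  refine ⟨fun α => angularCoeff g α w / laurentMonomial α w, fun α z hz hz0 => ?_⟩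
  simp only
  rw [← h.angularCoeff_div_eq hg α hz hw hz0 hw0, div_mul_cancel₀ _ (laurentMonomial_ne_zero α hz0)]

/-- A monomial with a nonzero coefficient has no pole on `U`. -/
theorem nonneg_of_coeff_ne_zero (h : HasLogCoordinates U A M) {g : (Fin n → ℂ) → ℂ}
    (hg : ContinuousOn g U) {α : Fin n → ℤ} {c : ℂ} (hc : c ≠ 0)
    (hcα : ∀ z ∈ U, (∀ k, z k ≠ 0) → angularCoeff g α z = c * laurentMonomial α z)
    {k : Fin n} {z : Fin n → ℂ} (hz : z ∈ U) (hzk : z k = 0) : 0 ≤ α k := by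
  by_contra! hk
  obtain ⟨r, hr, hball⟩ := Metric.nhds_basis_closedBall.mem_iff.1 (h.isOpen.mem_nhds hz)
  obtain ⟨C, hC⟩ := h.exists_bound_rot hg (isCompact_closedBall z r) hball
  -- move the zero coordinates of `z` away from zero, the `k`-th one by `t`
  set u : Fin n → ℂ := fun j => if z j = 0 then (r : ℂ) else z j
  have hu0 : ∀ j, u j ≠ 0 := fun j => by
    simp only [u]; split_ifs with h0
    · exact_mod_cast hr.ne'
    · exact h0
  set D : ℝ := ‖c‖ * ∏ j ∈ Finset.univ.erase k, ‖u j‖ ^ α j with hD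
  have hD0 : 0 < D := mul_pos (norm_pos_iff.2 hc)
    (Finset.prod_pos fun j _ => zpow_pos (norm_pos_iff.2 (hu0 j)) _)
  have key : ∀ t : ℝ, 0 < t → t ≤ r → D * t ^ α k ≤ C := by
    intro t ht htr
    set w : Fin n → ℂ := Function.update u k (t : ℂ)
    have hw0 : ∀ j, w j ≠ 0 := by
      intro j
      by_cases hj : j = k
      · subst hj; simp [w, ht.ne']
      · simp [w, hj, hu0 j]
    have hwb : w ∈ Metric.closedBall z r := by
      rw [Metric.mem_closedBall, dist_pi_le_iff hr.le]
      intro j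
      by_cases hj : j = k
      · subst hj
        simp [w, hzk, abs_of_pos ht, htr]
      · simp only [w, u, Function.update_of_ne hj]
        split_ifs with h0
        · simp [h0, abs_of_pos hr]
        · simp [hr.le]
    have h1 := norm_angularCoeff_le (hC w hwb) α
    rw [hcα w (hball hwb) hw0, norm_mul, norm_laurentMonomial,
      ← Finset.mul_prod_erase _ _ (Finset.mem_univ k)] at h1
    have h2 : ∏ j ∈ Finset.univ.erase k, ‖w j‖ ^ α j = ∏ j ∈ Finset.univ.erase k, ‖u j‖ ^ α j :=
      Finset.prod_congr rfl fun j hj => by simp [w, Finset.ne_of_mem_erase hj]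
    rw [h2] at h1
    simp only [w, Function.update_self, Complex.norm_real, Real.norm_of_nonneg ht.le] at h1
    rw [hD]; linarith
  have hC0 : 0 < C := lt_of_lt_of_le (by positivity) (key r hr le_rfl)
  -- for small `t` the bound `key` contradicts `α k ≤ -1`
  set t : ℝ := min (min r 1) (D / (2 * C))
  have ht0 : 0 < t := by positivity
  have h1 := key t ht0 ((min_le_left _ _).trans (min_le_left _ _))
  have h2 : t⁻¹ ≤ t ^ α k := by
    rw [← zpow_neg_one]
    exact zpow_le_zpow_right_of_le_one₀ ht0 ((min_le_left _ _).trans (min_le_right _ _)) (by omega)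
  have h3 : D * t⁻¹ ≤ C := (mul_le_mul_of_nonneg_left h2 hD0.le).trans h1
  have h4 : t ≤ D / (2 * C) := min_le_right _ _
  rw [le_div_iff₀ (by positivity)] at h4
  rw [← div_eq_mul_inv, div_le_iff₀ ht0] at h3
  linarith

end HasLogCoordinates

theorem differentiableAt_laurentMonomial {α : Fin n → ℤ} {z : Fin n → ℂ}
    (hα : ∀ k, z k = 0 → 0 ≤ α k) : DifferentiableAt ℂ (laurentMonomial α) z := by
  unfold laurentMonomial
  suffices hk : ∀ k, DifferentiableAt ℂ (fun z : Fin n → ℂ => z k ^ α k) z by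
    exact (HasFDerivAt.finsetProd fun k _ => (hk k).hasFDerivAt).differentiableAt
  intro k
  refine DifferentiableAt.zpow (differentiableAt_apply k z) ?_
  by_cases hz : z k = 0
  · exact Or.inr (hα k hz)
  · exact Or.inl hz

theorem differentiableOn_laurentMonomial {U : Set (Fin n → ℂ)} {α : Fin n → ℤ}
    (hα : ∀ k, ∀ z ∈ U, z k = 0 → 0 ≤ α k) : DifferentiableOn ℂ (laurentMonomial α) U :=
  fun z hz => (differentiableAt_laurentMonomial fun k hk => hα k z hz hk).differentiableWithinAt

end Laurent

/-! ### Laurent expansions -/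

theorem summable_prod_pow_natAbs (n : ℕ) {q : ℝ} (hq0 : 0 ≤ q) (hq1 : q < 1) :
    Summable fun α : Fin n → ℤ => ∏ k, q ^ (α k).natAbs := by
  classical
  have h1 : Summable fun a : ℤ => q ^ a.natAbs := by
    have := summable_geometric_of_lt_one hq0 hq1
    exact Summable.of_nat_of_neg (by simpa using this) (by simpa using this)
  refine summable_of_sum_le (c := ∏ _k : Fin n, ∑' a : ℤ, q ^ a.natAbs)
    (fun α => Finset.prod_nonneg fun k _ => by positivity) fun s => ?_
  calc ∑ α ∈ s, ∏ k, q ^ (α k).natAbs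
      ≤ ∑ α ∈ Fintype.piFinset fun k => s.image fun α => α k, ∏ k, q ^ (α k).natAbs := by
        refine Finset.sum_le_sum_of_subset_of_nonneg (fun α hα => ?_) fun α _ _ =>
          Finset.prod_nonneg fun k _ => by positivity
        exact Fintype.mem_piFinset.2 fun k => Finset.mem_image_of_mem _ hα
    _ = ∏ k, ∑ a ∈ s.image fun α => α k, q ^ a.natAbs :=
        (Finset.prod_univ_sum (fun k => s.image fun α => α k) fun _ a => q ^ a.natAbs).symm
    _ ≤ _ := Finset.prod_le_prod (fun k _ => Finset.sum_nonneg fun a _ => by positivity)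
        fun k _ => h1.sum_le_tsum _ fun a _ => by positivity

section Laurent
variable {n : ℕ} {U : Set (Fin n → ℂ)} {A : Matrix (Fin n) (Fin n) ℤ}
  {M : Matrix (Fin n) (Fin n) ℝ}

/-- `c` gives the angular coefficients of `g` at all points of `U`; in particular no monomial with a
pole on `U` has a nonzero coefficient. -/
structure HasAngularCoeff (U : Set (Fin n → ℂ)) (g : (Fin n → ℂ) → ℂ) (c : (Fin n → ℤ) → ℂ) :
    Prop where
  nonneg : ∀ α, c α ≠ 0 → ∀ k, ∀ z ∈ U, z k = 0 → 0 ≤ α k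
  eq : ∀ α, ∀ z ∈ U, angularCoeff g α z = c α * laurentMonomial α z

/-- The relation between angular coefficients and monomials extends to the coordinate hyperplanes by
continuity. -/
theorem HasLogCoordinates.exists_hasAngularCoeff (h : HasLogCoordinates U A M)
    {g : (Fin n → ℂ) → ℂ} (hg : DifferentiableOn ℂ g U) : ∃ c, HasAngularCoeff U g c := by
  obtain ⟨c, hc⟩ := h.exists_angularCoeff_eq hg
  have hnn : ∀ α, c α ≠ 0 → ∀ k, ∀ z ∈ U, z k = 0 → 0 ≤ α k := fun α hα k z hz hzk =>
    h.nonneg_of_coeff_ne_zero hg.continuousOn hα (hc α) hz hzk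
  refine ⟨c, hnn, fun α z hz => ?_⟩
  have hcont : ContinuousOn (fun z => c α * laurentMonomial α z) U := by
    by_cases hα : c α = 0
    · simp only [hα, zero_mul]; exact continuousOn_const
    · exact continuousOn_const.mul (differentiableOn_laurentMonomial (hnn α hα)).continuousOn
  have heq : Set.EqOn (angularCoeff g α) (fun z => c α * laurentMonomial α z)
      (U ∩ {z | ∀ k, z k ≠ 0}) := fun w hw => hc α w hw.1 hw.2
  exact heq.of_subset_closure (h.continuousOn_angularCoeff hg.continuousOn α) hcont
    Set.inter_subset_left ((dense_forall_ne_zero n).open_subset_closure_inter h.isOpen) hz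

/-- Cauchy estimates: near each point of `U` the terms of the Laurent series decay geometrically. -/
theorem HasLogCoordinates.exists_geometric_bound (h : HasLogCoordinates U A M)
    {g : (Fin n → ℂ) → ℂ} (hg : ContinuousOn g U) {c : (Fin n → ℤ) → ℂ}
    (hc : HasAngularCoeff U g c) {z : Fin n → ℂ} (hz : z ∈ U) :
    ∃ C q : ℝ, 0 ≤ q ∧ q < 1 ∧ ∀ᶠ w in 𝓝 z, ∀ α,
      ‖c α * laurentMonomial α w‖ ≤ C * ∏ k, q ^ (α k).natAbs := by
  obtain ⟨r, hr, hball⟩ := Metric.nhds_basis_closedBall.mem_iff.1 (h.isOpen.mem_nhds hz)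
  obtain ⟨C, hC⟩ := h.exists_bound_rot hg (isCompact_closedBall z r) hball
  -- the moduli of the coordinates may be changed by the factor `ρ` inside the ball
  set ρ : ℝ := 1 + min 1 (r / (2 * (‖z‖ + r))) with hρ
  have hm0 : 0 < min 1 (r / (2 * (‖z‖ + r))) := by positivity
  have hρ1 : 1 < ρ := by linarith
  have hρ2 : ρ ≤ 2 := by linarith [min_le_left 1 (r / (2 * (‖z‖ + r)))]
  have hρ3 : (ρ - 1) * (‖z‖ + r) ≤ r / 2 := by
    have h1 : ρ - 1 ≤ r / (2 * (‖z‖ + r)) := by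
      rw [hρ, add_sub_cancel_left]; exact min_le_right _ _
    rw [le_div_iff₀ (by positivity)] at h1
    linarith
  have hρinv : |ρ⁻¹ - 1| ≤ ρ - 1 := by
    have : ρ⁻¹ ≤ 1 := inv_le_one_of_one_le₀ hρ1.le
    rw [abs_sub_comm, abs_of_nonneg (by linarith)]
    have h2 : ρ * ρ⁻¹ = 1 := mul_inv_cancel₀ (by linarith)
    nlinarith
  refine ⟨C, ρ⁻¹, by positivity, inv_lt_one_of_one_lt₀ hρ1, ?_⟩
  have hnz : ∀ᶠ w in 𝓝 z, ∀ k, z k ≠ 0 → w k ≠ 0 := by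
    rw [eventually_all]
    intro k
    by_cases hk : z k = 0
    · simp [hk]
    · filter_upwards [(continuous_apply k).continuousAt.eventually_ne hk] with w hw _ using hw
  filter_upwards [Metric.closedBall_mem_nhds z (half_pos hr), hnz] with w hw hw0 α
  rw [Metric.mem_closedBall, dist_pi_le_iff (half_pos hr).le] at hw
  have hC0 : 0 ≤ C := (norm_nonneg _).trans (hC z (Metric.mem_closedBall_self hr.le) 0)
  by_cases hα : c α = 0
  · rw [hα, zero_mul, norm_zero]; positivity
  -- dilate the coordinates with positive exponent, contract those with negative exponent
  set w' : Fin n → ℂ := fun k => if z k = 0 then (r : ℂ) else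
    ((if 0 ≤ α k then ρ else ρ⁻¹ : ℝ) : ℂ) * w k with hw'
  have hwn : ∀ k, ‖w k‖ ≤ ‖z‖ + r := fun k => by
    have h1 := hw k
    rw [dist_eq_norm] at h1
    have h2 := norm_le_pi_norm z k
    have h3 : ‖w k‖ ≤ ‖w k - z k‖ + ‖z k‖ := by simpa using norm_add_le (w k - z k) (z k)
    linarith
  have hwb : w' ∈ Metric.closedBall z r := by
    rw [Metric.mem_closedBall, dist_pi_le_iff hr.le]
    intro k
    simp only [hw']
    split_ifs with h0 hk
    · simp [h0, abs_of_pos hr]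
    · have e : (ρ : ℂ) * w k - z k = ((ρ - 1 : ℝ) : ℂ) * w k + (w k - z k) := by push_cast; ring
      rw [dist_eq_norm, e]
      refine (norm_add_le _ _).trans ?_
      rw [norm_mul, Complex.norm_real, Real.norm_of_nonneg (by linarith), ← dist_eq_norm]
      have := mul_le_mul_of_nonneg_left (hwn k) (by linarith : 0 ≤ ρ - 1)
      linarith [hw k]
    · have e : ((ρ⁻¹ : ℝ) : ℂ) * w k - z k = ((ρ⁻¹ - 1 : ℝ) : ℂ) * w k + (w k - z k) := by
        push_cast; ring
      rw [dist_eq_norm, e]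
      refine (norm_add_le _ _).trans ?_
      rw [norm_mul, Complex.norm_real, Real.norm_eq_abs, ← dist_eq_norm]
      have := mul_le_mul hρinv (hwn k) (norm_nonneg _) (by linarith : 0 ≤ ρ - 1)
      linarith [hw k]
  have hterm : ∀ k, ‖w k‖ ^ α k ≤ ρ⁻¹ ^ (α k).natAbs * ‖w' k‖ ^ α k := by
    intro k
    by_cases h0 : z k = 0
    · obtain ⟨m, hm⟩ := Int.eq_ofNat_of_zero_le (hc.nonneg α hα k z hz h0)
      have h1 := hw k
      rw [h0, dist_zero_right] at h1
      simp only [hw', h0, if_true, hm, Int.natAbs_natCast, zpow_natCast, ← mul_pow]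
      refine pow_le_pow_left₀ (norm_nonneg _) ?_ m
      rw [Complex.norm_real, Real.norm_of_nonneg hr.le, ← div_eq_inv_mul, le_div_iff₀ (by linarith)]
      nlinarith [norm_nonneg (w k)]
    · have hρ0 : ρ ≠ 0 := by linarith
      simp only [hw', h0, if_false, norm_mul, Complex.norm_real]
      split_ifs with hk
      · obtain ⟨m, hm⟩ := Int.eq_ofNat_of_zero_le hk
        rw [hm, Int.natAbs_natCast, zpow_natCast, zpow_natCast, Real.norm_of_nonneg (by linarith),
          mul_pow, ← mul_assoc, ← mul_pow, inv_mul_cancel₀ hρ0, one_pow, one_mul]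
      · obtain ⟨m, hm⟩ := Int.eq_ofNat_of_zero_le (by omega : 0 ≤ -α k)
        have hm' : α k = -(m : ℤ) := by omega
        rw [hm', Int.natAbs_neg, Int.natAbs_natCast, zpow_neg, zpow_neg, zpow_natCast, zpow_natCast,
          Real.norm_of_nonneg (by positivity), mul_pow, mul_inv, ← inv_pow, ← inv_pow, inv_inv,
          ← mul_assoc, ← mul_pow, inv_mul_cancel₀ hρ0, one_pow, one_mul]
  calc ‖c α * laurentMonomial α w‖ = ‖c α‖ * ∏ k, ‖w k‖ ^ α k := by
        rw [norm_mul, norm_laurentMonomial]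
    _ ≤ ‖c α‖ * ∏ k, (ρ⁻¹ ^ (α k).natAbs * ‖w' k‖ ^ α k) := by
        gcongr with k _
        exact hterm k
    _ = ‖c α * laurentMonomial α w'‖ * ∏ k, ρ⁻¹ ^ (α k).natAbs := by
        rw [norm_mul, norm_laurentMonomial, Finset.prod_mul_distrib]; ring
    _ ≤ C * ∏ k, ρ⁻¹ ^ (α k).natAbs := by
        gcongr
        rw [← hc.eq α w' (hball hwb)]
        exact HasLogCoordinates.norm_angularCoeff_le (hC w' hwb) α

theorem HasLogCoordinates.exists_summable_bound (h : HasLogCoordinates U A M)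
    {g : (Fin n → ℂ) → ℂ} (hg : ContinuousOn g U) {c : (Fin n → ℤ) → ℂ}
    (hc : HasAngularCoeff U g c) {K : Set (Fin n → ℂ)} (hKU : K ⊆ U) (hK : IsCompact K) :
    ∃ m : (Fin n → ℤ) → ℝ, Summable m ∧ ∀ α, ∀ z ∈ K, ‖c α * laurentMonomial α z‖ ≤ m α := by
  refine hK.induction_on (p := fun K => ∃ m : (Fin n → ℤ) → ℝ, Summable m ∧
    ∀ α, ∀ z ∈ K, ‖c α * laurentMonomial α z‖ ≤ m α) ?_ ?_ ?_ ?_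
  · exact ⟨0, summable_zero, by simp⟩
  · rintro s t hst ⟨m, hm, H⟩
    exact ⟨m, hm, fun α z hz => H α z (hst hz)⟩
  · rintro s t ⟨m, hm, H⟩ ⟨m', hm', H'⟩
    refine ⟨fun α => |m α| + |m' α|, hm.abs.add hm'.abs, fun α z hz => ?_⟩
    rcases hz with hz | hz
    · linarith [H α z hz, le_abs_self (m α), abs_nonneg (m' α)]
    · linarith [H' α z hz, le_abs_self (m' α), abs_nonneg (m α)]
  · intro z hz
    obtain ⟨C, q, hq0, hq1, hev⟩ := h.exists_geometric_bound hg hc (hKU hz)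
    exact ⟨_, mem_nhdsWithin_of_mem_nhds hev, _, (summable_prod_pow_natAbs n hq0 hq1).mul_left C,
      fun α w hw => hw α⟩

theorem integral_mFourier (γ : Fin n → ℤ) :
    ∫ θ, UnitAddTorus.mFourier γ θ ∂torusMeasure n = if γ = 0 then 1 else 0 := by
  have h1 : ∀ m : ℤ, ∫ t : UnitAddCircle, fourier m t ∂AddCircle.haarAddCircle =
      if m = 0 then (1 : ℂ) else 0 := by
    intro m
    have := congrFun (fourierCoeff_fourier (T := 1) m) 0
    simp only [fourierCoeff, neg_zero, fourier_zero, one_smul] at this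
    rw [this, Pi.single_apply]
    simp only [eq_comm]
  simp only [UnitAddTorus.mFourier, ContinuousMap.coe_mk]
  rw [integral_fintype_prod_eq_prod (fun k (t : UnitAddCircle) => (fourier (γ k) t : ℂ))]
  simp_rw [h1]
  split_ifs with h0
  · simp [h0]
  · obtain ⟨k, hk⟩ := Function.ne_iff.1 h0
    exact Finset.prod_eq_zero (Finset.mem_univ k) (if_neg hk)

theorem mFourierCoeff_comp_rot (g : (Fin n → ℂ) → ℂ) (α : Fin n → ℤ) (z : Fin n → ℂ) :
    UnitAddTorus.mFourierCoeff (fun θ => g (rot θ z)) α = angularCoeff g α z := rfl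

/-- The series converges to `g z` because it is the Fourier series, at the unit of the torus, of the
function `θ ↦ g (θ · z)`, whose coefficients are summable. -/
theorem HasLogCoordinates.hasLaurentExpansion (h : HasLogCoordinates U A M)
    {g : (Fin n → ℂ) → ℂ} (hg : DifferentiableOn ℂ g U) {c : (Fin n → ℤ) → ℂ}
    (hc : HasAngularCoeff U g c) : HasLaurentExpansion U g c where
  holomorphic α hα := differentiableOn_laurentMonomial (hc.nonneg α hα)
  normal K hKU hK := h.exists_summable_bound hg.continuousOn hc hKU hK
  hasSum z hz := by
    set f : C(UnitAddTorus (Fin n), ℂ) := ⟨fun θ => g (rot θ z),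
      h.continuous_comp_rot hg.continuousOn hz⟩
    have hcoeff : ∀ α, UnitAddTorus.mFourierCoeff f α = c α * laurentMonomial α z := fun α =>
      (mFourierCoeff_comp_rot g α z).trans (hc.eq α z hz)
    obtain ⟨m, hm, hmb⟩ := h.exists_summable_bound hg.continuousOn hc
      (Set.singleton_subset_iff.2 hz) isCompact_singleton
    have hs : Summable (UnitAddTorus.mFourierCoeff f) :=
      Summable.of_norm_bounded hm fun α => by rw [hcoeff]; exact hmb α z rfl
    have := UnitAddTorus.hasSum_mFourier_series_apply_of_summable hs 0
    simp only [hcoeff] at this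
    simpa [f, rot_zero, UnitAddTorus.mFourier] using this

/-- The coefficients of a normally convergent Laurent series are its angular coefficients. -/
theorem HasLogCoordinates.angularCoeff_eq_of_hasLaurentExpansion (h : HasLogCoordinates U A M)
    {g : (Fin n → ℂ) → ℂ} {c : (Fin n → ℤ) → ℂ} (hgc : HasLaurentExpansion U g c)
    (α : Fin n → ℤ) {z : Fin n → ℂ} (hz : z ∈ U) :
    angularCoeff g α z = c α * laurentMonomial α z := by
  have hK : IsCompact ((fun θ => rot θ z) '' Set.univ) :=
    isCompact_univ.image (continuous_rot.comp (by fun_prop : Continuous fun θ => (θ, z)))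
  obtain ⟨m, hm, hmb⟩ := hgc.normal _ (by rintro _ ⟨θ, -, rfl⟩; exact h.rot_mem θ hz) hK
  set F : (Fin n → ℤ) → UnitAddTorus (Fin n) → ℂ := fun β θ =>
    UnitAddTorus.mFourier (-α) θ * (UnitAddTorus.mFourier β θ * (c β * laurentMonomial β z))
  have hF : ∀ β, Continuous (F β) := fun β => by fun_prop
  have hFn : ∀ β θ, ‖F β θ‖ = ‖c β * laurentMonomial β z‖ := fun β θ => by
    simp only [F, norm_mul, norm_mFourier_apply, one_mul]
  have hmz : ∀ β, ‖c β * laurentMonomial β z‖ ≤ m β := fun β =>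
    hmb β z ⟨0, trivial, rot_zero z⟩
  have hint := hasSum_integral_of_summable_integral_norm (μ := torusMeasure n) (F := F)
    (fun β => (hF β).integrable_torus) (by
      simp_rw [hFn, integral_const]
      simpa using Summable.of_nonneg_of_le (fun _ => by positivity) hmz hm)
  have horth : ∀ β, ∫ θ, F β θ ∂torusMeasure n =
      if β = α then c α * laurentMonomial α z else 0 := by
    intro β
    have e : ∀ θ, F β θ = c β * laurentMonomial β z * UnitAddTorus.mFourier (-α + β) θ := by
      intro θ
      rw [UnitAddTorus.mFourier_add]; simp only [F]; ring
    simp_rw [e]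
    rw [integral_const_mul, integral_mFourier]
    by_cases hβ : β = α
    · rw [hβ]; simp
    · rw [if_neg hβ, if_neg (by rw [neg_add_eq_sub]; exact sub_ne_zero.2 hβ), mul_zero]
  have htsum : ∀ θ, ∑' β, F β θ = UnitAddTorus.mFourier (-α) θ * g (rot θ z) := by
    intro θ
    have h1 := (hgc.hasSum (rot θ z) (h.rot_mem θ hz)).mul_left (UnitAddTorus.mFourier (-α) θ)
    rw [← h1.tsum_eq]
    refine tsum_congr fun β => ?_
    simp only [F, laurentMonomial_rot]; ring
  simp_rw [horth, htsum] at hint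
  have h2 := hasSum_ite_eq α (c α * laurentMonomial α z)
  exact hint.unique h2

end Laurent

/-! ### Allowable indices -/

section Allowable
variable {n : ℕ} {U : Set (Fin n → ℂ)} {A : Matrix (Fin n) (Fin n) ℤ} {M : Matrix (Fin n) (Fin n) ℝ}

theorem measurable_laurentMonomial (α : Fin n → ℤ) : Measurable (laurentMonomial α) := by
  unfold laurentMonomial
  refine Finset.measurable_fun_prod _ fun k _ => ?_
  have h1 : Measurable fun x : ℂ => x ^ α k := by
    cases hk : α k with
    | ofNat m => simpa using (measurable_id (α := ℂ)).pow_const m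
    | negSucc m => simpa only [zpow_negSucc, id] using ((measurable_id (α := ℂ)).pow_const (m + 1)).fun_inv
  exact h1.comp (measurable_pi_apply k)

theorem angularCoeff_laurentMonomial (α : Fin n → ℤ) (z : Fin n → ℂ) :
    angularCoeff (laurentMonomial α) α z = laurentMonomial α z := by
  have : ∀ θ : UnitAddTorus (Fin n), UnitAddTorus.mFourier (-α) θ * laurentMonomial α (rot θ z) =
      laurentMonomial α z := fun θ => by
    rw [laurentMonomial_rot, ← mul_assoc, ← UnitAddTorus.mFourier_add, neg_add_cancel,
      UnitAddTorus.mFourier_zero]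
    simp
  simp [angularCoeff, this]

theorem lintegral_exp_neg_mul_ne_top_iff (c : ℝ) :
    ∫⁻ s in Set.Ioi (0 : ℝ), ENNReal.ofReal (Real.exp (-(c * s))) ≠ ⊤ ↔ 0 < c := by
  constructor
  · intro h
    by_contra! hc
    refine h (top_le_iff.1 ?_)
    calc (⊤ : ℝ≥0∞) = ∫⁻ s in Set.Ioi (0 : ℝ), 1 := by simp
      _ ≤ _ := by
        refine setLIntegral_mono' measurableSet_Ioi fun s hs => ?_
        rw [← ENNReal.ofReal_one]
        refine ENNReal.ofReal_le_ofReal (Real.one_le_exp ?_)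
        nlinarith [Set.mem_Ioi.1 hs]
  · intro hc
    have h1 := (exp_neg_integrableOn_Ioi 0 hc).lintegral_lt_top.ne
    simpa only [neg_mul] using h1

namespace HasLogCoordinates

/-- The `L^p` norms of monomials are products of integrals of exponentials. -/
theorem exists_lintegral_laurentMonomial_rpow (h : HasLogCoordinates U A M) : ∃ K : ℝ, 0 < K ∧
    ∀ {P : ℝ}, 0 < P → ∀ α : Fin n → ℤ, ∫⁻ z in U, ‖laurentMonomial α z‖ₑ ^ P = ENNReal.ofReal K *
      ∏ j, ∫⁻ s in Set.Ioi (0 : ℝ), ENNReal.ofReal (Real.exp (-((P *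
        (∑ k, A k j * α k : ℤ) + 2 * (∑ k, A k j : ℤ)) * s))) := by
  obtain ⟨K, hK, hint⟩ := h.exists_lintegral_prod
  refine ⟨K, hK, fun {P} hP α => ?_⟩
  have h1 := hint (fun j s => ENNReal.ofReal (Real.exp (-(P *
      (∑ k, A k j * α k : ℤ) * s)))) fun j => by fun_prop
  have h2 : ∀ j, ∀ s : ℝ, ENNReal.ofReal (Real.exp (-(2 * (∑ k, A k j : ℤ) * s))) *
      ENNReal.ofReal (Real.exp (-(P * (∑ k, A k j * α k : ℤ) * s))) =
      ENNReal.ofReal (Real.exp (-((P *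
      (∑ k, A k j * α k : ℤ) + 2 * (∑ k, A k j : ℤ)) * s))) := fun j s => by
    rw [← ENNReal.ofReal_mul (Real.exp_nonneg _), ← Real.exp_add]
    congr 2; ring
  simp only [h2] at h1
  rw [← h1]
  refine lintegral_congr_ae ?_
  filter_upwards [ae_restrict_of_ae (ae_forall_ne_zero n)] with z hz
  rw [← ofReal_norm, h.norm_laurentMonomial_eq α hz,
    ENNReal.ofReal_rpow_of_nonneg (Finset.prod_nonneg fun _ _ => Real.exp_nonneg _) hP.le,
    ← ENNReal.ofReal_prod_of_nonneg fun _ _ => Real.exp_nonneg _,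
    ← Real.finsetProd_rpow _ _ fun _ _ => Real.exp_nonneg _]
  congr 1
  refine Finset.prod_congr rfl fun j _ => ?_
  rw [← Real.exp_mul]
  congr 1; ring

theorem memLp_laurentMonomial_iff (h : HasLogCoordinates U A M) {p : ℝ≥0∞} (hp0 : p ≠ 0)
    (hp : p ≠ ⊤) (α : Fin n → ℤ) : MemLp (laurentMonomial α) p (volume.restrict U) ↔
      ∀ j, 0 < p.toReal * (∑ k, A k j * α k : ℤ) + 2 * (∑ k, A k j : ℤ) := by
  have hP : 0 < p.toReal := ENNReal.toReal_pos hp0 hp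
  obtain ⟨K, hK, hint⟩ := h.exists_lintegral_laurentMonomial_rpow
  have hkey := hint hP α
  have hpos : ∀ c : ℝ, ∫⁻ s in Set.Ioi (0 : ℝ), ENNReal.ofReal (Real.exp (-(c * s))) ≠ 0 := by
    intro c hc
    rw [lintegral_eq_zero_iff (by fun_prop)] at hc
    have : (volume.restrict (Set.Ioi (0 : ℝ))) Set.univ = 0 := by
      refine measure_mono_null (fun x _ => ?_) hc
      simpa using Real.exp_pos _
    simp at this
  have hmem : MemLp (laurentMonomial α) p (volume.restrict U) ↔
      ∫⁻ z in U, ‖laurentMonomial α z‖ₑ ^ p.toReal < ⊤ := by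
    rw [← eLpNorm_lt_top_iff_lintegral_rpow_enorm_lt_top hp0 hp]
    exact ⟨fun h => h.2, fun h => ⟨(measurable_laurentMonomial α).aestronglyMeasurable, h⟩⟩
  rw [hmem, hkey]
  constructor
  · intro hlt j
    rw [← lintegral_exp_neg_mul_ne_top_iff]
    intro htop
    have h5 : ∏ j, ∫⁻ s in Set.Ioi (0 : ℝ), ENNReal.ofReal (Real.exp (-((p.toReal *
        (∑ k, A k j * α k : ℤ) + 2 * (∑ k, A k j : ℤ)) * s))) = ⊤ :=
      WithTop.prod_eq_top (Finset.mem_univ j) htop fun i _ => hpos _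
    rw [h5] at hlt
    exact hlt.ne (ENNReal.mul_top (ENNReal.ofReal_pos.2 hK).ne')
  · intro hj
    exact ENNReal.mul_lt_top ENNReal.ofReal_lt_top
      (WithTop.prod_lt_top fun j _ => ((lintegral_exp_neg_mul_ne_top_iff _).2 (hj j)).lt_top)

/-- The allowable indices are given by sign conditions and by strict linear inequalities. This is why
partial sums over them are products of half-line multipliers. -/
theorem mem_allowableIndices_iff (h : HasLogCoordinates U A M) {p : ℝ≥0∞} (hp0 : p ≠ 0)
    (hp : p ≠ ⊤) (α : Fin n → ℤ) : α ∈ allowableIndices U p ↔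
      (∀ k, ∀ z ∈ U, z k = 0 → 0 ≤ α k) ∧
        ∀ j, 0 < p.toReal * (∑ k, A k j * α k : ℤ) + 2 * (∑ k, A k j : ℤ) := by
  rw [← h.memLp_laurentMonomial_iff hp0 hp]
  refine ⟨fun hα => ⟨fun k z hz hzk => ?_, hα.2⟩, fun hα => ⟨differentiableOn_laurentMonomial hα.1,
    hα.2⟩⟩
  exact h.nonneg_of_coeff_ne_zero hα.1.continuousOn one_ne_zero
    (fun z _ _ => by rw [angularCoeff_laurentMonomial, one_mul]) hz hzk

theorem measurePreserving_rot_prod (h : HasLogCoordinates U A M) :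
    MeasurePreserving (fun x : UnitAddTorus (Fin n) × (Fin n → ℂ) => rot x.1 x.2)
      ((torusMeasure n).prod (volume.restrict U)) (volume.restrict U) := by
  have h1 := (MeasurePreserving.id (torusMeasure n)).skew_product (μc := volume.restrict U)
    (μd := volume.restrict U) (g := rot) continuous_rot.measurable
    (Eventually.of_forall fun θ => (h.measurePreserving_rot θ).map_eq)
  exact measurePreserving_snd.comp h1

theorem lintegral_rot (h : HasLogCoordinates U A M) {F : (Fin n → ℂ) → ℝ≥0∞}
    (hF : AEMeasurable F (volume.restrict U)) :
    ∫⁻ z in U, ∫⁻ θ, F (rot θ z) ∂torusMeasure n = ∫⁻ z in U, F z := by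
  have h1 := h.measurePreserving_rot_prod
  rw [← lintegral_prod_symm (fun x : UnitAddTorus (Fin n) × (Fin n → ℂ) => F (rot x.1 x.2))
    (hF.comp_quasiMeasurePreserving h1.quasiMeasurePreserving)]
  conv_rhs => rw [← h1.map_eq]
  rw [lintegral_map' (by rwa [h1.map_eq]) h1.measurable.aemeasurable]

theorem integral_rot (h : HasLogCoordinates U A M) {G : (Fin n → ℂ) → ℂ}
    (hG : IntegrableOn G U) :
    ∫ z in U, ∫ θ, G (rot θ z) ∂torusMeasure n = ∫ z in U, G z := by
  have h1 := h.measurePreserving_rot_prod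
  have h2 : Integrable (fun x : UnitAddTorus (Fin n) × (Fin n → ℂ) => G (rot x.1 x.2))
    ((torusMeasure n).prod (volume.restrict U)) := h1.integrable_comp_of_integrable hG
  rw [← integral_prod_symm _ h2]
  conv_rhs => rw [← h1.map_eq]
  rw [integral_map h1.measurable.aemeasurable (by rw [h1.map_eq]; exact hG.aestronglyMeasurable)]

theorem integrable_integral_rot (h : HasLogCoordinates U A M) {G : (Fin n → ℂ) → ℂ}
    (hG : IntegrableOn G U) :
    IntegrableOn (fun z => ∫ θ, G (rot θ z) ∂torusMeasure n) U :=
  (h.measurePreserving_rot_prod.integrable_comp_of_integrable hG).integral_prod_right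

/-- Averaging over the torus contracts the `L^p` norm, by Jensen. -/
theorem eLpNorm_angularCoeff_le (h : HasLogCoordinates U A M) {p : ℝ≥0∞}
    (h1 : 1 ≤ p) (hp : p ≠ ⊤) {g : (Fin n → ℂ) → ℂ} (hg : ContinuousOn g U) (α : Fin n → ℤ) :
    eLpNorm (angularCoeff g α) p (volume.restrict U) ≤ eLpNorm g p (volume.restrict U) := by
  have hp0 : p ≠ 0 := (zero_lt_one.trans_le h1).ne'
  have hP : 0 < p.toReal := ENNReal.toReal_pos hp0 hp
  refine (ENNReal.rpow_le_rpow_iff hP).1 ?_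
  rw [eLpNorm_eq_lintegral_rpow_enorm_toReal hp0 hp, eLpNorm_eq_lintegral_rpow_enorm_toReal hp0 hp,
    ← ENNReal.rpow_mul, ← ENNReal.rpow_mul, one_div, inv_mul_cancel₀ hP.ne', ENNReal.rpow_one,
    ENNReal.rpow_one, ← h.lintegral_rot (F := fun z => ‖g z‖ₑ ^ p.toReal)
      ((hg.aestronglyMeasurable h.isOpen.measurableSet).enorm.pow_const _)]
  refine setLIntegral_mono' h.isOpen.measurableSet fun z hz => ?_
  have hc := h.continuous_comp_rot hg hz
  have h2 : ‖angularCoeff g α z‖ₑ ≤ ∫⁻ θ, ‖g (rot θ z)‖ₑ ∂torusMeasure n := by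
    refine (enorm_integral_le_lintegral_enorm _).trans (le_of_eq (lintegral_congr fun θ => ?_))
    rw [enorm_mul, ← ofReal_norm, norm_mFourier_apply, ENNReal.ofReal_one, one_mul]
  have h3 := eLpNorm_le_eLpNorm_of_exponent_le (μ := torusMeasure n) h1 hc.aestronglyMeasurable
  rw [eLpNorm_one_eq_lintegral_enorm] at h3
  calc _ ≤ (eLpNorm (fun θ => g (rot θ z)) p (torusMeasure n)) ^ p.toReal :=
        ENNReal.rpow_le_rpow (h2.trans h3) hP.le
    _ = _ := by
      rw [eLpNorm_eq_lintegral_rpow_enorm_toReal hp0 hp, ← ENNReal.rpow_mul, one_div,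
        inv_mul_cancel₀ hP.ne', ENNReal.rpow_one]

/-- The index of a nonzero Laurent coefficient of a function in `A^p(U)` is `p`-allowable. -/
theorem mem_allowableIndices_of_coeff_ne_zero (h : HasLogCoordinates U A M) {p : ℝ≥0∞}
    (h1 : 1 ≤ p) (hp : p ≠ ⊤) {g : (Fin n → ℂ) → ℂ} (hg : ContinuousOn g U)
    (hgp : MemLp g p (volume.restrict U)) {c : (Fin n → ℤ) → ℂ} (hc : HasAngularCoeff U g c)
    {α : Fin n → ℤ} (hα : c α ≠ 0) : α ∈ allowableIndices U p := by
  refine ⟨differentiableOn_laurentMonomial (hc.nonneg α hα),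
    (measurable_laurentMonomial α).aestronglyMeasurable, ?_⟩
  have h2 : eLpNorm (laurentMonomial α) p (volume.restrict U) =
      eLpNorm ((c α)⁻¹ • angularCoeff g α) p (volume.restrict U) := by
    refine eLpNorm_congr_ae ((ae_restrict_mem h.isOpen.measurableSet).mono fun z hz => ?_)
    simp only [Pi.smul_apply, smul_eq_mul]
    rw [hc.eq α z hz, inv_mul_cancel_left₀ hα]
  rw [h2, eLpNorm_const_smul]
  exact ENNReal.mul_lt_top enorm_lt_top
    ((h.eLpNorm_angularCoeff_le h1 hp hg α).trans_lt hgp.2)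

end HasLogCoordinates
end Allowable

/-! ### Norming functionals in `L^p` -/

section Norming
variable {X : Type*} [MeasurableSpace X] {μ : Measure X} {p : ℝ≥0∞} [Fact (1 ≤ p)]

theorem Lp_norm_rpow_eq_integral (hp : p ≠ ⊤) (f : Lp ℂ p μ) :
    ‖f‖ ^ p.toReal = ∫ x, ‖f x‖ ^ p.toReal ∂μ := by
  have h0 : p ≠ 0 := (zero_lt_one.trans_le (Fact.out : 1 ≤ p)).ne'
  have hP : 0 < p.toReal := ENNReal.toReal_pos h0 hp
  rw [Lp.norm_def, MemLp.eLpNorm_eq_integral_rpow_norm h0 hp (Lp.memLp f),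
    ENNReal.toReal_ofReal (by positivity),
    ← Real.rpow_mul (by positivity), inv_mul_cancel₀ hP.ne', Real.rpow_one]

/-- The norm of `L^p`, `1 < p < ∞`, is differentiable along lines through a nonzero point. -/
theorem differentiableAt_norm_add_smul (h1 : 1 < p) (hp : p ≠ ⊤) {e : Lp ℂ p μ} (he : e ≠ 0)
    (f : Lp ℂ p μ) : DifferentiableAt ℝ (fun t : ℝ => ‖e + (t : ℂ) • f‖) 0 := by
  have hp0 : p ≠ 0 := (zero_lt_one.trans h1).ne'
  have hP : 1 < p.toReal := by
    rw [← ENNReal.toReal_one]; exact (ENNReal.toReal_lt_toReal ENNReal.one_ne_top hp).2 h1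
  set P := p.toReal
  have hint : ∀ t : ℝ, ‖e + (t : ℂ) • f‖ ^ P = ∫ x, ‖e x + t * f x‖ ^ P ∂μ := fun t => by
    rw [Lp_norm_rpow_eq_integral hp]
    refine integral_congr_ae ?_
    filter_upwards [Lp.coeFn_add e ((t : ℂ) • f), Lp.coeFn_smul (t : ℂ) f] with x h1 h2
    rw [h1, Pi.add_apply, h2, Pi.smul_apply, smul_eq_mul]
  have hsum : MemLp (fun x => ‖e x‖ + ‖f x‖) p μ := (Lp.memLp e).norm.add (Lp.memLp f).norm
  have hbd : Integrable (fun x => P * (‖e x‖ + ‖f x‖) ^ P) μ := by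
    refine (((hsum.integrable_norm_rpow hp0 hp)).congr (Eventually.of_forall fun x => ?_)).const_mul P
    simp only
    rw [Real.norm_of_nonneg (by positivity)]
  have hd : ∀ x, ∀ t : ℝ, HasDerivAt (fun t : ℝ => ‖e x + t * f x‖ ^ P)
      (P * ‖e x + t * f x‖ ^ (P - 2) * inner ℝ (e x + t * f x) (f x)) t := fun x t => by
    have h2 : HasDerivAt (fun t : ℝ => e x + t * f x) (f x) t := by
      simpa using ((hasDerivAt_id t).ofReal_comp.mul_const (f x)).const_add (e x)
    exact (hasFDerivAt_norm_rpow (e x + t * f x) hP).comp_hasDerivAt t h2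
  have hφ : HasDerivAt (fun t : ℝ => ∫ x, ‖e x + t * f x‖ ^ P ∂μ)
      (∫ x, P * ‖e x + (0 : ℝ) * f x‖ ^ (P - 2) * inner ℝ (e x + (0 : ℝ) * f x) (f x) ∂μ) 0 := by
    have he := (Lp.aestronglyMeasurable e)
    have hf := (Lp.aestronglyMeasurable f)
    refine (hasDerivAt_integral_of_dominated_loc_of_deriv_le (μ := μ)
      (F' := fun t x => P * ‖e x + (t : ℝ) * f x‖ ^ (P - 2) * inner ℝ (e x + (t : ℝ) * f x) (f x))
      (Metric.ball_mem_nhds (0 : ℝ) one_pos) (Eventually.of_forall fun t => ?_) ?_ ?_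
      (Eventually.of_forall fun x t ht => ?_) hbd (Eventually.of_forall fun x t _ => hd x t)).2
    · exact ((he.add (hf.const_mul _)).norm.aemeasurable.pow_const _).aestronglyMeasurable
    · simpa using (Lp.memLp e).integrable_norm_rpow hp0 hp
    · refine AEStronglyMeasurable.mul ?_ ((he.add (hf.const_mul _)).inner hf)
      exact ((he.add (hf.const_mul _)).norm.aemeasurable.pow_const _).aestronglyMeasurable.const_mul P
    · rw [mem_ball_zero_iff, Real.norm_eq_abs] at ht
      have h3 : ‖e x + (t : ℂ) * f x‖ ≤ ‖e x‖ + ‖f x‖ := by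
        refine (norm_add_le _ _).trans ?_
        rw [norm_mul, Complex.norm_real, Real.norm_eq_abs]
        nlinarith [norm_nonneg (f x)]
      rw [norm_mul, norm_mul, Real.norm_of_nonneg (by positivity),
        Real.norm_of_nonneg (by positivity), mul_assoc]
      refine mul_le_mul_of_nonneg_left ?_ (by positivity)
      calc ‖e x + (t : ℂ) * f x‖ ^ (P - 2) * ‖inner ℝ (e x + t * f x) (f x)‖
          ≤ ‖e x + (t : ℂ) * f x‖ ^ (P - 2) * (‖e x + (t : ℂ) * f x‖ * ‖f x‖) := by
            gcongr; exact norm_inner_le_norm _ _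
        _ = ‖e x + (t : ℂ) * f x‖ ^ (P - 1) * ‖f x‖ := by
            rw [← mul_assoc]
            rcases (norm_nonneg (e x + (t : ℂ) * f x)).eq_or_lt with h0 | h0
            · rw [← h0, mul_zero, Real.zero_rpow (by linarith)]
            · rw [← Real.rpow_add_one h0.ne']; ring_nf
        _ ≤ (‖e x‖ + ‖f x‖) ^ (P - 1) * (‖e x‖ + ‖f x‖) := by
            gcongr
            exact le_add_of_nonneg_left (norm_nonneg (e x))
        _ = (‖e x‖ + ‖f x‖) ^ P := by
            rcases (add_nonneg (norm_nonneg (e x)) (norm_nonneg (f x))).eq_or_lt with h0 | h0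
            · rw [← h0, mul_zero, Real.zero_rpow (by linarith)]
            · rw [← Real.rpow_add_one h0.ne']; ring_nf
  have hne : (∫ x, ‖e x + (0 : ℝ) * f x‖ ^ P ∂μ) ≠ 0 := by
    rw [← hint 0]
    have : 0 < ‖e‖ := norm_pos_iff.2 he
    simpa using (Real.rpow_pos_of_pos this P).ne'
  have h4 := (hφ.differentiableAt.rpow_const (p := P⁻¹) (Or.inl hne))
  refine h4.congr_of_eventuallyEq (Eventually.of_forall fun t => ?_)
  simp only
  rw [← hint t, ← Real.rpow_mul (norm_nonneg _), mul_inv_cancel₀ (by linarith), Real.rpow_one]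

/-- In `L^p`, `1 < p < ∞`, a nonzero element has only one norming functional. -/
theorem eq_of_norming (h1 : 1 < p) (hp : p ≠ ⊤) {e : Lp ℂ p μ} (he : e ≠ 0)
    {b₁ b₂ : Lp ℂ p μ →L[ℂ] ℂ} (hb₁ : b₁ e = 1) (hb₂ : b₂ e = 1) (hn₁ : ‖b₁‖ ≤ ‖e‖⁻¹)
    (hn₂ : ‖b₂‖ ≤ ‖e‖⁻¹) : b₁ = b₂ := by
  have he' : 0 < ‖e‖ := norm_pos_iff.2 he
  have key : ∀ b : Lp ℂ p μ →L[ℂ] ℂ, b e = 1 → ‖b‖ ≤ ‖e‖⁻¹ → ∀ f,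
      ‖e‖ * (b f).re = deriv (fun t : ℝ => ‖e + (t : ℂ) • f‖) 0 := by
    intro b hb hn f
    have hd := (differentiableAt_norm_add_smul h1 hp he f).hasDerivAt
    have hl : HasDerivAt (fun t : ℝ => ‖e‖ * (1 + t * (b f).re)) (‖e‖ * (b f).re) 0 := by
      simpa using (((hasDerivAt_id (0 : ℝ)).mul_const (b f).re).const_add 1).const_mul ‖e‖
    -- `‖e + t f‖ ≥ ‖e‖ Re b (e + t f)` with equality at `t = 0`, so the derivatives agree there
    have hmin : IsLocalMin (fun t : ℝ => ‖e + (t : ℂ) • f‖ - ‖e‖ * (1 + t * (b f).re)) 0 := by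
      refine Eventually.of_forall fun t => ?_
      simp only [Complex.ofReal_zero, zero_smul, add_zero, zero_mul, mul_one, sub_self, sub_nonneg]
      have h2 : (b (e + (t : ℂ) • f)).re ≤ ‖e‖⁻¹ * ‖e + (t : ℂ) • f‖ :=
        (Complex.re_le_norm _).trans ((b.le_opNorm _).trans (by gcongr))
      rw [map_add, map_smul, hb] at h2
      simp only [Complex.add_re, Complex.one_re, smul_eq_mul, Complex.re_ofReal_mul] at h2
      calc ‖e‖ * (1 + t * (b f).re) ≤ ‖e‖ * (‖e‖⁻¹ * ‖e + (t : ℂ) • f‖) := by gcongr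
        _ = _ := by rw [mul_inv_cancel_left₀ he'.ne']
    have := hmin.hasDerivAt_eq_zero (hd.sub hl)
    linarith
  have hre : ∀ f, (b₁ f).re = (b₂ f).re := fun f =>
    mul_left_cancel₀ he'.ne' ((key b₁ hb₁ hn₁ f).trans (key b₂ hb₂ hn₂ f).symm)
  ext f
  refine Complex.ext (hre f) ?_
  have := hre (Complex.I • f)
  simpa using this

/-- The norming functional of `e`, up to normalization: the pairing with `conj e |e|^(p-2)`, which
lies in the dual `L^q`. -/
theorem exists_norming (h1 : 1 < p) (hp : p ≠ ⊤) (e : Lp ℂ p μ) : ∃ b : Lp ℂ p μ →L[ℂ] ℂ,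
    (∀ f, b f = ∫ x, f x * (starRingEnd ℂ (e x) * (‖e x‖ ^ (p.toReal - 2) : ℝ)) ∂μ) ∧
    (∀ f : Lp ℂ p μ,
      Integrable (fun x => f x * (starRingEnd ℂ (e x) * (‖e x‖ ^ (p.toReal - 2) : ℝ))) μ) ∧
    ‖b‖ ≤ ‖e‖ ^ (p.toReal - 1) := by
  have hP : 1 < p.toReal := by
    rw [← ENNReal.toReal_one]; exact (ENNReal.toReal_lt_toReal ENNReal.one_ne_top hp).2 h1
  set P := p.toReal with hPdef
  have hpP : p = ENNReal.ofReal P := (ENNReal.ofReal_toReal hp).symm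
  have hconj := Real.HolderConjugate.conjExponent hP
  set Q := P.conjExponent
  have : ENNReal.HolderConjugate p (ENNReal.ofReal Q) := by
    rw [hpP]; exact hconj.ennrealOfReal
  have : Fact (1 ≤ ENNReal.ofReal Q) := ⟨by
    rw [← ENNReal.ofReal_one]; exact ENNReal.ofReal_le_ofReal hconj.symm.lt.le⟩
  -- where `e` vanishes the factor `conj e` is zero, whatever the value of `0 ^ (P - 2)`
  set w : X → ℂ := fun x => starRingEnd ℂ (e x) * (‖e x‖ ^ (P - 2) : ℝ)
  have he := Lp.aestronglyMeasurable e
  have hwm : AEStronglyMeasurable w μ := by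
    refine AEStronglyMeasurable.mul (continuous_star.comp_aestronglyMeasurable he) ?_
    exact Complex.continuous_ofReal.comp_aestronglyMeasurable
      (he.norm.aemeasurable.pow_const _).aestronglyMeasurable
  have hwn : ∀ x, ‖w x‖ = ‖e x‖ ^ (P - 1) := fun x => by
    simp only [w, norm_mul, RCLike.norm_conj, Complex.norm_real]
    rw [Real.norm_of_nonneg (by positivity)]
    rcases (norm_nonneg (e x)).eq_or_lt with h0 | h0
    · rw [← h0, zero_mul, Real.zero_rpow (by linarith)]
    · rw [mul_comm, ← Real.rpow_add_one h0.ne']; ring_nf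
  have hwl : eLpNorm w (ENNReal.ofReal Q) μ = eLpNorm e p μ ^ (P - 1) := by
    rw [← eLpNorm_norm]
    simp only [hwn]
    rw [eLpNorm_norm_rpow _ (by linarith), ← ENNReal.ofReal_mul (by linarith [hconj.symm.lt]),
      mul_comm, hconj.sub_one_mul_conj, ← hpP]
  have hw : MemLp w (ENNReal.ofReal Q) μ := ⟨hwm, by
    rw [hwl]; exact ENNReal.rpow_lt_top_of_nonneg (by linarith) (Lp.memLp e).2.ne⟩
  refine ⟨((ContinuousLinearMap.mul ℂ ℂ).lpPairing μ p (ENNReal.ofReal Q)).flip (hw.toLp w),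
    fun f => ?_, fun f => ?_, ContinuousLinearMap.opNorm_le_bound _ (by positivity) fun f => ?_⟩
  · rw [ContinuousLinearMap.flip_apply, ContinuousLinearMap.lpPairing_eq_integral]
    refine integral_congr_ae ?_
    filter_upwards [hw.coeFn_toLp] with x hx
    rw [hx, ContinuousLinearMap.mul_apply']
  · refine (L1.integrable_coeFn ((ContinuousLinearMap.mul ℂ ℂ).holder 1 f (hw.toLp w))).congr ?_
    filter_upwards [(ContinuousLinearMap.mul ℂ ℂ).coeFn_holder (r := 1) f (hw.toLp w),
      hw.coeFn_toLp] with x h1 h2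
    rw [h1, h2, ContinuousLinearMap.mul_apply']
  · have hnw : ‖hw.toLp w‖ = ‖e‖ ^ (P - 1) := by
      rw [Lp.norm_toLp, hwl, Lp.norm_def, ENNReal.toReal_rpow]
    rw [ContinuousLinearMap.flip_apply, ContinuousLinearMap.lpPairing_eq_integral, ← hnw,
      ← integral_congr_ae ((ContinuousLinearMap.mul ℂ ℂ).coeFn_holder (r := 1) f (hw.toLp w))]
    refine (norm_integral_le_integral_norm _).trans ?_
    rw [← L1.norm_eq_integral_norm]
    refine ((ContinuousLinearMap.mul ℂ ℂ).norm_holder_apply_apply_le f (hw.toLp w)).trans ?_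
    rw [mul_comm ‖hw.toLp w‖]
    gcongr
    exact mul_le_of_le_one_left (norm_nonneg _) (ContinuousLinearMap.opNorm_mul_le ℂ ℂ)

end Norming

/-! ### Coefficient functionals -/

section Coefficient
variable {n : ℕ} {U : Set (Fin n → ℂ)} {A : Matrix (Fin n) (Fin n) ℤ} {M : Matrix (Fin n) (Fin n) ℝ}
  {p : ℝ≥0∞} [Fact (1 ≤ p)]

namespace HasLogCoordinates

theorem bergmanMonomial_ne_zero (h : HasLogCoordinates U A M) (α : allowableIndices U p) :
    (bergmanMonomial U p α : Lp ℂ p (volume.restrict U)) ≠ 0 := by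
  intro h0
  have h1 : laurentMonomial α.1 =ᵐ[volume.restrict U] 0 :=
    (MemLp.coeFn_toLp α.2.2).symm.trans (by
      have : α.2.2.toLp (laurentMonomial α.1) = 0 := h0
      rw [this]; exact Lp.coeFn_zero ℂ p _)
  have h2 : ∀ᵐ z ∂volume.restrict U, False := by
    filter_upwards [h1, ae_restrict_of_ae (ae_forall_ne_zero n)] with z hz hz0
    exact laurentMonomial_ne_zero α.1 hz0 hz
  have h3 : volume.restrict U = 0 := by simpa [ae_iff] using h2
  rw [Measure.restrict_eq_zero] at h3
  exact (h.isOpen.measure_pos volume h.nonempty).ne' h3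

/-- In an integral against the norming density of `e_α`, a function may be replaced by its angular
coefficient. -/
theorem integral_mul_conj_laurentMonomial_eq (h : HasLogCoordinates U A M) {P : ℝ}
    {α : Fin n → ℤ} {q a : (Fin n → ℂ) → ℂ} (ha : ∀ z ∈ U, angularCoeff q α z = a z)
    (hint : IntegrableOn (fun z => q z * (starRingEnd ℂ (laurentMonomial α z) *
      (‖laurentMonomial α z‖ ^ (P - 2) : ℝ))) U) :
    IntegrableOn (fun z => a z * (starRingEnd ℂ (laurentMonomial α z) *
      (‖laurentMonomial α z‖ ^ (P - 2) : ℝ))) U ∧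
    ∫ z in U, q z * (starRingEnd ℂ (laurentMonomial α z) *
      (‖laurentMonomial α z‖ ^ (P - 2) : ℝ)) = ∫ z in U, a z *
        (starRingEnd ℂ (laurentMonomial α z) * (‖laurentMonomial α z‖ ^ (P - 2) : ℝ)) := by
  have key : ∀ z ∈ U, ∫ θ, q (rot θ z) * (starRingEnd ℂ (laurentMonomial α (rot θ z)) *
      (‖laurentMonomial α (rot θ z)‖ ^ (P - 2) : ℝ)) ∂torusMeasure n =
      a z * (starRingEnd ℂ (laurentMonomial α z) * (‖laurentMonomial α z‖ ^ (P - 2) : ℝ)) := by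
    intro z hz
    have h1 : ∀ θ, q (rot θ z) * (starRingEnd ℂ (laurentMonomial α (rot θ z)) *
        (‖laurentMonomial α (rot θ z)‖ ^ (P - 2) : ℝ)) =
        (starRingEnd ℂ (laurentMonomial α z) * (‖laurentMonomial α z‖ ^ (P - 2) : ℝ)) *
          (UnitAddTorus.mFourier (-α) θ * q (rot θ z)) := fun θ => by
      rw [laurentMonomial_rot, norm_mul, norm_mFourier_apply, one_mul, map_mul,
        UnitAddTorus.mFourier_neg]
      ring
    simp only [h1]
    rw [integral_const_mul, ← ha z hz, mul_comm]
    rfl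
  rw [← h.integral_rot hint]
  exact ⟨(h.integrable_integral_rot hint).congr_fun key h.isOpen.measurableSet,
    setIntegral_congr_fun h.isOpen.measurableSet key⟩

/-- The pairing with the norming density of `e_α` extracts the coefficient of index `α`. -/
theorem integral_mul_conj_laurentMonomial (h : HasLogCoordinates U A M) {P : ℝ} (hP : 1 < P)
    {α : Fin n → ℤ} {g : (Fin n → ℂ) → ℂ} {c : ℂ}
    (hc : ∀ z ∈ U, angularCoeff g α z = c * laurentMonomial α z)
    (hint : IntegrableOn (fun z => g z * (starRingEnd ℂ (laurentMonomial α z) *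
      (‖laurentMonomial α z‖ ^ (P - 2) : ℝ))) U) :
    ∫ z in U, g z * (starRingEnd ℂ (laurentMonomial α z) *
      (‖laurentMonomial α z‖ ^ (P - 2) : ℝ)) =
      c * (∫ z in U, ‖laurentMonomial α z‖ ^ P : ℝ) := by
  rw [(h.integral_mul_conj_laurentMonomial_eq hc hint).2, ← integral_complex_ofReal,
    ← integral_const_mul]
  refine integral_congr_ae (Eventually.of_forall fun z => ?_)
  have h2 : starRingEnd ℂ (laurentMonomial α z) * laurentMonomial α z =
      ((‖laurentMonomial α z‖ ^ 2 : ℝ) : ℂ) := by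
    rw [mul_comm, Complex.mul_conj, Complex.normSq_eq_norm_sq]
  have h3 : ‖laurentMonomial α z‖ ^ 2 * ‖laurentMonomial α z‖ ^ (P - 2) =
      ‖laurentMonomial α z‖ ^ P := by
    rcases (norm_nonneg (laurentMonomial α z)).eq_or_lt with h0 | h0
    · rw [← h0, Real.zero_rpow (by linarith : P ≠ 0)]; simp
    · rw [← Real.rpow_natCast, ← Real.rpow_add h0]; norm_num
  simp only
  rw [← h3, Complex.ofReal_mul, ← h2]
  ring

/-- The Laurent coefficient functionals extend to `L^p(U)` with the same norm, in a unique way, and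
the extension is given by an integral. -/
theorem exists_coeffFunctional (h : HasLogCoordinates U A M) (h1 : 1 < p) (hp : p ≠ ⊤)
    (α : allowableIndices U p) : ∃ b : Lp ℂ p (volume.restrict U) →L[ℂ] ℂ,
      (∀ f, b f = ((‖bergmanMonomial U p α‖ ^ p.toReal)⁻¹ : ℝ) *
        ∫ z in U, f z * (starRingEnd ℂ (laurentMonomial α z) *
          (‖laurentMonomial α.1 z‖ ^ (p.toReal - 2) : ℝ))) ∧
      (∀ (f : bergmanSpace U p) (g : (Fin n → ℂ) → ℂ) (c : ℂ),
        (f : Lp ℂ p (volume.restrict U)) =ᵐ[volume.restrict U] g →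
        (∀ z ∈ U, angularCoeff g α z = c * laurentMonomial α z) → b f = c) ∧
      ∀ b', (∃ a : bergmanSpace U p →L[ℂ] ℂ, IsLaurentCoeffFunctional U p α a ∧
        IsHahnBanachExtension a b') ↔ b' = b := by
  have hP : 1 < p.toReal := by
    rw [← ENNReal.toReal_one]; exact (ENNReal.toReal_lt_toReal ENNReal.one_ne_top hp).2 h1
  set E : Lp ℂ p (volume.restrict U) := (bergmanMonomial U p α : Lp ℂ p (volume.restrict U)) with hE
  have hE0 : E ≠ 0 := h.bergmanMonomial_ne_zero α
  have hEn : 0 < ‖E‖ := norm_pos_iff.2 hE0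
  have hEP : 0 < ‖E‖ ^ p.toReal := Real.rpow_pos_of_pos hEn _
  have hEe : E =ᵐ[volume.restrict U] laurentMonomial α.1 := α.2.2.coeFn_toLp
  have hEint : ‖E‖ ^ p.toReal = ∫ z in U, ‖laurentMonomial α.1 z‖ ^ p.toReal := by
    rw [Lp_norm_rpow_eq_integral hp]
    refine integral_congr_ae (hEe.mono fun z hz => ?_)
    simp only [hz]
  obtain ⟨b₀, hb₀, hb₀i, hb₀n⟩ := exists_norming h1 hp E
  have hb₀' : ∀ f, b₀ f = ∫ z in U, f z * (starRingEnd ℂ (laurentMonomial α z) *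
      (‖laurentMonomial α.1 z‖ ^ (p.toReal - 2) : ℝ)) := fun f => by
    rw [hb₀ f]
    refine integral_congr_ae (hEe.mono fun z hz => ?_)
    simp only [hz]
  obtain ⟨b, hb⟩ : ∃ b : Lp ℂ p (volume.restrict U) →L[ℂ] ℂ,
      b = (((‖E‖ ^ p.toReal)⁻¹ : ℝ) : ℂ) • b₀ := ⟨_, rfl⟩
  have hbf : ∀ f, b f = ((‖E‖ ^ p.toReal)⁻¹ : ℝ) * b₀ f := fun f => by rw [hb]; rfl
  have hcoeff : ∀ (f : bergmanSpace U p) (g : (Fin n → ℂ) → ℂ) (c : ℂ),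
      (f : Lp ℂ p (volume.restrict U)) =ᵐ[volume.restrict U] g →
      (∀ z ∈ U, angularCoeff g α z = c * laurentMonomial α z) → b f = c := by
    intro f g c hfg hc
    have hae : (fun z => (f : Lp ℂ p (volume.restrict U)) z * (starRingEnd ℂ (E z) *
        (‖E z‖ ^ (p.toReal - 2) : ℝ))) =ᵐ[volume.restrict U] fun z => g z *
        (starRingEnd ℂ (laurentMonomial α z) *
          (‖laurentMonomial α.1 z‖ ^ (p.toReal - 2) : ℝ)) := by
      filter_upwards [hEe, hfg] with z hz hz'
      rw [hz, hz']
    rw [hbf, hb₀ f, integral_congr_ae hae,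
      h.integral_mul_conj_laurentMonomial hP hc ((hb₀i f).congr hae), ← hEint]
    rw [mul_left_comm, ← Complex.ofReal_mul, inv_mul_cancel₀ hEP.ne', Complex.ofReal_one, mul_one]
  have hbE : b E = 1 := hcoeff (bergmanMonomial U p α) _ 1 hEe fun z _ => by
    rw [angularCoeff_laurentMonomial, one_mul]
  have hbn : ‖b‖ ≤ ‖E‖⁻¹ := by
    rw [hb, norm_smul, Complex.norm_real, Real.norm_of_nonneg (by positivity)]
    calc (‖E‖ ^ p.toReal)⁻¹ * ‖b₀‖ ≤ (‖E‖ ^ p.toReal)⁻¹ * ‖E‖ ^ (p.toReal - 1) := by gcongr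
      _ = ‖E‖⁻¹ := by
        rw [← Real.rpow_neg hEn.le, ← Real.rpow_add hEn, ← Real.rpow_neg_one]
        congr 1; ring
  have hge : ∀ a : bergmanSpace U p →L[ℂ] ℂ, a (bergmanMonomial U p α) = 1 → ‖E‖⁻¹ ≤ ‖a‖ := by
    intro a ha
    have h2 := a.le_opNorm (bergmanMonomial U p α)
    rw [ha, norm_one] at h2
    rw [inv_le_iff_one_le_mul₀ hEn]
    exact h2
  refine ⟨b, fun f => by rw [hbf, hb₀']; rfl, hcoeff, fun b' => ⟨?_, ?_⟩⟩
  · rintro ⟨a, ha, hab, hn⟩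
    have hab' : ∀ f, a f = b f := fun f => by
      obtain ⟨g, c, -, hfg, hgc, hac⟩ := ha f
      rw [hac, hcoeff f g (c α) hfg fun z hz => h.angularCoeff_eq_of_hasLaurentExpansion hgc α hz]
    have han : ‖a‖ ≤ ‖E‖⁻¹ := by
      refine ContinuousLinearMap.opNorm_le_bound _ (by positivity) fun f => ?_
      rw [hab']
      exact (b.le_opNorm _).trans (by gcongr; exact le_rfl)
    refine eq_of_norming h1 hp hE0 ?_ hbE (hn.le.trans han) hbn
    rw [hE, hab, hab', hbE]
  · rintro rfl
    refine ⟨b'.comp (bergmanSpace U p).subtypeL, fun f => ?_, fun f => rfl, ?_⟩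
    · obtain ⟨g, hg, hfg⟩ := f.2
      obtain ⟨c, hc⟩ := h.exists_hasAngularCoeff hg
      exact ⟨g, c, hg, hfg, h.hasLaurentExpansion hg hc, hcoeff f g (c α) hfg (hc.eq α)⟩
    · refine le_antisymm (hbn.trans (hge _ hbE)) ?_
      refine ContinuousLinearMap.opNorm_le_bound _ (norm_nonneg _) fun f => ?_
      exact b'.le_opNorm f

end HasLogCoordinates
end Coefficient

/-! ### Closedness of the Bergman space -/

section Complete
variable {n : ℕ}

/-- The mean value inequality for holomorphic functions on polydiscs. -/
theorem enorm_mul_volume_ball_le {g : (Fin n → ℂ) → ℂ} {z : Fin n → ℂ} {r : ℝ}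
    (hg : DifferentiableOn ℂ g (Metric.ball z r)) :
    ‖g z‖ₑ * volume (Metric.ball z r) ≤ ∫⁻ w in Metric.ball z r, ‖g w‖ₑ := by
  classical
  set B : Set (Fin n → ℂ) := Metric.ball 0 r
  set F : (Fin n → ℂ) → ℝ≥0∞ := B.indicator fun w => ‖g (z + w)‖ₑ with hF
  have hzB : ∀ w ∈ B, z + w ∈ Metric.ball z r := fun w hw => by
    simpa [B, dist_eq_norm] using hw
  have hFm : Measurable F := by
    have hc : ContinuousOn (fun w => ‖g (z + w)‖ₑ) B :=
      continuous_enorm.comp_continuousOn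
        (hg.continuousOn.comp (by fun_prop : ContinuousOn (fun w => z + w) B) hzB)
    have := hc.measurable_piecewise (continuousOn_const (c := (0 : ℝ≥0∞)))
      (Metric.isOpen_ball.measurableSet)
    rw [hF, ← Set.piecewise_eq_indicator]
    exact this
  have hmem : ∀ (t : UnitAddCircle) (w : Fin n → ℂ), rot (fun _ => t) w ∈ B ↔ w ∈ B := fun t w => by
    have : ‖rot (fun _ => t) w‖ = ‖w‖ := by
      simp only [Pi.norm_def, nnnorm, norm_rot_apply]
    simp only [B, mem_ball_zero_iff, this]
  -- the mean value property on the circle `t ↦ z + e^{2πit} w`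
  have hmean : ∀ w ∈ B, ‖g z‖ₑ ≤ ∫⁻ t : UnitAddCircle, F (rot (fun _ => t) w)
      ∂AddCircle.haarAddCircle := by
    intro w hw
    have hd : DiffContOnCl ℂ (fun ζ : ℂ => g (z + ζ • w)) (Metric.ball 0 1) := by
      refine DifferentiableOn.diffContOnCl (hg.comp (by fun_prop) fun ζ hζ => hzB _ ?_)
      rw [closure_ball _ one_ne_zero, mem_closedBall_zero_iff] at hζ
      rw [mem_ball_zero_iff] at hw ⊢
      rw [norm_smul]
      exact lt_of_le_of_lt (mul_le_of_le_one_left (norm_nonneg _) hζ) hw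
    have h1 := integral_toCircle_of_diffContOnCl hd
    simp only [zero_smul, add_zero] at h1
    rw [← h1]
    refine (enorm_integral_le_lintegral_enorm _).trans (le_of_eq (lintegral_congr fun t => ?_))
    rw [hF, Set.indicator_of_mem ((hmem t w).2 hw)]
    rfl
  have hjoint : Measurable fun x : (Fin n → ℂ) × UnitAddCircle => F (rot (fun _ => x.2) x.1) :=
    hFm.comp ((continuous_rot.comp (by fun_prop : Continuous
      fun x : (Fin n → ℂ) × UnitAddCircle => ((fun _ => x.2 : UnitAddTorus (Fin n)), x.1))).measurable)
  have hvol : volume (Metric.ball z r) = volume B := Measure.addHaar_ball_center _ _ _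
  calc ‖g z‖ₑ * volume (Metric.ball z r) = ∫⁻ _ in B, ‖g z‖ₑ := by
        rw [setLIntegral_const, hvol]
    _ ≤ ∫⁻ w in B, ∫⁻ t : UnitAddCircle, F (rot (fun _ => t) w) ∂AddCircle.haarAddCircle :=
        setLIntegral_mono' Metric.isOpen_ball.measurableSet hmean
    _ = ∫⁻ t : UnitAddCircle, (∫⁻ w in B, F (rot (fun _ => t) w)) ∂AddCircle.haarAddCircle :=
        lintegral_lintegral_swap hjoint.aemeasurable
    _ ≤ ∫⁻ _t : UnitAddCircle, (∫⁻ w, F w) ∂AddCircle.haarAddCircle := by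
        refine lintegral_mono fun t => (setLIntegral_le_lintegral _ _).trans (le_of_eq ?_)
        exact (measurePreserving_rot (fun _ => t)).lintegral_comp hFm
    _ = ∫⁻ w in B, ‖g (z + w)‖ₑ := by
        simp only [lintegral_const, measure_univ, mul_one]
        rw [hF, lintegral_indicator Metric.isOpen_ball.measurableSet]
    _ = ∫⁻ w in Metric.ball z r, ‖g w‖ₑ := by
        have h1 : B = (fun w => z + w) ⁻¹' Metric.ball z r := by
          ext w; simp [B, dist_eq_norm]
        rw [h1]
        exact (measurePreserving_add_left volume z).setLIntegral_comp_preimage_emb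
          (measurableEmbedding_addLeft z) (fun w => ‖g w‖ₑ) _

variable {U : Set (Fin n → ℂ)} {p : ℝ≥0∞} [Fact (1 ≤ p)]

/-- Point evaluations are locally uniformly bounded on `A^p(U)`, and so are the derivatives. -/
theorem exists_norm_le_of_mem_bergmanSpace (hU : IsOpen U) {z₀ : Fin n → ℂ} (hz₀ : z₀ ∈ U) :
    ∃ r > 0, ∃ C, 0 ≤ C ∧ Metric.ball z₀ r ⊆ U ∧ ∀ (f : Lp ℂ p (volume.restrict U))
      (g : (Fin n → ℂ) → ℂ), DifferentiableOn ℂ g U → f =ᵐ[volume.restrict U] g →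
      ∀ z ∈ Metric.ball z₀ r, ‖g z‖ ≤ C * ‖f‖ ∧ ‖fderiv ℂ g z‖ ≤ C * ‖f‖ := by
  obtain ⟨r, hr, hball⟩ : ∃ r > 0, Metric.ball z₀ (3 * r) ⊆ U := by
    obtain ⟨r, hr, h⟩ := Metric.nhds_basis_ball.mem_iff.1 (hU.mem_nhds hz₀)
    exact ⟨r / 3, by positivity, by rwa [mul_div_cancel₀ _ three_ne_zero]⟩
  set V := volume (Metric.ball z₀ r) with hV
  have hV0 : V ≠ 0 := (Metric.measure_ball_pos volume z₀ hr).ne'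
  have hVt : V ≠ ⊤ := measure_ball_lt_top.ne
  set C₀ : ℝ := (V⁻¹ * V ^ (1 - 1 / p.toReal)).toReal with hC₀
  have hC₀t : V⁻¹ * V ^ (1 - 1 / p.toReal) ≠ ⊤ :=
    ENNReal.mul_ne_top (ENNReal.inv_ne_top.2 hV0) (ENNReal.rpow_ne_top_of_ne_zero hV0 hVt)
  have hval : ∀ (f : Lp ℂ p (volume.restrict U)) (g : (Fin n → ℂ) → ℂ), DifferentiableOn ℂ g U →
      f =ᵐ[volume.restrict U] g → ∀ z ∈ Metric.ball z₀ (2 * r), ‖g z‖ ≤ C₀ * ‖f‖ := by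
    intro f g hg hfg z hz
    have hsub : Metric.ball z r ⊆ U := (Metric.ball_subset_ball' (by
      rw [Metric.mem_ball] at hz; linarith)).trans hball
    have h1 := enorm_mul_volume_ball_le (hg.mono hsub)
    rw [Measure.addHaar_ball_center, ← Measure.addHaar_ball_center volume z₀, ← hV] at h1
    have hm : AEStronglyMeasurable g (volume.restrict (Metric.ball z r)) :=
      (hg.mono hsub).continuousOn.aestronglyMeasurable Metric.isOpen_ball.measurableSet
    have h2 := eLpNorm_le_eLpNorm_mul_rpow_measure_univ (Fact.out : 1 ≤ p) hm
    rw [eLpNorm_one_eq_lintegral_enorm, Measure.restrict_apply_univ,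
      Measure.addHaar_ball_center, ← Measure.addHaar_ball_center volume z₀, ← hV,
      ENNReal.toReal_one, div_one] at h2
    have h3 : eLpNorm g p (volume.restrict (Metric.ball z r)) ≤ ‖f‖ₑ := by
      rw [Lp.enorm_def, eLpNorm_congr_ae hfg]
      exact eLpNorm_mono_measure _ (Measure.restrict_mono hsub le_rfl)
    have h4 : ‖g z‖ₑ ≤ (V⁻¹ * V ^ (1 - 1 / p.toReal)) * ‖f‖ₑ := by
      calc ‖g z‖ₑ = V⁻¹ * (‖g z‖ₑ * V) := by
            rw [mul_left_comm, ENNReal.inv_mul_cancel hV0 hVt, mul_one]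
        _ ≤ V⁻¹ * (‖f‖ₑ * V ^ (1 - 1 / p.toReal)) := by
            exact mul_le_mul_right (h1.trans (h2.trans (mul_le_mul_left h3 _))) _
        _ = _ := by ring
    have h5 := ENNReal.toReal_mono (ENNReal.mul_ne_top hC₀t enorm_ne_top) h4
    simpa [ENNReal.toReal_mul, hC₀] using h5
  have hC₀0 : 0 ≤ C₀ := ENNReal.toReal_nonneg
  refine ⟨r, hr, C₀ + 2 * C₀ / r, by positivity, (Metric.ball_subset_ball (by linarith)).trans hball,
    fun f g hg hfg z hz => ⟨?_, ?_⟩⟩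
  · refine (hval f g hg hfg z (Metric.ball_subset_ball (by linarith) hz)).trans ?_
    gcongr
    exact le_add_of_nonneg_right (by positivity)
  · have hsub : Metric.ball z r ⊆ Metric.ball z₀ (2 * r) := Metric.ball_subset_ball' (by
      rw [Metric.mem_ball] at hz; linarith)
    have h1 := Complex.norm_fderiv_le_div_of_mapsTo_ball (f := g) (c := z) (R₁ := r)
      (R₂ := 2 * (C₀ * ‖f‖))
      (hg.mono ((hsub.trans (Metric.ball_subset_ball (by linarith))).trans hball)) (fun w hw => by
        rw [Metric.mem_closedBall, dist_eq_norm]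
        refine (norm_sub_le _ _).trans ?_
        linarith [hval f g hg hfg w (hsub hw), hval f g hg hfg z (hsub (Metric.mem_ball_self hr))]) hr
    refine h1.trans ?_
    rw [show (C₀ + 2 * C₀ / r) * ‖f‖ = C₀ * ‖f‖ + 2 * (C₀ * ‖f‖) / r by ring]
    exact le_add_of_nonneg_left (by positivity)

/-- `A^p(U)` is closed in `L^p(U)`. -/
theorem isClosed_bergmanSpace (hU : IsOpen U) :
    IsClosed (bergmanSpace U p : Set (Lp ℂ p (volume.restrict U))) := by
  refine IsSeqClosed.isClosed fun x f hx hxf => ?_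
  choose g hg hxg using hx
  have hsub : ∀ k l, (x k - x l : Lp ℂ p (volume.restrict U)) =ᵐ[volume.restrict U] (g k - g l) :=
    fun k l => (Lp.coeFn_sub _ _).trans ((hxg k).sub (hxg l))
  have hcau := hxf.cauchySeq
  have hlim : ∀ z ∈ U, ∃ w, Tendsto (fun k => g k z) atTop (𝓝 w) := by
    intro z hz
    obtain ⟨r, hr, C, hC, hball, H⟩ := exists_norm_le_of_mem_bergmanSpace (p := p) hU hz
    refine cauchySeq_tendsto_of_complete ?_
    rw [Metric.cauchySeq_iff'] at hcau ⊢
    intro ε hε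
    obtain ⟨N, hN⟩ := hcau (ε / (C + 1)) (by positivity)
    refine ⟨N, fun k hk => ?_⟩
    have h1 := (H _ _ ((hg k).sub (hg N)) (hsub k N) z (Metric.mem_ball_self hr)).1
    have h2 := hN k hk
    rw [dist_eq_norm] at h2 ⊢
    rw [lt_div_iff₀ (by positivity)] at h2
    refine lt_of_le_of_lt h1 ?_
    nlinarith [norm_nonneg (x k - x N)]
  choose! G hG using hlim
  refine ⟨G, fun z hz => ?_, ?_⟩
  · obtain ⟨r, hr, C, hC, hball, H⟩ := exists_norm_le_of_mem_bergmanSpace (p := p) hU hz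
    have hdiff : ∀ k, ∀ w ∈ Metric.ball z r, HasFDerivAt (g k) (fderiv ℂ (g k) w) w := fun k w hw =>
      ((hg k).differentiableAt (hU.mem_nhds (hball hw))).hasFDerivAt
    -- the derivatives converge locally uniformly, so the pointwise limit is differentiable
    have hunif : UniformCauchySeqOn (fun k => fderiv ℂ (g k)) atTop (Metric.ball z r) := by
      rw [Metric.uniformCauchySeqOn_iff]
      intro ε hε
      rw [Metric.cauchySeq_iff] at hcau
      obtain ⟨N, hN⟩ := hcau (ε / (C + 1)) (by positivity)
      refine ⟨N, fun k hk l hl w hw => ?_⟩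
      have h1 := (H _ _ ((hg k).sub (hg l)) (hsub k l) w hw).2
      rw [fderiv_sub (hdiff k w hw).differentiableAt (hdiff l w hw).differentiableAt] at h1
      have h2 := hN k hk l hl
      rw [dist_eq_norm] at h2 ⊢
      rw [lt_div_iff₀ (by positivity)] at h2
      refine lt_of_le_of_lt h1 ?_
      nlinarith [norm_nonneg (x k - x l)]
    have hlim' : ∀ w ∈ Metric.ball z r, ∃ L, Tendsto (fun k => fderiv ℂ (g k) w) atTop (𝓝 L) :=
      fun w hw => cauchySeq_tendsto_of_complete (hunif.cauchySeq hw)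
    choose! D hD using hlim'
    exact (hasFDerivAt_of_tendstoUniformlyOn Metric.isOpen_ball
      (hunif.tendstoUniformlyOn_of_tendsto hD) hdiff (fun w hw => hG w (hball hw))
      (Metric.mem_ball_self hr)).differentiableAt.differentiableWithinAt
  · obtain ⟨φ, hφ, hae⟩ := (tendstoInMeasure_of_tendsto_Lp hxf).exists_seq_tendsto_ae
    filter_upwards [hae, ae_all_iff.2 hxg, ae_restrict_mem hU.measurableSet] with z h1 h2 h3
    refine tendsto_nhds_unique h1 ?_
    simp only [h2]
    exact (hG z h3).comp hφ.tendsto_atTop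

end Complete

/-! ### Density of torus polynomials -/

section Density
variable {n : ℕ}

/-- The continuous functions on `ℂⁿ` that the torus action multiplies by a character. -/
def torusHomogeneous (n : ℕ) : Submonoid C(Fin n → ℂ, ℂ) where
  carrier := {f | ∃ β, ∀ θ z, f (rot θ z) = UnitAddTorus.mFourier β θ * f z}
  one_mem' := ⟨0, fun θ z => by simp [UnitAddTorus.mFourier_zero]⟩
  mul_mem' := by
    rintro f g ⟨β, hf⟩ ⟨γ, hg⟩
    refine ⟨β + γ, fun θ z => ?_⟩
    rw [ContinuousMap.mul_apply, hf, hg, UnitAddTorus.mFourier_add, ContinuousMap.mul_apply]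
    ring

/-- The linear span of the torus-homogeneous functions, a star subalgebra. -/
noncomputable def torusPolynomials (n : ℕ) : StarSubalgebra ℂ C(Fin n → ℂ, ℂ) where
  toSubalgebra := Algebra.adjoin ℂ (torusHomogeneous n)
  star_mem' := by
    change Algebra.adjoin ℂ (torusHomogeneous n : Set C(Fin n → ℂ, ℂ)) ≤
      star (Algebra.adjoin ℂ (torusHomogeneous n : Set C(Fin n → ℂ, ℂ)))
    refine Algebra.adjoin_le ?_
    rintro f ⟨β, hf⟩
    refine Algebra.subset_adjoin ⟨-β, fun θ z => ?_⟩
    rw [ContinuousMap.star_apply, hf, star_mul', UnitAddTorus.mFourier_neg]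
    rfl

/-- On each torus orbit a torus polynomial is a trigonometric polynomial, with frequencies in a
fixed finite set and coefficients depending continuously on the orbit. -/
theorem exists_finsupp_of_mem_torusPolynomials {q : C(Fin n → ℂ, ℂ)}
    (hq : q ∈ torusPolynomials n) : ∃ a : (Fin n → ℤ) →₀ C(Fin n → ℂ, ℂ), ∀ θ z,
      q (rot θ z) = ∑ α ∈ a.support, a α z * UnitAddTorus.mFourier α θ := by
  have h1 : q ∈ Submodule.span ℂ (torusHomogeneous n : Set C(Fin n → ℂ, ℂ)) := by
    have h2 := Algebra.adjoin_eq_span ℂ (torusHomogeneous n : Set C(Fin n → ℂ, ℂ))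
    rw [Submonoid.closure_eq] at h2
    rw [← h2]; exact hq
  suffices h : ∃ a : (Fin n → ℤ) →₀ C(Fin n → ℂ, ℂ), ∀ θ z,
      q (rot θ z) = a.sum fun α f => f z * UnitAddTorus.mFourier α θ from h
  clear hq
  induction h1 using Submodule.span_induction with
  | mem f hf =>
    obtain ⟨β, hf⟩ := hf
    refine ⟨Finsupp.single β f, fun θ z => ?_⟩
    rw [Finsupp.sum_single_index (by simp), hf, mul_comm]
  | zero => exact ⟨0, fun θ z => by simp⟩
  | add f g _ _ hf hg =>
    obtain ⟨a, ha⟩ := hf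
    obtain ⟨b, hb⟩ := hg
    refine ⟨a + b, fun θ z => ?_⟩
    rw [Finsupp.sum_add_index' (by simp) (by intros; simp [add_mul]), ContinuousMap.add_apply, ha, hb]
  | smul c f _ hf =>
    obtain ⟨a, ha⟩ := hf
    refine ⟨c • a, fun θ z => ?_⟩
    rw [Finsupp.sum_smul_index' (by simp), ContinuousMap.smul_apply, ha, Finsupp.smul_sum]
    simp only [ContinuousMap.smul_apply, smul_eq_mul, mul_assoc]

theorem angularCoeff_of_finsupp {q : (Fin n → ℂ) → ℂ} {a : (Fin n → ℤ) →₀ C(Fin n → ℂ, ℂ)}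
    {z : Fin n → ℂ}
    (ha : ∀ θ, q (rot θ z) = ∑ α ∈ a.support, a α z * UnitAddTorus.mFourier α θ)
    (α : Fin n → ℤ) : angularCoeff q α z = a α z := by
  have h1 : ∀ θ, UnitAddTorus.mFourier (-α) θ * q (rot θ z) =
      ∑ β ∈ a.support, a β z * UnitAddTorus.mFourier (β - α) θ := fun θ => by
    rw [ha, Finset.mul_sum]
    refine Finset.sum_congr rfl fun β _ => ?_
    rw [sub_eq_add_neg, UnitAddTorus.mFourier_add]
    ring
  unfold angularCoeff
  simp only [h1]
  rw [integral_finsetSum _ fun β _ => Continuous.integrable_torus (by fun_prop)]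
  simp only [integral_const_mul, integral_mFourier, sub_eq_zero, mul_ite, mul_one, mul_zero]
  rw [Finset.sum_ite_eq']
  split_ifs with h
  · rfl
  · rw [Finsupp.notMem_support_iff.1 h]; rfl

theorem separatesPoints_torusPolynomials : (torusPolynomials n).SeparatesPoints := by
  intro z w hzw
  obtain ⟨k, hk⟩ := Function.ne_iff.1 hzw
  refine ⟨_, ⟨⟨fun z => z k, by fun_prop⟩, Algebra.subset_adjoin ⟨Pi.single k 1, fun θ z => ?_⟩,
    rfl⟩, hk⟩
  have : UnitAddTorus.mFourier (Pi.single k 1) θ = (AddCircle.toCircle (θ k) : ℂ) := by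
    simp only [UnitAddTorus.mFourier, ContinuousMap.coe_mk]
    rw [Finset.prod_eq_single k]
    · simp
    · intro j _ hj
      simp [Pi.single_eq_of_ne hj]
    · simp
  simp only [ContinuousMap.coe_mk, this, rot]

/-- Density of the torus polynomials in `L^p` of a bounded set. -/
theorem exists_torusPolynomial_eLpNorm_sub_le {U : Set (Fin n → ℂ)} (hU : Bornology.IsBounded U)
    {p : ℝ≥0∞} (h1 : 1 ≤ p) (hp : p ≠ ⊤) {f : (Fin n → ℂ) → ℂ} (hf : MemLp f p (volume.restrict U))
    {ε : ℝ≥0∞} (hε : ε ≠ 0) : ∃ q ∈ torusPolynomials n,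
      eLpNorm (f - (q : (Fin n → ℂ) → ℂ)) p (volume.restrict U) ≤ ε := by
  have hK : IsCompact (closure U) := hU.isCompact_closure
  have : IsFiniteMeasure (volume.restrict U) := isFiniteMeasure_restrict.2
    (measure_mono subset_closure |>.trans_lt hK.measure_lt_top).ne
  obtain ⟨g, -, hfg, hgc, hgm⟩ := hf.exists_hasCompactSupport_eLpNorm_sub_le hp
    (ENNReal.half_pos hε).ne'
  -- uniform approximation on the closure of `U`
  have hSW : ∀ u : C(Fin n → ℂ, ℝ), ∀ δ : ℝ, 0 < δ → ∃ v ∈ torusPolynomials n,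
      ∀ z ∈ closure U, ‖v z - u z‖ < δ := by
    intro u δ hδ
    obtain ⟨v, hv, hvu⟩ :=
      ContinuousMap.exists_mem_subalgebra_near_continuous_of_isCompact_of_separatesPoints
        separatesPoints_torusPolynomials.rclike_to_real u hK hδ
    refine ⟨_, hv, fun z hz => ?_⟩
    have h2 := hvu z hz
    rw [← Complex.norm_real, Complex.ofReal_sub] at h2
    exact h2
  obtain ⟨δ, hδ, hδε⟩ := ENNReal.exists_nnreal_pos_mul_lt
    (ENNReal.rpow_ne_top_of_nonneg (y := p.toReal⁻¹) (by positivity)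
      (measure_ne_top (volume.restrict U) Set.univ)) (ENNReal.half_pos hε).ne'
  have hδ2 : 0 < (δ : ℝ) / 2 := by positivity
  obtain ⟨v, hv, hvu⟩ := hSW ⟨fun z => (g z).re, by fun_prop⟩ _ hδ2
  obtain ⟨w, hw, hwu⟩ := hSW ⟨fun z => (g z).im, by fun_prop⟩ _ hδ2
  refine ⟨v + Complex.I • w, add_mem hv ((torusPolynomials n).smul_mem hw _), ?_⟩
  have hgq : eLpNorm (g - ((v + Complex.I • w : C(Fin n → ℂ, ℂ)) : (Fin n → ℂ) → ℂ)) p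
      (volume.restrict U) ≤ ε / 2 := by
    refine (eLpNorm_le_of_ae_bound (C := δ) ?_).trans ?_
    · refine ae_restrict_of_ae_restrict_of_subset subset_closure
        ((ae_restrict_mem isClosed_closure.measurableSet).mono fun z hz => ?_)
      have h2 : (g - ((v + Complex.I • w : C(Fin n → ℂ, ℂ)) : (Fin n → ℂ) → ℂ)) z =
          -((v z - ((g z).re : ℂ)) + Complex.I * (w z - ((g z).im : ℂ))) := by
        simp only [Pi.sub_apply, ContinuousMap.add_apply, ContinuousMap.smul_apply, smul_eq_mul]
        linear_combination -(Complex.re_add_im (g z))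
      rw [h2, norm_neg]
      refine (norm_add_le _ _).trans ?_
      rw [norm_mul, Complex.norm_I, one_mul]
      have h3 := hvu z hz
      have h4 := hwu z hz
      simp only [ContinuousMap.coe_mk] at h3 h4
      linarith
    · rw [mul_comm, ENNReal.ofReal_coe_nnreal]
      exact hδε.le
  calc eLpNorm (f - ((v + Complex.I • w : C(Fin n → ℂ, ℂ)) : (Fin n → ℂ) → ℂ)) p (volume.restrict U)
      = eLpNorm ((f - g) + (g - ((v + Complex.I • w : C(Fin n → ℂ, ℂ)) : (Fin n → ℂ) → ℂ))) p
        (volume.restrict U) := by rw [sub_add_sub_cancel]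
    _ ≤ ε / 2 + ε / 2 := (eLpNorm_add_le (hf.1.sub hgm.1)
        (hgm.1.sub (ContinuousMap.continuous _).aestronglyMeasurable) h1).trans (add_le_add hfg hgq)
    _ = ε := ENNReal.add_halves ε

end Density

/-! ### Schur's test for the dominating kernel -/

section Schur

/-- The one-dimensional factor of the kernel that dominates the partial sums: the total variation
of `k ↦ (k - l) e^{-ky}` over `k > l`, up to a constant, at `y = s + (P - 1) t`. -/
noncomputable def bergmanKernel (P l s t : ℝ) : ℝ≥0∞ :=
  ENNReal.ofReal (Real.exp (-(l * (s + (P - 1) * t))) / (s + (P - 1) * t))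

/-- The weight of the Schur test for `bergmanKernel`. -/
noncomputable def schurWeight (P Q l s : ℝ) : ℝ≥0∞ :=
  ENNReal.ofReal (Real.exp (-(l * s / Q)) * s ^ (-(1 / (P * Q))))

variable {P Q : ℝ}

theorem Measurable.bergmanKernel {X : Type*} [MeasurableSpace X] {f g : X → ℝ} (hf : Measurable f)
    (hg : Measurable g) (P l : ℝ) : Measurable fun x => bergmanKernel P l (f x) (g x) := by
  unfold _root_.bergmanKernel; fun_prop

theorem measurable_schurWeight (P Q l : ℝ) : Measurable (schurWeight P Q l) := by
  unfold schurWeight; fun_prop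

theorem schurWeight_rpow (l : ℝ) {s e : ℝ} (hs : 0 < s) (he : 0 ≤ e) :
    schurWeight P Q l s ^ e = ENNReal.ofReal (Real.exp (-(l * s * (e / Q))) * s ^ (-(e / (P * Q)))) := by
  unfold schurWeight
  rw [ENNReal.ofReal_rpow_of_nonneg (by positivity) he, Real.mul_rpow (by positivity) (by positivity),
    ← Real.exp_mul, ← Real.rpow_mul hs.le]
  congr 4 <;> ring

/-- The factor `exp (P l t)` is the density of Lebesgue measure in a logarithmic coordinate. The
weights are chosen so that all exponentials in `t` cancel and the Hilbert-type kernel remains. -/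
theorem exists_lintegral_bergmanKernel_right_le (hPQ : P.HolderConjugate Q) :
    ∃ C : ℝ, 0 ≤ C ∧ ∀ l s : ℝ, 0 < s → ∫⁻ t in Set.Ioi (0 : ℝ),
      ENNReal.ofReal (Real.exp (P * l * t)) * (bergmanKernel P l s t * schurWeight P Q l t ^ Q) ≤
        ENNReal.ofReal C * schurWeight P Q l s ^ Q := by
  have hP := hPQ.lt
  have hQ := hPQ.symm.lt
  have ha : 1 / P < 1 := by rw [div_lt_one (by linarith)]; exact hP
  obtain ⟨C, hC, H⟩ := lintegral_hilbert_kernel_le (a := 1 / P) (c := P - 1) (by positivity) ha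
    (by linarith)
  refine ⟨C, hC, fun l s hs => ?_⟩
  have hpt : ∀ t ∈ Set.Ioi (0 : ℝ), ENNReal.ofReal (Real.exp (P * l * t)) *
      (bergmanKernel P l s t * schurWeight P Q l t ^ Q) = ENNReal.ofReal (Real.exp (-(l * s))) *
      ENNReal.ofReal (t ^ (-(1 / P)) / (s + (P - 1) * t)) := by
    intro t ht
    have ht : 0 < t := ht
    have hy : 0 < s + (P - 1) * t := by nlinarith
    rw [schurWeight_rpow l ht (by linarith), bergmanKernel,
      ← ENNReal.ofReal_mul (by positivity), ← ENNReal.ofReal_mul (by positivity),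
      ← ENNReal.ofReal_mul (by positivity)]
    congr 1
    have e1 : Q / (P * Q) = 1 / P := by field_simp
    have e2 : Real.exp (-(l * s)) = Real.exp (P * l * t) *
        (Real.exp (-(l * (s + (P - 1) * t))) * Real.exp (-(l * t * (Q / Q)))) := by
      rw [div_self (by linarith), ← Real.exp_add, ← Real.exp_add]; congr 1; ring
    rw [e1, e2]
    ring
  rw [setLIntegral_congr_fun measurableSet_Ioi hpt, lintegral_const_mul _ (by fun_prop)]
  refine (mul_le_mul_right (H s hs) _).trans (le_of_eq ?_)
  rw [schurWeight_rpow l hs (by linarith), ← ENNReal.ofReal_mul (by positivity),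
    ← ENNReal.ofReal_mul hC]
  congr 1
  have e1 : Q / (P * Q) = 1 / P := by field_simp
  rw [e1, div_self (by linarith : Q ≠ 0), mul_one]
  ring

theorem exists_lintegral_bergmanKernel_left_le (hPQ : P.HolderConjugate Q) :
    ∃ C : ℝ, 0 ≤ C ∧ ∀ l t : ℝ, 0 < t → ∫⁻ s in Set.Ioi (0 : ℝ),
      ENNReal.ofReal (Real.exp (P * l * s)) * (bergmanKernel P l s t * schurWeight P Q l s ^ P) ≤
        ENNReal.ofReal C * schurWeight P Q l t ^ P := by
  have hP := hPQ.lt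
  have hQ := hPQ.symm.lt
  have hP1 : 0 < P - 1 := by linarith
  have ha : 1 / Q < 1 := by rw [div_lt_one (by linarith)]; exact hQ
  obtain ⟨C, hC, H⟩ := lintegral_hilbert_kernel_le (a := 1 / Q) (c := (P - 1)⁻¹) (by positivity) ha
    (by positivity)
  refine ⟨C / (P - 1), by positivity, fun l t ht => ?_⟩
  have hdiv : P / Q = P - 1 := by
    have := hPQ.sub_one_mul_conj
    field_simp; linarith
  have hpt : ∀ s ∈ Set.Ioi (0 : ℝ), ENNReal.ofReal (Real.exp (P * l * s)) *
      (bergmanKernel P l s t * schurWeight P Q l s ^ P) =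
      ENNReal.ofReal (Real.exp (-(l * (P - 1) * t)) / (P - 1)) *
      ENNReal.ofReal (s ^ (-(1 / Q)) / (t + (P - 1)⁻¹ * s)) := by
    intro s hs
    have hs : 0 < s := hs
    have hy : 0 < s + (P - 1) * t := by positivity
    rw [schurWeight_rpow l hs (by linarith), bergmanKernel,
      ← ENNReal.ofReal_mul (by positivity), ← ENNReal.ofReal_mul (by positivity),
      ← ENNReal.ofReal_mul (by positivity)]
    congr 1
    have e1 : P / (P * Q) = 1 / Q := by field_simp
    have e2 : Real.exp (-(l * (P - 1) * t)) = Real.exp (P * l * s) *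
        (Real.exp (-(l * (s + (P - 1) * t))) * Real.exp (-(l * s * (P / Q)))) := by
      rw [hdiv, ← Real.exp_add, ← Real.exp_add]; congr 1; ring
    have e3 : s + (P - 1) * t = (P - 1) * (t + (P - 1)⁻¹ * s) := by field_simp; ring
    rw [e1, e2, e3]
    field_simp
  rw [setLIntegral_congr_fun measurableSet_Ioi hpt, lintegral_const_mul _ (by fun_prop)]
  refine (mul_le_mul_right (H t ht) _).trans (le_of_eq ?_)
  rw [schurWeight_rpow l ht (by linarith), ← ENNReal.ofReal_mul (by positivity),
    ← ENNReal.ofReal_mul (by positivity)]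
  congr 1
  have e1 : P / (P * Q) = 1 / Q := by field_simp
  rw [e1, hdiv, show l * (P - 1) * t = l * t * (P - 1) by ring]
  ring

variable {n : ℕ} {U : Set (Fin n → ℂ)} {A : Matrix (Fin n) (Fin n) ℤ} {M : Matrix (Fin n) (Fin n) ℝ}

theorem measurable_logCoordinate (M : Matrix (Fin n) (Fin n) ℝ) (j : Fin n) :
    Measurable fun z : Fin n → ℂ => M.mulVec (fun k => Real.log ‖z k‖) j := by
  unfold Matrix.mulVec dotProduct
  fun_prop

/-- The Schur test for the product kernel on `U`. -/
theorem HasLogCoordinates.exists_lintegral_bergmanKernel_rpow_le (h : HasLogCoordinates U A M)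
    (hPQ : P.HolderConjugate Q) {l : Fin n → ℝ} (hl : ∀ j, P * l j = -(2 * (∑ k, A k j : ℤ))) :
    ∃ C : ℝ≥0∞, C ≠ ⊤ ∧ ∀ F : (Fin n → ℂ) → ℝ≥0∞, Measurable F →
      ∫⁻ z in U, (∫⁻ w in U, (∏ j, bergmanKernel P (l j) (M.mulVec (fun k => Real.log ‖z k‖) j)
        (M.mulVec (fun k => Real.log ‖w k‖) j)) * F w) ^ P ≤ C * ∫⁻ w in U, F w ^ P := by
  obtain ⟨K, hK, hint⟩ := h.exists_lintegral_prod
  obtain ⟨C₁, hC₁, H₁⟩ := exists_lintegral_bergmanKernel_right_le hPQ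
  obtain ⟨C₂, hC₂, H₂⟩ := exists_lintegral_bergmanKernel_left_le hPQ
  have hT := measurable_logCoordinate M
  have hpos : ∀ᵐ z ∂volume.restrict U, ∀ j, 0 < M.mulVec (fun k => Real.log ‖z k‖) j := by
    filter_upwards [ae_restrict_mem h.isOpen.measurableSet,
      ae_restrict_of_ae (ae_forall_ne_zero n)] with z hz hz0
    exact (h.mem_iff z hz0).1 hz
  have hexp : ∀ j (s : ℝ), Real.exp (-(2 * (∑ k, A k j : ℤ) * s)) = Real.exp (P * l j * s) :=
    fun j s => by rw [hl]; congr 1; ring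
  simp only [hexp] at hint
  set W : (Fin n → ℂ) → ℝ≥0∞ := fun z =>
    ∏ j, schurWeight P Q (l j) (M.mulVec (fun k => Real.log ‖z k‖) j)
  have hW : Measurable W :=
    Finset.measurable_fun_prod _ fun j _ => (measurable_schurWeight P Q (l j)).comp (hT j)
  have hWpos : ∀ {s : ℝ} (j : Fin n), 0 < s → schurWeight P Q (l j) s ≠ 0 := fun j hs => by
    unfold schurWeight
    rw [ne_eq, ENNReal.ofReal_eq_zero, not_le]
    positivity
  refine ⟨(ENNReal.ofReal K * ∏ _j : Fin n, ENNReal.ofReal C₁) ^ (P / Q) *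
    (ENNReal.ofReal K * ∏ _j : Fin n, ENNReal.ofReal C₂), ?_, fun F hF => ?_⟩
  · have hfin : ∀ c : ℝ, ENNReal.ofReal K * ∏ _j : Fin n, ENNReal.ofReal c ≠ ⊤ := fun c =>
      ENNReal.mul_ne_top ENNReal.ofReal_ne_top (ENNReal.prod_ne_top fun _ _ => ENNReal.ofReal_ne_top)
    exact ENNReal.mul_ne_top (ENNReal.rpow_ne_top_of_nonneg
      (div_nonneg hPQ.nonneg hPQ.symm.nonneg) (hfin C₁)) (hfin C₂)
  refine lintegral_schur_le hPQ (h₁ := W) (h₂ := W) ?_ hW hW ?_ ?_ ?_ ?_ hF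
  · refine Finset.measurable_fun_prod _ fun j _ => ?_
    exact ((hT j).comp measurable_fst).bergmanKernel ((hT j).comp measurable_snd) P (l j)
  · filter_upwards [hpos] with z hz
    exact Finset.prod_ne_zero_iff.2 fun j _ => hWpos j (hz j)
  · refine Eventually.of_forall fun z => ?_
    exact ENNReal.prod_ne_top fun j _ => ENNReal.ofReal_ne_top
  · filter_upwards [hpos] with z hz
    have h1 := hint (fun j t => bergmanKernel P (l j) (M.mulVec (fun k => Real.log ‖z k‖) j) t *
      schurWeight P Q (l j) t ^ Q) fun j =>
        (measurable_const.bergmanKernel measurable_id P (l j)).mul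
          ((measurable_schurWeight P Q (l j)).pow_const _)
    simp only [Finset.prod_mul_distrib] at h1
    simp only [W, ← ENNReal.prod_rpow_of_nonneg hPQ.symm.nonneg]
    rw [h1, mul_assoc, ← Finset.prod_mul_distrib]
    gcongr with j
    exact H₁ (l j) _ (hz j)
  · filter_upwards [hpos] with w hw
    have h1 := hint (fun j s => bergmanKernel P (l j) s (M.mulVec (fun k => Real.log ‖w k‖) j) *
      schurWeight P Q (l j) s ^ P) fun j =>
        (measurable_id.bergmanKernel measurable_const P (l j)).mul
          ((measurable_schurWeight P Q (l j)).pow_const _)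
    simp only [Finset.prod_mul_distrib] at h1
    simp only [W, ← ENNReal.prod_rpow_of_nonneg hPQ.nonneg]
    rw [h1, mul_assoc, ← Finset.prod_mul_distrib]
    gcongr with j
    exact H₂ (l j) _ (hw j)

end Schur

/-! ### The multiplier of the partial sums -/

section Multiplier
variable {n : ℕ} {U : Set (Fin n → ℂ)} {A : Matrix (Fin n) (Fin n) ℤ} {M : Matrix (Fin n) (Fin n) ℝ}
  {p : ℝ≥0∞} [Fact (1 ≤ p)]

/-- The phases of the monomials at a point are a character of the torus. -/
theorem exists_laurentMonomial_eq_mFourier_mul (z : Fin n → ℂ) : ∃ θ : UnitAddTorus (Fin n),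
    ∀ α, laurentMonomial α z = UnitAddTorus.mFourier α θ * ‖laurentMonomial α z‖ := by
  obtain ⟨θ, hθ⟩ := exists_rot_eq (z := fun k => (‖z k‖ : ℂ)) (w := z) (fun k => by simp)
  refine ⟨θ, fun α => ?_⟩
  conv_lhs => rw [← hθ, laurentMonomial_rot]
  congr 1
  rw [norm_laurentMonomial, laurentMonomial]
  push_cast
  rfl

theorem exists_conj_laurentMonomial_eq_mFourier_mul (z : Fin n → ℂ) : ∃ θ : UnitAddTorus (Fin n),
    ∀ α, starRingEnd ℂ (laurentMonomial α z) =
      UnitAddTorus.mFourier α θ * ‖laurentMonomial α z‖ := by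
  obtain ⟨θ, hθ⟩ := exists_laurentMonomial_eq_mFourier_mul (fun k => starRingEnd ℂ (z k))
  have h1 : ∀ α, laurentMonomial α (fun k => starRingEnd ℂ (z k)) =
      starRingEnd ℂ (laurentMonomial α z) := fun α => by
    simp only [laurentMonomial, map_prod, map_zpow₀]
  refine ⟨θ, fun α => ?_⟩
  rw [← h1, hθ, h1, RCLike.norm_conj]

/-- For fixed points `z`, `w`, the terms of the kernel of the `N`-th partial sum (up to a constant
factor, see `exists_norm_bergmanMonomial_rpow_mul`), as a function of the index `α`, are a
multiplier of the torus. It is a product of indicators of half-lines, of characters and of functions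
of bounded variation of the linear forms `(α A)_j`, so the bound is a product over `j` and does not
depend on `N`. -/
theorem HasLogCoordinates.exists_isMultiplier (h : HasLogCoordinates U A M) (h1 : 1 < p)
    (hp : p ≠ ⊤) {l : Fin n → ℝ} (hl : ∀ j, p.toReal * l j = -(2 * (∑ k, A k j : ℤ))) :
    ∃ C : ℝ, 0 ≤ C ∧ ∀ (N : ℕ) (z w : Fin n → ℂ), z ∈ U → w ∈ U → (∀ k, z k ≠ 0) →
      (∀ k, w k ≠ 0) → IsMultiplier (torusChar (n := n) p)
        (Set.indicator (allowableIndices U p ∩ squareIndices n N) fun α =>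
          (∏ j, (((∑ k, A k j * α k : ℤ) : ℝ) - l j) : ℝ) * (laurentMonomial α z *
            (starRingEnd ℂ (laurentMonomial α w) * (‖laurentMonomial α w‖ ^ (p.toReal - 2) : ℝ))))
        (C * ∏ j, Real.exp (-(l j * (M.mulVec (fun k => Real.log ‖z k‖) j +
            (p.toReal - 1) * M.mulVec (fun k => Real.log ‖w k‖) j))) /
          (M.mulVec (fun k => Real.log ‖z k‖) j +
            (p.toReal - 1) * M.mulVec (fun k => Real.log ‖w k‖) j)) := by
  classical
  have hp0 : p ≠ 0 := (zero_lt_one.trans h1).ne'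
  have hP : 1 < p.toReal := by
    rw [← ENNReal.toReal_one]; exact (ENNReal.toReal_lt_toReal ENNReal.one_ne_top hp).2 h1
  obtain ⟨R, hR, hhalf⟩ := exists_isMultiplier_halfLine h1 hp
  have hdir : ∀ (a : Fin n → ℤ) (m : ℤ), IsMultiplier (torusChar (n := n) p)
      (fun α => if m ≤ ∑ k, a k * α k then 1 else 0) R := fun a m => (hhalf m).transfer hp a
  have hcoord : ∀ (k : Fin n) (m : ℤ), IsMultiplier (torusChar (n := n) p)
      (fun α => if m ≤ α k then 1 else 0) R := fun k m => by
    have := hdir (Pi.single k 1) m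
    simpa [Pi.single_apply] using this
  have hbox : ∀ (k : Fin n) (N : ℕ), IsMultiplier (torusChar (n := n) p)
      (fun α => if α k ∈ Finset.Icc (-(N : ℤ)) N then 1 else 0) (R * (1 + 1 * R)) := fun k N => by
    have h2 := (hcoord k (-N)).mul ((IsMultiplier.const (torusChar (n := n) p) 1).add
      ((IsMultiplier.const (torusChar (n := n) p) (-1)).mul (hcoord k (N + 1))))
    simp only [norm_neg, norm_one] at h2
    convert! h2 using 2 with α
    simp only [Finset.mem_Icc]
    by_cases ha : -(N : ℤ) ≤ α k <;> by_cases hb : (N : ℤ) + 1 ≤ α k <;>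
      simp [ha, hb] <;> omega
  have hsign : ∀ k : Fin n, IsMultiplier (torusChar (n := n) p)
      (fun α => if (∀ z ∈ U, z k = 0 → 0 ≤ α k) then 1 else 0) (R + 1) := fun k => by
    by_cases hk : ∃ z ∈ U, z k = 0
    · obtain ⟨z, hz, hzk⟩ := hk
      convert! (hcoord k 0).mono (by linarith : R ≤ R + 1) using 2 with α
      exact if_congr ⟨fun H => H z hz hzk, fun H _ _ _ => H⟩ rfl rfl
    · push Not at hk
      convert! (IsMultiplier.const (torusChar (n := n) p) 1).mono
        (by simpa using hR : ‖(1 : ℂ)‖ ≤ R + 1) using 2 with α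
      exact if_pos fun z hz hzk => absurd hzk (hk z hz)
  refine ⟨(∏ _k : Fin n, R * (1 + 1 * R)) * (∏ _k : Fin n, (R + 1)) * ∏ _j : Fin n, 4 * R,
    by positivity, fun N z w hz hw hz0 hw0 => ?_⟩
  obtain ⟨θ, hθ⟩ := exists_laurentMonomial_eq_mFourier_mul z
  obtain ⟨φ, hφ⟩ := exists_conj_laurentMonomial_eq_mFourier_mul w
  set y : Fin n → ℝ := fun j => M.mulVec (fun k => Real.log ‖z k‖) j +
    (p.toReal - 1) * M.mulVec (fun k => Real.log ‖w k‖) j with hy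
  have hypos : ∀ j, 0 < y j := fun j => by
    have h2 := (h.mem_iff z hz0).1 hz j
    have h3 := (h.mem_iff w hw0).1 hw j
    have : 0 < p.toReal - 1 := by linarith
    simp only [hy]; positivity
  -- the integers `k > l j` start at `⌊l j⌋ + 1`; allowability is `(α A)_j > l j` for all `j`
  set g : Fin n → ℤ → ℝ := fun j k =>
    if ⌊l j⌋ + 1 ≤ k then ((k : ℝ) - l j) * Real.exp (-(k * y j)) else 0 with hg
  have hgm : ∀ j, IsMultiplier (torusChar (n := n) p)
      (fun α => (g j (∑ k, A k j * α k) : ℂ)) (4 * (Real.exp (-(l j * y j)) / y j) * R) := fun j =>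
    IsMultiplier.of_variation hR (hdir fun k => A k j)
      (fun k hk => if_neg (not_le.2 hk)) (fun N => variation_linear_mul_exp_le
        (by push_cast; exact Int.lt_floor_add_one _) (hypos j) N)
  -- the box, the sign conditions, the radial factors and the phases
  have hall := (((IsMultiplier.prod Finset.univ fun k _ => hbox k N).mul
    (IsMultiplier.prod Finset.univ fun k _ => hsign k)).mul
    (IsMultiplier.prod Finset.univ fun j _ => hgm j)).mul
    ((isMultiplier_mFourier hp θ).mul (isMultiplier_mFourier hp φ))
  have hC : (∏ _k : Fin n, R * (1 + 1 * R)) * (∏ _k : Fin n, (R + 1)) * (∏ _j : Fin n, 4 * R) *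
      ∏ j, Real.exp (-(l j * y j)) / y j = (∏ _k : Fin n, R * (1 + 1 * R)) *
        (∏ _k : Fin n, (R + 1)) * (∏ j, 4 * (Real.exp (-(l j * y j)) / y j) * R) * (1 * 1) := by
    have h2 : ∏ j, 4 * (Real.exp (-(l j * y j)) / y j) * R =
        (∏ _j : Fin n, 4 * R) * ∏ j, Real.exp (-(l j * y j)) / y j := by
      rw [← Finset.prod_mul_distrib]
      exact Finset.prod_congr rfl fun j _ => by ring
    rw [h2]
    ring
  rw [hC]
  convert! hall using 1
  funext α
  have hind : (∏ k, if α k ∈ Finset.Icc (-(N : ℤ)) N then (1 : ℂ) else 0) =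
      if α ∈ squareIndices n N then 1 else 0 := by
    rw [Finset.prod_ite_zero]
    simp [squareIndices, Fintype.mem_piFinset]
  have hind' : (∏ k, if (∀ z ∈ U, z k = 0 → 0 ≤ α k) then (1 : ℂ) else 0) =
      if (∀ k, ∀ z ∈ U, z k = 0 → 0 ≤ α k) then 1 else 0 := by
    rw [Finset.prod_ite_zero]
    simp
  rw [hind, hind']
  have hlt : ∀ j, (0 < p.toReal * (∑ k, A k j * α k : ℤ) + 2 * (∑ k, A k j : ℤ)) ↔
      ⌊l j⌋ + 1 ≤ ∑ k, A k j * α k := fun j => by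
    rw [Int.add_one_le_iff, Int.floor_lt]
    have h2 : p.toReal * (∑ k, A k j * α k : ℤ) + 2 * (∑ k, A k j : ℤ) =
        p.toReal * ((∑ k, A k j * α k : ℤ) - l j) := by rw [mul_sub, hl]; ring
    rw [h2, mul_pos_iff_of_pos_left (by linarith), sub_pos]
  by_cases hα : α ∈ squareIndices n N
  swap
  · rw [Set.indicator_of_notMem (fun H => hα H.2), if_neg hα]; simp
  by_cases hs : ∀ k, ∀ z ∈ U, z k = 0 → 0 ≤ α k
  swap
  · rw [Set.indicator_of_notMem (fun H => hs ((h.mem_allowableIndices_iff hp0 hp α).1 H.1).1),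
      if_neg hs]; simp
  by_cases hj : ∀ j, ⌊l j⌋ + 1 ≤ ∑ k, A k j * α k
  swap
  · rw [Set.indicator_of_notMem (fun H => hj fun j =>
      (hlt j).1 (((h.mem_allowableIndices_iff hp0 hp α).1 H.1).2 j))]
    push Not at hj
    obtain ⟨j, hj⟩ := hj
    have hgj : g j (∑ k, A k j * α k) = 0 := if_neg (not_le.2 hj)
    rw [Finset.prod_eq_zero (Finset.mem_univ j) (by rw [hgj, Complex.ofReal_zero])]
    simp
  have hmem : α ∈ allowableIndices U p ∩ squareIndices n N :=
    ⟨(h.mem_allowableIndices_iff hp0 hp α).2 ⟨hs, fun j => (hlt j).2 (hj j)⟩, hα⟩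
  rw [Set.indicator_of_mem hmem, if_pos hα, if_pos hs, one_mul, one_mul, hφ]
  rw [hθ]
  have hgα : ∏ j, (g j (∑ k, A k j * α k) : ℂ) =
      ((∏ j, (((∑ k, A k j * α k : ℤ) : ℝ) - l j) : ℝ) : ℂ) *
        ((‖laurentMonomial α z‖ * (‖laurentMonomial α w‖ * ‖laurentMonomial α w‖ ^ (p.toReal - 2)) :
          ℝ) : ℂ) := by
    have hw1 : 0 < ‖laurentMonomial α w‖ := norm_pos_iff.2 (laurentMonomial_ne_zero α hw0)
    rw [← Complex.ofReal_prod, ← Complex.ofReal_mul]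
    congr 1
    have h3 : ‖laurentMonomial α w‖ * ‖laurentMonomial α w‖ ^ (p.toReal - 2) =
        ‖laurentMonomial α w‖ ^ (p.toReal - 1) := by
      rw [mul_comm, ← Real.rpow_add_one hw1.ne']; congr 1; ring
    rw [h3, h.norm_laurentMonomial_eq α hz0, h.norm_laurentMonomial_eq α hw0,
      ← Real.finsetProd_rpow _ _ fun _ _ => Real.exp_nonneg _, ← Finset.prod_mul_distrib,
      ← Finset.prod_mul_distrib]
    refine Finset.prod_congr rfl fun j _ => ?_
    simp only [hg]
    rw [if_pos (hj j), ← Real.exp_mul, ← Real.exp_add]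
    congr 2
    simp only [hy]
    ring
  rw [hgα]
  push_cast
  ring

end Multiplier

/-! ### Uniform bound for the partial sums -/

section PartialSums
variable {n : ℕ} {U : Set (Fin n → ℂ)} {A : Matrix (Fin n) (Fin n) ℤ} {M : Matrix (Fin n) (Fin n) ℝ}
  {p : ℝ≥0∞} [Fact (1 ≤ p)]

theorem lintegral_exp_neg_mul_Ioi {c : ℝ} (hc : 0 < c) :
    ∫⁻ s in Set.Ioi (0 : ℝ), ENNReal.ofReal (Real.exp (-(c * s))) = ENNReal.ofReal c⁻¹ := by
  have h1 := exp_neg_integrableOn_Ioi 0 hc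
  simp only [neg_mul] at h1
  rw [← ofReal_integral_eq_lintegral_ofReal h1 (Eventually.of_forall fun _ => Real.exp_nonneg _)]
  congr 1
  have := integral_exp_mul_Ioi (a := -c) (by linarith) 0
  simpa [neg_mul, inv_neg, div_eq_mul_inv] using this

theorem Lp_enorm_rpow_eq_lintegral {X : Type*} [MeasurableSpace X] {μ : Measure X} (hp : p ≠ ⊤)
    {f : Lp ℂ p μ} {g : X → ℂ} (hfg : f =ᵐ[μ] g) :
    ‖f‖ₑ ^ p.toReal = ∫⁻ x, ‖g x‖ₑ ^ p.toReal ∂μ := by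
  have h0 : p ≠ 0 := (zero_lt_one.trans_le (Fact.out : 1 ≤ p)).ne'
  have hP : 0 < p.toReal := ENNReal.toReal_pos h0 hp
  rw [Lp.enorm_def, eLpNorm_congr_ae hfg, eLpNorm_eq_lintegral_rpow_enorm_toReal h0 hp,
    ← ENNReal.rpow_mul, one_div, inv_mul_cancel₀ hP.ne', ENNReal.rpow_one]

theorem enorm_sum_torusChar_rpow (hp : p ≠ ⊤) (F : Finset (Fin n → ℤ)) (c : (Fin n → ℤ) → ℂ) :
    ‖∑ α ∈ F, c α • torusChar p α‖ₑ ^ p.toReal =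
      ∫⁻ θ, ‖∑ α ∈ F, c α * UnitAddTorus.mFourier α θ‖ₑ ^ p.toReal ∂torusMeasure n := by
  refine Lp_enorm_rpow_eq_lintegral hp ?_
  have : ∑ α ∈ F, c α • torusChar p α = ContinuousMap.toLp (E := ℂ) p (torusMeasure n) ℂ
      (∑ α ∈ F, c α • UnitAddTorus.mFourier α) := by
    simp only [map_sum, map_smul]; rfl
  rw [this]
  refine (ContinuousMap.coeFn_toLp _ _).trans (Eventually.of_forall fun θ => ?_)
  simp [ContinuousMap.sum_apply]

namespace HasLogCoordinates

/-- The norms of the monomials: `‖e_α‖^p` is inversely proportional to a product of affine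
functions of `α`. -/
theorem exists_norm_bergmanMonomial_rpow_mul (h : HasLogCoordinates U A M) (hp : p ≠ ⊤)
    {l : Fin n → ℝ} (hl : ∀ j, p.toReal * l j = -(2 * (∑ k, A k j : ℤ))) :
    ∃ K : ℝ, 0 < K ∧ ∀ α : allowableIndices U p, (‖bergmanMonomial U p α‖ ^ p.toReal)⁻¹ =
      K * ∏ j, (((∑ k, A k j * α.1 k : ℤ) : ℝ) - l j) := by
  have hp0 : p ≠ 0 := (zero_lt_one.trans_le (Fact.out : 1 ≤ p)).ne'
  have hP : 0 < p.toReal := ENNReal.toReal_pos hp0 hp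
  obtain ⟨K, hK, hint⟩ := h.exists_lintegral_laurentMonomial_rpow
  refine ⟨K⁻¹ * ∏ _j : Fin n, p.toReal, by positivity, fun α => ?_⟩
  have hα := ((h.mem_allowableIndices_iff hp0 hp α).1 α.2).2
  have h1 := Lp_enorm_rpow_eq_lintegral hp (f := (bergmanMonomial U p α : Lp ℂ p (volume.restrict U)))
    α.2.2.coeFn_toLp
  rw [hint hP] at h1
  simp only [lintegral_exp_neg_mul_Ioi (hα _)] at h1
  have hpos : ∀ j ∈ Finset.univ, 0 ≤ (p.toReal * (∑ k, A k j * α.1 k : ℤ) +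
      2 * (∑ k, A k j : ℤ))⁻¹ := fun j _ => by have := hα j; positivity
  rw [← ENNReal.ofReal_prod_of_nonneg hpos, ← ENNReal.ofReal_mul hK.le, ← ofReal_norm,
    ENNReal.ofReal_rpow_of_nonneg (norm_nonneg _) hP.le, ENNReal.ofReal_eq_ofReal_iff
      (by positivity) (mul_nonneg hK.le (Finset.prod_nonneg hpos))] at h1
  change (‖(bergmanMonomial U p α : Lp ℂ p (volume.restrict U))‖ ^ p.toReal)⁻¹ = _
  rw [h1, mul_inv, Finset.prod_inv_distrib, inv_inv, mul_assoc, ← Finset.prod_mul_distrib]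
  congr 1
  refine Finset.prod_congr rfl fun j _ => ?_
  rw [mul_sub, hl]; ring

end HasLogCoordinates
end PartialSums

section UniformBound
variable {n : ℕ} {U : Set (Fin n → ℂ)} {A : Matrix (Fin n) (Fin n) ℤ} {M : Matrix (Fin n) (Fin n) ℝ}
  {p : ℝ≥0∞} [Fact (1 ≤ p)]

theorem coeFn_sum_bergmanMonomial (s : Finset (allowableIndices U p))
    (c : allowableIndices U p → ℂ) :
    ((∑ α ∈ s, c α • bergmanMonomial U p α : bergmanSpace U p) : Lp ℂ p (volume.restrict U))
      =ᵐ[volume.restrict U] fun z => ∑ α ∈ s, c α * laurentMonomial α.1 z := by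
  classical
  induction s using Finset.induction_on with
  | empty =>
    simp only [Finset.sum_empty, Submodule.coe_zero]
    exact Lp.coeFn_zero ℂ p (volume.restrict U)
  | insert β s hβ ih =>
    rw [Finset.sum_insert hβ, Submodule.coe_add, Submodule.coe_smul]
    have hE : (bergmanMonomial U p β : Lp ℂ p (volume.restrict U)) =ᵐ[volume.restrict U]
      laurentMonomial β.1 := β.2.2.coeFn_toLp
    filter_upwards [Lp.coeFn_add (c β • (bergmanMonomial U p β : Lp ℂ p (volume.restrict U)))
      ((∑ α ∈ s, c α • bergmanMonomial U p α : bergmanSpace U p) : Lp ℂ p (volume.restrict U)),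
      Lp.coeFn_smul (c β) (bergmanMonomial U p β : Lp ℂ p (volume.restrict U)), ih, hE]
      with z e1 e2 e3 e4
    rw [e1, Pi.add_apply, e2, Pi.smul_apply, e3, e4, Finset.sum_insert hβ, smul_eq_mul]

namespace HasLogCoordinates

/-- The partial sum at `z`, whose frequencies under rotation are carried by the characters, is an
integral over `w` of multipliers applied to the angular coefficients `a α w`. The triangle
inequality bounds its norm in `L^p` of the torus by the action of the positive kernel on the norms
of the angular parts at `w`. -/
theorem exists_enorm_sum_torusChar_le (h : HasLogCoordinates U A M) (h1 : 1 < p)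
    (hp : p ≠ ⊤) {l : Fin n → ℝ} (hl : ∀ j, p.toReal * l j = -(2 * (∑ k, A k j : ℤ))) :
    ∃ C : ℝ≥0∞, C ≠ ⊤ ∧ ∀ (N : ℕ) (F : Finset (Fin n → ℤ)) (a : (Fin n → ℤ) → (Fin n → ℂ) → ℂ)
      (z : Fin n → ℂ), z ∈ U → (∀ k, z k ≠ 0) →
      (∀ α ∈ allowableIndices U p, IntegrableOn (fun w => a α w *
        (starRingEnd ℂ (laurentMonomial α w) *
          (‖laurentMonomial α w‖ ^ (p.toReal - 2) : ℝ))) U) →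
      ‖∑ α ∈ F, (Set.indicator (allowableIndices U p ∩ squareIndices n N) (fun α =>
          (∏ j, (((∑ k, A k j * α k : ℤ) : ℝ) - l j) : ℝ) * laurentMonomial α z *
            ∫ w in U, a α w * (starRingEnd ℂ (laurentMonomial α w) *
              (‖laurentMonomial α w‖ ^ (p.toReal - 2) : ℝ))) α) • torusChar p α‖ₑ ≤
        C * ∫⁻ w in U, (∏ j, bergmanKernel p.toReal (l j) (M.mulVec (fun k => Real.log ‖z k‖) j)
          (M.mulVec (fun k => Real.log ‖w k‖) j)) * ‖∑ α ∈ F, a α w • torusChar p α‖ₑ := by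
  have hP : 1 < p.toReal := by
    rw [← ENNReal.toReal_one]; exact (ENNReal.toReal_lt_toReal ENNReal.one_ne_top hp).2 h1
  obtain ⟨C, hC, hmult⟩ := h.exists_isMultiplier h1 hp hl
  refine ⟨ENNReal.ofReal C, ENNReal.ofReal_ne_top, fun N F a z hz hz0 hint => ?_⟩
  set S : Set (Fin n → ℤ) := allowableIndices U p ∩ squareIndices n N
  set m : (Fin n → ℂ) → (Fin n → ℤ) → ℂ := fun w => S.indicator fun α =>
    (∏ j, (((∑ k, A k j * α k : ℤ) : ℝ) - l j) : ℝ) * (laurentMonomial α z *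
      (starRingEnd ℂ (laurentMonomial α w) * (‖laurentMonomial α w‖ ^ (p.toReal - 2) : ℝ))) with hm
  have hmint : ∀ α, IntegrableOn (fun w => m w α * a α w) U := by
    intro α
    by_cases hα : α ∈ S
    · simp only [hm, Set.indicator_of_mem hα]
      refine ((hint α hα.1).const_mul ((∏ j, (((∑ k, A k j * α k : ℤ) : ℝ) - l j) : ℝ) *
        laurentMonomial α z)).congr (Eventually.of_forall fun w => ?_)
      simp only
      ring
    · simp only [hm, Set.indicator_of_notMem hα, zero_mul]
      exact integrableOn_zero
  have heq : ∀ α, S.indicator (fun α => (∏ j, (((∑ k, A k j * α k : ℤ) : ℝ) - l j) : ℝ) *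
      laurentMonomial α z * ∫ w in U, a α w * (starRingEnd ℂ (laurentMonomial α w) *
        (‖laurentMonomial α w‖ ^ (p.toReal - 2) : ℝ))) α = ∫ w in U, m w α * a α w := by
    intro α
    by_cases hα : α ∈ S
    · simp only [hm, Set.indicator_of_mem hα]
      rw [← integral_const_mul]
      refine integral_congr_ae (Eventually.of_forall fun w => ?_)
      simp only
      ring
    · simp only [hm, Set.indicator_of_notMem hα, zero_mul, integral_zero]
  have hsum : ∑ α ∈ F, (∫ w in U, m w α * a α w) • torusChar p α =
      ∫ w in U, ∑ α ∈ F, (m w α * a α w) • torusChar p α := by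
    rw [integral_finsetSum _ fun α _ => (hmint α).smul_const _]
    simp only [integral_smul_const]
  simp only [heq]
  rw [hsum, ← lintegral_const_mul' _ _ ENNReal.ofReal_ne_top]
  refine (enorm_integral_le_lintegral_enorm _).trans (lintegral_mono_ae ?_)
  filter_upwards [ae_restrict_mem h.isOpen.measurableSet,
    ae_restrict_of_ae (ae_forall_ne_zero n)] with w hw hw0
  have h2 := (hmult N z w hz hw hz0 hw0).2 F fun α => a α w
  have hy : ∀ j, 0 < M.mulVec (fun k => Real.log ‖z k‖) j +
      (p.toReal - 1) * M.mulVec (fun k => Real.log ‖w k‖) j := fun j => by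
    have h2 := (h.mem_iff z hz0).1 hz j
    have h3 := (h.mem_iff w hw0).1 hw j
    have : 0 < p.toReal - 1 := by linarith
    positivity
  rw [← ofReal_norm, ← ofReal_norm, ← mul_assoc]
  unfold bergmanKernel
  have hk : ∀ j ∈ Finset.univ, 0 ≤ Real.exp (-(l j * (M.mulVec (fun k => Real.log ‖z k‖) j +
      (p.toReal - 1) * M.mulVec (fun k => Real.log ‖w k‖) j))) /
      (M.mulVec (fun k => Real.log ‖z k‖) j +
        (p.toReal - 1) * M.mulVec (fun k => Real.log ‖w k‖) j) := fun j _ =>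
    div_nonneg (Real.exp_nonneg _) (hy j).le
  rw [← ENNReal.ofReal_prod_of_nonneg hk, ← ENNReal.ofReal_mul hC,
    ← ENNReal.ofReal_mul (mul_nonneg hC (Finset.prod_nonneg hk))]
  exact ENNReal.ofReal_le_ofReal h2

/-- On a class represented by a function with known angular coefficients, the coefficient
functional is an integral of the angular coefficient. -/
theorem coeffFunctional_eq_integral (h : HasLogCoordinates U A M) (h1 : 1 < p) (hp : p ≠ ⊤)
    {α : allowableIndices U p} {b : Lp ℂ p (volume.restrict U) →L[ℂ] ℂ}
    (hb : ∀ f, b f = ((‖bergmanMonomial U p α‖ ^ p.toReal)⁻¹ : ℝ) *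
        ∫ z in U, f z * (starRingEnd ℂ (laurentMonomial α z) *
          (‖laurentMonomial α.1 z‖ ^ (p.toReal - 2) : ℝ)))
    {f : Lp ℂ p (volume.restrict U)} {q a : (Fin n → ℂ) → ℂ} (hfq : f =ᵐ[volume.restrict U] q)
    (ha : ∀ z, angularCoeff q α z = a z) :
    IntegrableOn (fun w => a w * (starRingEnd ℂ (laurentMonomial α w) *
      (‖laurentMonomial α.1 w‖ ^ (p.toReal - 2) : ℝ))) U ∧
    b f = ((‖bergmanMonomial U p α‖ ^ p.toReal)⁻¹ : ℝ) * ∫ w in U, a w *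
      (starRingEnd ℂ (laurentMonomial α w) *
        (‖laurentMonomial α.1 w‖ ^ (p.toReal - 2) : ℝ)) := by
  obtain ⟨-, -, hint, -⟩ := exists_norming h1 hp
    (bergmanMonomial U p α : Lp ℂ p (volume.restrict U))
  have hE : (bergmanMonomial U p α : Lp ℂ p (volume.restrict U)) =ᵐ[volume.restrict U]
    laurentMonomial α.1 := α.2.2.coeFn_toLp
  have h2 := h.integral_mul_conj_laurentMonomial_eq (P := p.toReal) (α := α.1) (fun z _ => ha z)
    ((hint f).congr (by filter_upwards [hE, hfq] with z hz hz'; rw [hz, hz']))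
  refine ⟨h2.1, ?_⟩
  rw [hb, ← h2.2]
  congr 1
  exact integral_congr_ae (by filter_upwards [hfq] with z hz; rw [hz])

open Classical in
/-- The partial sums are bounded on torus polynomials, uniformly in their order: the multiplier bound
on each torus orbit is followed by the Schur test in the radial variables. -/
theorem exists_norm_partialSum_le (h : HasLogCoordinates U A M) (h1 : 1 < p) (hp : p ≠ ⊤)
    {b : allowableIndices U p → (Lp ℂ p (volume.restrict U) →L[ℂ] ℂ)}
    (hb : ∀ α f, b α f = ((‖bergmanMonomial U p α‖ ^ p.toReal)⁻¹ : ℝ) *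
        ∫ z in U, f z * (starRingEnd ℂ (laurentMonomial α z) *
          (‖laurentMonomial α.1 z‖ ^ (p.toReal - 2) : ℝ))) :
    ∃ C : ℝ, 0 ≤ C ∧ ∀ (N : ℕ), ∀ q ∈ torusPolynomials n, ∀ f : Lp ℂ p (volume.restrict U),
      f =ᵐ[volume.restrict U] q →
      ‖∑ α ∈ (squareIndices n N).subtype (· ∈ allowableIndices U p),
        b α f • bergmanMonomial U p α‖ ≤ C * ‖f‖ := by
  have hP : 1 < p.toReal := by
    rw [← ENNReal.toReal_one]; exact (ENNReal.toReal_lt_toReal ENNReal.one_ne_top hp).2 h1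
  have hP0 : 0 < p.toReal := by linarith
  obtain ⟨l, hl⟩ : ∃ l : Fin n → ℝ, ∀ j, p.toReal * l j = -(2 * (∑ k, A k j : ℤ)) :=
    ⟨fun j => -(2 * (∑ k, A k j : ℤ)) / p.toReal, fun j => by field_simp⟩
  obtain ⟨K, hK, hKα⟩ := h.exists_norm_bergmanMonomial_rpow_mul hp hl
  obtain ⟨C₁, hC₁, H₁⟩ := h.exists_enorm_sum_torusChar_le h1 hp hl
  obtain ⟨C₂, hC₂, H₂⟩ := h.exists_lintegral_bergmanKernel_rpow_le
    (Real.HolderConjugate.conjExponent hP) hl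
  set C : ℝ≥0∞ := ((ENNReal.ofReal K * C₁) ^ p.toReal * C₂) ^ p.toReal⁻¹ with hCdef
  have hCt : C ≠ ⊤ := ENNReal.rpow_ne_top_of_nonneg (by positivity) (ENNReal.mul_ne_top
    (ENNReal.rpow_ne_top_of_nonneg hP0.le (ENNReal.mul_ne_top ENNReal.ofReal_ne_top hC₁)) hC₂)
  refine ⟨C.toReal, ENNReal.toReal_nonneg, fun N q hq f hfq => ?_⟩
  obtain ⟨a, ha⟩ := exists_finsupp_of_mem_torusPolynomials hq
  have hcoeff : ∀ α z, angularCoeff q α z = a α z := fun α z =>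
    angularCoeff_of_finsupp (fun θ => ha θ z) α
  -- the coefficients of `f` as integrals of the angular coefficients
  have hbint : ∀ α : allowableIndices U p, IntegrableOn (fun w => a α w *
      (starRingEnd ℂ (laurentMonomial α w) * (‖laurentMonomial α.1 w‖ ^ (p.toReal - 2) : ℝ))) U ∧
      b α f = (K * ∏ j, (((∑ k, A k j * α.1 k : ℤ) : ℝ) - l j) : ℝ) * ∫ w in U, a α w *
      (starRingEnd ℂ (laurentMonomial α w) *
        (‖laurentMonomial α.1 w‖ ^ (p.toReal - 2) : ℝ)) := by
    intro α
    rw [← hKα]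
    exact h.coeffFunctional_eq_integral h1 hp (hb α) hfq (hcoeff α.1)
  set F : Finset (Fin n → ℤ) := squareIndices n N ∪ a.support with hF
  set v : (Fin n → ℂ) → (Fin n → ℤ) → ℂ := fun z =>
    Set.indicator (allowableIndices U p ∩ squareIndices n N) (fun α =>
      (∏ j, (((∑ k, A k j * α k : ℤ) : ℝ) - l j) : ℝ) * laurentMonomial α z *
        ∫ w in U, a α w * (starRingEnd ℂ (laurentMonomial α w) *
          (‖laurentMonomial α w‖ ^ (p.toReal - 2) : ℝ))) with hv
  set s : Lp ℂ p (volume.restrict U) :=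
    ((∑ α ∈ (squareIndices n N).subtype (· ∈ allowableIndices U p),
      b α f • bergmanMonomial U p α : bergmanSpace U p) : Lp ℂ p (volume.restrict U)) with hs
  have hsv : s =ᵐ[volume.restrict U] fun z => ∑ α ∈ F, (K : ℂ) * v z α := by
    refine (coeFn_sum_bergmanMonomial _ fun α => b α f).trans (Eventually.of_forall fun z => ?_)
    have h4 : ∀ α : allowableIndices U p, α ∈ (squareIndices n N).subtype (· ∈ allowableIndices U p) →
        b α f * laurentMonomial α.1 z = (K : ℂ) * v z α := fun α hα => by
      have hmem : α.1 ∈ allowableIndices U p ∩ squareIndices n N :=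
        ⟨α.2, Finset.mem_subtype.1 hα⟩
      simp only [hv, Set.indicator_of_mem hmem]
      rw [(hbint α).2]
      push_cast
      ring
    simp only
    rw [Finset.sum_congr rfl h4, Finset.sum_subtype_eq_sum_filter (fun α => (K : ℂ) * v z α)]
    refine Finset.sum_subset ((Finset.filter_subset _ _).trans Finset.subset_union_left)
      fun α _ hα => ?_
    rw [Finset.mem_filter] at hα
    simp only [hv]
    rw [Set.indicator_of_notMem fun H => hα ⟨H.2, H.1⟩, mul_zero]
  -- by rotation invariance, the `L^p` norms over `U` are averages of norms over the torus
  have hvrot : ∀ α θ z, v (rot θ z) α = v z α * UnitAddTorus.mFourier α θ := by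
    intro α θ z
    simp only [hv, Set.indicator_apply]
    split_ifs
    · rw [laurentMonomial_rot]; ring
    · rw [zero_mul]
  have hvm : Measurable fun z => ‖∑ α ∈ F, (K : ℂ) * v z α‖ₑ ^ p.toReal := by
    refine (Measurable.enorm (Finset.measurable_fun_sum _ fun α _ => Measurable.const_mul ?_ _)
      ).pow_const _
    simp only [hv, Set.indicator_apply]
    split_ifs
    · exact ((measurable_laurentMonomial α).const_mul _).mul_const _
    · exact measurable_const
  have hGm : Measurable fun w => ‖∑ α ∈ F, a α w • torusChar p α‖ₑ := by
    refine Continuous.measurable (continuous_enorm.comp ?_)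
    exact continuous_finsetSum _ fun α _ => (map_continuous (a α)).smul continuous_const
  have hG : ∫⁻ w in U, ‖∑ α ∈ F, a α w • torusChar p α‖ₑ ^ p.toReal = ‖f‖ₑ ^ p.toReal := by
    rw [Lp_enorm_rpow_eq_lintegral hp hfq,
      ← h.lintegral_rot (F := fun z => ‖q z‖ₑ ^ p.toReal) (by fun_prop)]
    refine lintegral_congr fun w => ?_
    rw [enorm_sum_torusChar_rpow hp]
    refine lintegral_congr fun θ => ?_
    rw [ha]
    congr 2
    refine (Finset.sum_subset Finset.subset_union_right fun α _ hα => ?_).symm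
    rw [Finsupp.notMem_support_iff.1 hα]; simp
  have hmain : ‖s‖ₑ ^ p.toReal ≤ (ENNReal.ofReal K * C₁) ^ p.toReal * C₂ * ‖f‖ₑ ^ p.toReal := by
    rw [Lp_enorm_rpow_eq_lintegral hp hsv,
      ← h.lintegral_rot (F := fun z => ‖∑ α ∈ F, (K : ℂ) * v z α‖ₑ ^ p.toReal) hvm.aemeasurable,
      mul_assoc]
    refine le_trans ?_ (mul_le_mul_right ((H₂ _ hGm).trans_eq (by rw [hG])) _)
    rw [← lintegral_const_mul' _ _ (ENNReal.rpow_ne_top_of_nonneg hP0.le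
      (ENNReal.mul_ne_top ENNReal.ofReal_ne_top hC₁))]
    refine lintegral_mono_ae ?_
    filter_upwards [ae_restrict_mem h.isOpen.measurableSet,
      ae_restrict_of_ae (ae_forall_ne_zero n)] with z hz hz0
    rw [← ENNReal.mul_rpow_of_nonneg _ _ hP0.le]
    have h3 : ∀ θ, ∑ α ∈ F, (K : ℂ) * v (rot θ z) α =
        ∑ α ∈ F, ((K : ℂ) * v z α) * UnitAddTorus.mFourier α θ := fun θ => by
      simp only [hvrot, mul_assoc]
    simp only [h3]
    rw [← enorm_sum_torusChar_rpow hp]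
    refine ENNReal.rpow_le_rpow ?_ hP0.le
    simp only [mul_smul, ← Finset.smul_sum]
    rw [enorm_smul, mul_assoc]
    have hKe : ‖(K : ℂ)‖ₑ = ENNReal.ofReal K := by
      rw [← ofReal_norm, Complex.norm_real, Real.norm_of_nonneg hK.le]
    rw [hKe]
    exact mul_le_mul_right (H₁ N F (fun α w => a α w) z hz hz0 fun α hα => (hbint ⟨α, hα⟩).1) _
  have hmain' : ‖s‖ₑ ≤ C * ‖f‖ₑ := by
    rw [← ENNReal.rpow_le_rpow_iff hP0, ENNReal.mul_rpow_of_nonneg _ _ hP0.le, hCdef,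
      ← ENNReal.rpow_mul, inv_mul_cancel₀ hP0.ne', ENNReal.rpow_one]
    exact hmain
  have := ENNReal.toReal_mono (ENNReal.mul_ne_top hCt enorm_ne_top) hmain'
  rw [ENNReal.toReal_mul, toReal_enorm, toReal_enorm] at this
  exact this

end HasLogCoordinates
end UniformBound

/-! ### Convergence of the partial sums -/

section Convergence
variable {n : ℕ} {U : Set (Fin n → ℂ)} {A : Matrix (Fin n) (Fin n) ℤ} {M : Matrix (Fin n) (Fin n) ℝ}
  {p : ℝ≥0∞} [Fact (1 ≤ p)]

theorem angularCoeff_laurentMonomial_of_ne {α β : Fin n → ℤ} (hαβ : α ≠ β) (z : Fin n → ℂ) :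
    angularCoeff (laurentMonomial β) α z = 0 := by
  have : ∀ θ : UnitAddTorus (Fin n), UnitAddTorus.mFourier (-α) θ * laurentMonomial β (rot θ z) =
      UnitAddTorus.mFourier (-α + β) θ * laurentMonomial β z := fun θ => by
    rw [laurentMonomial_rot, ← mul_assoc, ← UnitAddTorus.mFourier_add]
  simp only [angularCoeff, this]
  rw [integral_mul_const, integral_mFourier, if_neg, zero_mul]
  rwa [neg_add_eq_zero]

namespace HasLogCoordinates

/-- An element of `A^p(U)` all of whose Laurent coefficients with `p`-allowable index vanish is
zero. -/
theorem eq_zero_of_coeff_eq_zero (h : HasLogCoordinates U A M) (hp : p ≠ ⊤)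
    {d : bergmanSpace U p} (hd : ∀ α ∈ allowableIndices U p, ∀ (g : (Fin n → ℂ) → ℂ) (c : ℂ),
      (d : Lp ℂ p (volume.restrict U)) =ᵐ[volume.restrict U] g →
      (∀ z ∈ U, angularCoeff g α z = c * laurentMonomial α z) → c = 0) : d = 0 := by
  obtain ⟨g, hg, hdg⟩ := d.2
  obtain ⟨c, hc⟩ := h.exists_hasAngularCoeff hg
  have hgp : MemLp g p (volume.restrict U) := (memLp_congr_ae hdg).1 (Lp.memLp _)
  have hc0 : ∀ α, c α = 0 := fun α => by
    by_contra hα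
    exact hα (hd α (h.mem_allowableIndices_of_coeff_ne_zero Fact.out hp hg.continuousOn hgp hc hα)
      g (c α) hdg (hc.eq α))
  have hg0 : ∀ z ∈ U, g z = 0 := fun z hz => by
    have h1 := (h.hasLaurentExpansion hg hc).hasSum z hz
    simp only [hc0, zero_mul] at h1
    exact h1.unique hasSum_zero
  refine Subtype.ext ((Lp.eq_zero_iff_ae_eq_zero).2 ?_)
  filter_upwards [hdg, ae_restrict_mem h.isOpen.measurableSet] with z h1 h2
  rw [h1, hg0 z h2]; rfl

end HasLogCoordinates

/-- Uniformly bounded operators that converge pointwise on a dense set converge pointwise. -/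
theorem exists_tendsto_of_dense {E F : Type*} [NormedAddCommGroup E] [NormedSpace ℂ E]
    [NormedAddCommGroup F] [NormedSpace ℂ F] [CompleteSpace F] (S : ℕ → E →L[ℂ] F) {D : Set E}
    (hD : Dense D) {C : ℝ} (hC : 0 ≤ C) (hS : ∀ N, ∀ x ∈ D, ‖S N x‖ ≤ C * ‖x‖)
    (hlim : ∀ x ∈ D, ∃ y, Tendsto (fun N => S N x) atTop (𝓝 y)) (x : E) :
    ∃ y, Tendsto (fun N => S N x) atTop (𝓝 y) := by
  have hbound : ∀ N x, ‖S N x‖ ≤ C * ‖x‖ := fun N x =>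
    (isClosed_le (by fun_prop) (by fun_prop) : IsClosed {x | ‖S N x‖ ≤ C * ‖x‖}).closure_subset_iff.2
      (hS N) (hD x)
  refine cauchySeq_tendsto_of_complete (Metric.cauchySeq_iff'.2 fun ε hε => ?_)
  obtain ⟨x', hx', hxx⟩ := Metric.dense_iff.1 hD x (ε / (2 * C + 1) / 2) (by positivity)
  rw [Metric.mem_ball, dist_comm, dist_eq_norm] at hx'
  obtain ⟨y, hy⟩ := hlim x' hxx
  obtain ⟨N₀, hN₀⟩ := Metric.cauchySeq_iff'.1 hy.cauchySeq (ε / 2) (half_pos hε)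
  refine ⟨N₀, fun N hN => ?_⟩
  have h1 := hN₀ N hN
  rw [dist_eq_norm] at h1 ⊢
  have h2 : S N x - S N₀ x = (S N (x - x') - S N₀ (x - x')) + (S N x' - S N₀ x') := by
    simp only [map_sub]; abel
  rw [h2]
  calc ‖(S N (x - x') - S N₀ (x - x')) + (S N x' - S N₀ x')‖
      ≤ (C * ‖x - x'‖ + C * ‖x - x'‖) + ‖S N x' - S N₀ x'‖ :=
        (norm_add_le _ _).trans (add_le_add_left
          ((norm_sub_le _ _).trans (add_le_add (hbound _ _) (hbound _ _))) _)
    _ ≤ (2 * C + 1) * (ε / (2 * C + 1) / 2) + ‖S N x' - S N₀ x'‖ := by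
        nlinarith [norm_nonneg (x - x')]
    _ < ε := by rw [← mul_div_assoc, mul_div_cancel₀ _ (by positivity)]; linarith

theorem exists_forall_subset_squareIndices (s : Finset (Fin n → ℤ)) :
    ∃ N₀, ∀ N ≥ N₀, s ⊆ squareIndices n N := by
  refine ⟨∑ α ∈ s, ∑ k, (α k).natAbs, fun N hN α hα => ?_⟩
  refine Fintype.mem_piFinset.2 fun k => Finset.mem_Icc.2 ?_
  have h1 : (α k).natAbs ≤ ∑ k, (α k).natAbs :=
    Finset.single_le_sum (f := fun k => (α k).natAbs) (fun _ _ => Nat.zero_le _) (Finset.mem_univ k)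
  have h2 : ∑ k, (α k).natAbs ≤ ∑ α ∈ s, ∑ k, (α k).natAbs :=
    Finset.single_le_sum (f := fun α => ∑ k, (α k).natAbs) (fun _ _ => Nat.zero_le _) hα
  omega

/-- The classes of torus polynomials form a dense subset of `L^p(U)`. -/
theorem dense_torusPolynomials (hU : Bornology.IsBounded U) (hp : p ≠ ⊤) :
    Dense {f : Lp ℂ p (volume.restrict U) | ∃ q ∈ torusPolynomials n, f =ᵐ[volume.restrict U] q} := by
  refine Metric.dense_iff.2 fun f ε hε => ?_
  obtain ⟨q, hq, hfq⟩ := exists_torusPolynomial_eLpNorm_sub_le hU Fact.out hp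
    (Lp.memLp f) (ENNReal.ofReal_pos.2 (half_pos hε)).ne'
  have h2 : MemLp (⇑f - (q : (Fin n → ℂ) → ℂ)) p (volume.restrict U) :=
    ⟨(Lp.aestronglyMeasurable f).sub (map_continuous q).aestronglyMeasurable,
      hfq.trans_lt ENNReal.ofReal_lt_top⟩
  have hqm : MemLp (q : (Fin n → ℂ) → ℂ) p (volume.restrict U) := by
    have h3 := (Lp.memLp f).sub h2
    rwa [sub_sub_cancel] at h3
  refine ⟨hqm.toLp q, ?_, q, hq, hqm.coeFn_toLp⟩
  rw [Metric.mem_ball, dist_comm, dist_eq_norm]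
  rw [Lp.norm_def, eLpNorm_congr_ae ((Lp.coeFn_sub f (hqm.toLp q)).trans
    (EventuallyEq.rfl.sub hqm.coeFn_toLp))]
  exact (ENNReal.toReal_le_of_le_ofReal (half_pos hε).le hfq).trans_lt (half_lt_self hε)

end Convergence

theorem corollary1p3 {n : ℕ} (U : Set (Fin n → ℂ)) (hU : IsMonomialPolyhedron U)
    (p : ℝ≥0∞) [Fact (1 ≤ p)] (hp : 1 < p) (hp_top : p < ⊤) :
    ∃ P : Lp ℂ p (volume.restrict U) →L[ℂ] bergmanSpace U p,
      IsMonomialBasisProjection U p P ∧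
      (∀ P', IsMonomialBasisProjection U p P' → P' = P) ∧
      Function.Surjective P ∧
      ∀ f : bergmanSpace U p, P f = f := by
  classical
  have hpt : p ≠ ⊤ := hp_top.ne
  obtain ⟨A, M, h⟩ := hU.exists_hasLogCoordinates
  choose b hb hcoeff huniq using h.exists_coeffFunctional hp hpt
  have : CompleteSpace (bergmanSpace U p) := (isClosed_bergmanSpace h.isOpen).completeSpace_coe
  set S : ℕ → Lp ℂ p (volume.restrict U) →L[ℂ] bergmanSpace U p := fun N =>
    ∑ α ∈ (squareIndices n N).subtype (· ∈ allowableIndices U p),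
      (b α).smulRight (bergmanMonomial U p α) with hS
  have hSapp : ∀ N f, S N f = ∑ α ∈ (squareIndices n N).subtype (· ∈ allowableIndices U p),
      b α f • bergmanMonomial U p α := fun N f => by
    simp [hS]
  obtain ⟨C, hC, hbound⟩ := h.exists_norm_partialSum_le hp hpt hb
  have hconv : ∀ f, ∃ g, Tendsto (fun N => S N f) atTop (𝓝 g) := by
    refine exists_tendsto_of_dense S (dense_torusPolynomials h.isBounded hpt) hC ?_ ?_
    · rintro N f ⟨q, hq, hfq⟩
      rw [hSapp]
      exact hbound N q hq f hfq
    -- on torus polynomials the partial sums are eventually constant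
    · rintro f ⟨q, hq, hfq⟩
      obtain ⟨a, ha⟩ := exists_finsupp_of_mem_torusPolynomials hq
      have hzero : ∀ α : allowableIndices U p, α.1 ∉ a.support → b α f = 0 := fun α hα => by
        rw [(h.coeffFunctional_eq_integral hp hpt (hb α) hfq (a := 0) fun z => by
          rw [angularCoeff_of_finsupp (fun θ => ha θ z), Finsupp.notMem_support_iff.1 hα]; rfl).2]
        simp
      obtain ⟨N₀, hN₀⟩ := exists_forall_subset_squareIndices a.support
      refine ⟨∑ α ∈ a.support.subtype (· ∈ allowableIndices U p), b α f • bergmanMonomial U p α,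
        tendsto_const_nhds.congr' ?_⟩
      filter_upwards [eventually_ge_atTop N₀] with N hN
      rw [hSapp]
      refine Finset.sum_subset (fun α hα => ?_) fun α _ hα => ?_
      · exact Finset.mem_subtype.2 (hN₀ N hN (Finset.mem_subtype.1 hα))
      · rw [hzero α fun H => hα (Finset.mem_subtype.2 H), zero_smul]
  choose P₀ hP₀ using hconv
  set P : Lp ℂ p (volume.restrict U) →L[ℂ] bergmanSpace U p :=
    continuousLinearMapOfTendsto S (tendsto_pi_nhds.2 hP₀) with hPdef
  have hP : ∀ f, Tendsto (fun N => S N f) atTop (𝓝 (P f)) := hP₀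
  -- the partial sums reproduce the coefficients
  have hbS : ∀ (α : allowableIndices U p) f, ∀ᶠ N in atTop, b α (S N f) = b α f := by
    intro α f
    have hbE : ∀ β : allowableIndices U p, b α (bergmanMonomial U p β) = if β = α then 1 else 0 := by
      intro β
      refine hcoeff α (bergmanMonomial U p β) _ _ β.2.2.coeFn_toLp fun z _ => ?_
      split_ifs with hβ
      · rw [hβ, angularCoeff_laurentMonomial, one_mul]
      · rw [angularCoeff_laurentMonomial_of_ne fun H => hβ (Subtype.ext H.symm), zero_mul]
    obtain ⟨N₀, hN₀⟩ := exists_forall_subset_squareIndices {α.1}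
    filter_upwards [eventually_ge_atTop N₀] with N hN
    have hα : α ∈ (squareIndices n N).subtype (· ∈ allowableIndices U p) :=
      Finset.mem_subtype.2 (hN₀ N hN (Finset.mem_singleton_self _))
    rw [hSapp, Submodule.coe_sum, map_sum, Finset.sum_eq_single_of_mem α hα]
    · rw [Submodule.coe_smul, map_smul, hbE, if_pos rfl, smul_eq_mul, mul_one]
    · intro β _ hβ
      rw [Submodule.coe_smul, map_smul, hbE, if_neg hβ, smul_zero]
  have hproj : ∀ f : bergmanSpace U p, P f = f := by
    intro f
    refine sub_eq_zero.1 (h.eq_zero_of_coeff_eq_zero hpt fun α hα g c hg hc => ?_)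
    rw [← hcoeff ⟨α, hα⟩ (P f - f) g c hg hc, Submodule.coe_sub, map_sub, sub_eq_zero]
    have h2 : Tendsto (fun N => b ⟨α, hα⟩ (S N f)) atTop (𝓝 (b ⟨α, hα⟩ (P f))) :=
      ((b ⟨α, hα⟩).continuous.comp continuous_subtype_val).tendsto _ |>.comp (hP f)
    exact tendsto_nhds_unique (h2.congr' (hbS ⟨α, hα⟩ f)) tendsto_const_nhds
  refine ⟨P, ⟨hproj, b, fun α => (huniq α _).2 rfl, fun f => ?_⟩, fun P' hP' => ?_,
    fun f => ⟨f, hproj f⟩, hproj⟩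
  · simpa only [hSapp] using hP f
  · obtain ⟨b', hb', hlim⟩ := hP'.series
    have hbb : b' = b := funext fun α => (huniq α _).1 (hb' α)
    ext1 f
    refine tendsto_nhds_unique (hlim f) ?_
    rw [hbb]
    simpa only [hSapp] using hP f
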